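/- Notation. Let $\Lambda$ be the ring of symmetric functions over $\mathbb{Q}(z,w)$ in variables $\mathbf{x}=(x_1,x_2,\dots)$, with power sums $p_k$, complete symmetric functions $h_\mu$, Schur functions $s_\lambda$ and Hall pairing $\langle\cdot,\cdot\rangle$. For a partition $\lambda$ and a cell $s$ of its Young diagram let $a(s),l(s)$ be the arm and leg lengths, and put $n(\lambda)=\sum_i(i-1)\lambda_i$. Let $$\tilde H_\lambda(\mathbf{x};q,t)=t^{n(\lambda)}J_\lambda\!\left[\frac{X}{1-t^{-1}};q,t^{-1}\right]$$ be the modified Macdonald symmetric function; here $J_\lambda=\prod_{s\in\lambda}(1-q^{a(s)}t^{l(s)+1})\,P_\lambda(\mathbf{x};q,t)$, where $P_\lambda=s_\lambda+(\text{lower terms})$ are the Macdonald symmetric functions, orthogonal for $\langle p_\lambda,p_\mu\rangle_{q,t}=\delta_{\lambda\mu}z_\lambda\prod_i\frac{1-q^{\lambda_i}}{1-t^{\lambda_i}}$, and $f[X]\mapsto f[X/(1-t)]$ is the substitution $p_k\mapsto p_k/(1-t^k)$. Let $$\mathcal{H}_\lambda(z,w)=\prod_{s\in\lambda}\frac{(z^{2a(s)+1}-w^{2l(s)+1})^{2}}{(z^{2a(s)+2}-w^{2l(s)})(z^{2a(s)}-w^{2l(s)+2})},\qquad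 \Omega=\sum_\lambda\mathcal{H}_\lambda(z,w)\,\tilde H_\lambda(\mathbf{x};z^2,w^2)\,T^{|\lambda|}$$ (genus $1$, one puncture). Let $\operatorname{Log}\Omega=\sum_{d\ge1}\frac{\mu(d)}{d}\psi_d(\log\Omega)$, where $\psi_d$ replaces $x_i,z,w,T$ by their $d$-th powers. For a partition $\mu$ of $n$ put $$\mathbb{H}_\mu(z,w)=(z^2-1)(1-w^2)\,\big\langle [T^n]\operatorname{Log}\Omega,\;h_\mu\big\rangle\in\mathbb{Q}(z,w).$$ For even $k\ge 2$ let $$G_k(T)=-\frac{B_k}{2k}+\sum_{n\ge1}\sum_{d\mid n}d^{k-1}T^n\in\mathbb{Q}[[T]]$$ be the Eisenstein series, where $B_k$ is the $k$-th Bernoulli number. Theorem. For every $n\ge1$ the rational function $\mathbb{H}_{(n-1,1)}$ (for $n=1$ read $(n-1,1)$ as $(1)$) is defined at $(z,w)=(e^{u/2},e^{-u/2})$, that is, it is a quotient of polynomials in $z,w$ whose denominator does not vanish identically in $u$ at this point; and, as formal power series in $T$ over $\mathbb{Q}((u))$, $$1+\sum_{n\ge1}\mathbb{H}_{(n-1,1)}\left(e^{u/2},e^{-u/2}\right)T^n=\frac1u\left(e^{u/2}-e^{-u/2}\right)\exp\Bigg(2\sum_{\substack{k\ge2\\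 k\text{ even}}}G_k(T)\frac{u^k}{k!}\Bigg).$$ In particular, the coefficient of every power of $u$ on the left-hand side, a power series in $T$, lies in the ring of quasi-modular forms $\mathbb{Q}[G_2,G_4,G_6]$. -/

import Mathlib

noncomputable section

namespace CharVar

/-! ### Partitions -/

/-- The parts of a partition in weakly decreasing order. -/
def rows {n : ℕ} (l : n.Partition) : List ℕ := l.parts.sort (· ≥ ·)

/-- `row l i` is the part `λ_{i+1}` (zero beyond the length). -/
def row {n : ℕ} (l : n.Partition) (i : ℕ) : ℕ := (rows l).getD i 0

/-- The number of parts. -/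
def len {n : ℕ} (l : n.Partition) : ℕ := l.parts.card

/-- `col l j` is the part `λ'_{j+1}` of the dual partition. -/
def col {n : ℕ} (l : n.Partition) (j : ℕ) : ℕ := l.parts.countP (fun i => j < i)

/-- The cells `(i, j)` of the Young diagram, rows and columns numbered from `0`. -/
def cells {n : ℕ} (l : n.Partition) : Finset (ℕ × ℕ) :=
  (Finset.range (len l) ×ˢ Finset.range n).filter fun s => s.2 < row l s.1

/-- Arm length: the number of cells strictly to the right of `s` in its row. -/
def arm {n : ℕ} (l : n.Partition) (s : ℕ × ℕ) : ℕ := row l s.1 - (s.2 + 1)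

/-- Leg length: the number of cells strictly below `s` in its column. -/
def leg {n : ℕ} (l : n.Partition) (s : ℕ × ℕ) : ℕ := col l s.2 - (s.1 + 1)

/-- `n(λ) = ∑ (i - 1) λ_i`. -/
def nStat {n : ℕ} (l : n.Partition) : ℕ := ∑ i ∈ Finset.range (len l), i * row l i

/-- `z_λ = ∏ i ^ {m_i} m_i !`. -/
def zNum {n : ℕ} (l : n.Partition) : ℕ :=
  ∏ i ∈ l.parts.toFinset, i ^ l.parts.count i * (l.parts.count i).factorial

/-- The (strict) lexicographic order on the partitions of `n`, a total order which refines the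
dominance order. -/
def LexLT {n : ℕ} (m l : n.Partition) : Prop := rows m < rows l

theorem lexLT_wf (n : ℕ) : WellFounded (LexLT (n := n)) := by
  have : IsTrans n.Partition LexLT := ⟨fun _ _ _ h h' => lt_trans (α := List ℕ) h h'⟩
  have : Std.Irrefl (LexLT (n := n)) := ⟨fun a h => lt_irrefl (rows a) h⟩
  exact Finite.wellFounded_of_trans_of_irrefl _

instance lexWF (n : ℕ) : WellFoundedRelation n.Partition := ⟨LexLT, lexLT_wf n⟩

/-! ### Symmetric functions

Over a field `K` of characteristic zero the ring of symmetric functions in infinitely many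
variables is the polynomial ring in the power sums `p_1, p_2, …`; the variable `X k` of
`MvPolynomial ℕ+ K` stands for `p_k`. -/

/-- The ring of symmetric functions over `K`, presented as `K[p_1, p_2, …]`. -/
abbrev Sym (K : Type*) [Field K] : Type _ := MvPolynomial ℕ+ K

section SymmetricFunctions

variable {K : Type*} [Field K]

/-- The power sum `p_λ = p_{λ_1} p_{λ_2} ⋯`. -/
def psumPart {n : ℕ} (l : n.Partition) : Sym K :=
  (l.parts.map fun i => (MvPolynomial.X i.toPNat' : Sym K)).prod

/-- The complete symmetric function `h_n = ∑_{λ ⊢ n} z_λ⁻¹ p_λ`. -/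
def hsym (n : ℕ) : Sym K :=
  ∑ l : n.Partition, MvPolynomial.C ((zNum l : K)⁻¹) * psumPart l

/-- `h_m` for an integer `m`, with `h_m = 0` for `m < 0`. -/
def hsymInt (m : ℤ) : Sym K := if 0 ≤ m then hsym m.toNat else 0

/-- `h_μ = h_{μ_1} h_{μ_2} ⋯`. -/
def hsymPart {n : ℕ} (l : n.Partition) : Sym K := (l.parts.map fun i => (hsym i : Sym K)).prod

/-- The Schur function `s_λ = det (h_{λ_i - i + j})`. -/
def schur {n : ℕ} (l : n.Partition) : Sym K :=
  Matrix.det (Matrix.of fun i j : Fin (len l) =>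
    (hsymInt ((row l i : ℤ) - (i : ℤ) + (j : ℤ)) : Sym K))

/-- The bilinear form on symmetric functions with
`⟨p_λ, p_μ⟩ = δ_{λ μ} z_λ ∏ c_{λ_i}`. -/
def pairing (c : ℕ+ → K) (f g : Sym K) : K :=
  ∑ a ∈ f.support, f.coeff a * g.coeff a *
    a.prod fun k m => (((k : ℕ) : K) * c k) ^ m * (m.factorial : K)

/-- The Hall pairing, `⟨p_λ, p_μ⟩ = δ_{λ μ} z_λ`. -/
def hall (f g : Sym K) : K := pairing (fun _ => 1) f g

/-- Macdonald's pairing,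
`⟨p_λ, p_μ⟩_{q,t} = δ_{λ μ} z_λ ∏ (1 - q ^ λ_i) / (1 - t ^ λ_i)`. -/
def hallQT (q t : K) (f g : Sym K) : K :=
  pairing (fun k => (1 - q ^ (k : ℕ)) / (1 - t ^ (k : ℕ))) f g

/-- The Macdonald symmetric functions `P_λ(x; q, t)` (for independent parameters `q`, `t`): the
basis which is orthogonal for `⟨ , ⟩_{q,t}` and of the form `P_λ = s_λ + lower terms`, obtained
by the Gram–Schmidt process. -/
def macP (q t : K) {n : ℕ} (l : n.Partition) : Sym K :=
  open Classical in
  schur l - ∑ m : {m : n.Partition // LexLT m l},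
    MvPolynomial.C (hallQT q t (schur l) (macP q t m.1) /
      hallQT q t (macP q t m.1) (macP q t m.1)) * macP q t m.1
termination_by l
decreasing_by all_goals exact m.2

/-- The integral form `J_λ = ∏_s (1 - q ^ a(s) t ^ (l(s) + 1)) P_λ`. -/
def macJ (q t : K) {n : ℕ} (l : n.Partition) : Sym K :=
  MvPolynomial.C (∏ s ∈ cells l, (1 - q ^ arm l s * t ^ (leg l s + 1))) * macP q t l

/-- The plethystic substitution `f[X] ↦ f[X / (1 - t)]`, that is `p_k ↦ p_k / (1 - t ^ k)`. -/
def plethDiv (t : K) : Sym K →ₐ[K] Sym K :=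
  MvPolynomial.aeval fun k : ℕ+ => MvPolynomial.C ((1 - t ^ (k : ℕ))⁻¹) * MvPolynomial.X k

/-- The modified Macdonald symmetric function
`H̃_λ(x; q, t) = t ^ n(λ) J_λ[X / (1 - t⁻¹); q, t⁻¹]`. -/
def macH (q t : K) {n : ℕ} (l : n.Partition) : Sym K :=
  MvPolynomial.C (t ^ nStat l) * plethDiv t⁻¹ (macJ q t⁻¹ l)

end SymmetricFunctions

/-! ### Rational functions in two variables -/

/-- The field `ℚ(z, w)`. -/
abbrev QZW : Type := FractionRing (MvPolynomial (Fin 2) ℚ)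

/-- The variable `z`. -/
def zv : QZW := algebraMap (MvPolynomial (Fin 2) ℚ) QZW (MvPolynomial.X 0)

/-- The variable `w`. -/
def wv : QZW := algebraMap (MvPolynomial (Fin 2) ℚ) QZW (MvPolynomial.X 1)

section Evaluation

variable {L : Type*} [Field L] [Algebra ℚ L]

/-- `f = p / d` with a denominator which does not vanish at the point `a`. -/
def IsFracAt (f : QZW) (a : Fin 2 → L) (x : MvPolynomial (Fin 2) ℚ × MvPolynomial (Fin 2) ℚ) :
    Prop :=
  MvPolynomial.aeval a x.2 ≠ 0 ∧
    f = algebraMap (MvPolynomial (Fin 2) ℚ) QZW x.1 / algebraMap (MvPolynomial (Fin 2) ℚ) QZW x.2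

/-- The rational function `f` is defined at the point `a`. -/
def RegularAt (f : QZW) (a : Fin 2 → L) : Prop := ∃ x, IsFracAt f a x

open Classical in
/-- The value of the rational function `f` at the point `a` (`0` if `f` is not defined there). -/
def evalAt (f : QZW) (a : Fin 2 → L) : L :=
  if h : RegularAt f a then
    MvPolynomial.aeval a h.choose.1 / MvPolynomial.aeval a h.choose.2
  else 0

/-- The value does not depend on the chosen fraction. -/
theorem evalAt_eq (f : QZW) (a : Fin 2 → L)
    (x : MvPolynomial (Fin 2) ℚ × MvPolynomial (Fin 2) ℚ) (hx : IsFracAt f a x) :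
    evalAt f a = MvPolynomial.aeval a x.1 / MvPolynomial.aeval a x.2 := by
  have h : RegularAt f a := ⟨x, hx⟩
  rw [evalAt, dif_pos h]
  obtain ⟨h1, h2⟩ := h.choose_spec
  obtain ⟨h3, h4⟩ := hx
  have inj := IsFractionRing.injective (MvPolynomial (Fin 2) ℚ) QZW
  have ne : ∀ y : MvPolynomial (Fin 2) ℚ, MvPolynomial.aeval a y ≠ 0 →
      algebraMap (MvPolynomial (Fin 2) ℚ) QZW y ≠ 0 := by
    intro y hy h0
    apply hy
    rw [inj (h0.trans (map_zero _).symm), map_zero]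
  rw [h2, div_eq_div_iff (ne _ h1) (ne _ h3), ← map_mul, ← map_mul] at h4
  rw [div_eq_div_iff h1 h3, ← map_mul, ← map_mul, inj h4]

end Evaluation

/-! ### Adams operations and the plethystic logarithm -/

theorem adams_injective (d : ℕ+) : Function.Injective
    ((algebraMap (MvPolynomial (Fin 2) ℚ) QZW).comp
      (MvPolynomial.expand (R := ℚ) (σ := Fin 2) (d : ℕ)).toRingHom) :=
  (IsFractionRing.injective (MvPolynomial (Fin 2) ℚ) QZW).comp
    (MvPolynomial.expand_injective d.pos)

/-- The Adams operation `f(z, w) ↦ f(z ^ d, w ^ d)` of `ℚ(z, w)`. -/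
def adamsK (d : ℕ+) : QZW →+* QZW := IsFractionRing.lift (adams_injective d)

/-- The Adams operation on symmetric functions over `ℚ(z, w)`: `p_k ↦ p_{dk}`, `z ↦ z ^ d`,
`w ↦ w ^ d`. -/
def adams (d : ℕ+) : Sym QZW →+* Sym QZW :=
  MvPolynomial.eval₂Hom (MvPolynomial.C.comp (adamsK d)) fun k => MvPolynomial.X (d * k)

/-- The plethystic logarithm `Log f = ∑_{d ≥ 1} (μ(d) / d) ψ_d (log f)`, where `ψ_d` also sends
`T` to `T ^ d`. -/
def plethLog (f : PowerSeries (Sym QZW)) : PowerSeries (Sym QZW) :=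
  PowerSeries.mk fun n => ∑ d ∈ n.divisors,
    MvPolynomial.C (((ArithmeticFunction.moebius d : ℤ) : QZW) / (d : QZW)) *
      adams d.toPNat' (PowerSeries.coeff (n / d) (PowerSeries.logOf f))

/-! ### The functions `ℍ_μ` (one puncture) -/

/-- The genus `g` hook function `ℋ_λ(z, w)`. -/
def hookFun (g : ℕ) {n : ℕ} (l : n.Partition) : QZW :=
  ∏ s ∈ cells l, (zv ^ (2 * arm l s + 1) - wv ^ (2 * leg l s + 1)) ^ (2 * g) /
    ((zv ^ (2 * arm l s + 2) - wv ^ (2 * leg l s)) *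
      (zv ^ (2 * arm l s) - wv ^ (2 * leg l s + 2)))

/-- `Ω(z, w) = ∑_λ ℋ_λ(z, w) H̃_λ(x; z², w²) T ^ |λ|`. -/
def Omega (g : ℕ) : PowerSeries (Sym QZW) :=
  PowerSeries.mk fun n => ∑ l : n.Partition,
    MvPolynomial.C (hookFun g l) * macH (zv ^ 2) (wv ^ 2) l

/-- `ℍ_μ(z, w) = (z² - 1)(1 - w²) ⟨Log Ω(z, w), h_μ⟩` for genus `g` and one partition `μ`. -/
def bbH (g : ℕ) {n : ℕ} (m : n.Partition) : QZW :=
  (zv ^ 2 - 1) * (1 - wv ^ 2) * hall (PowerSeries.coeff n (plethLog (Omega g))) (hsymPart m)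

/-- The partition `(n, 1)` of `n + 1` (for `n = 0`, the partition `(1)` of `1`). -/
def hookPartition (n : ℕ) : (n + 1).Partition :=
  Nat.Partition.ofSums (n + 1) {n, 1} (by simp)

/-! ### The two sides of the formula -/

/-- The Laurent series `e ^ (c u)`. -/
def expU (c : ℚ) : LaurentSeries ℚ :=
  HahnSeries.ofPowerSeries ℤ ℚ (PowerSeries.rescale c (PowerSeries.exp ℚ))

/-- The point `(e ^ (u / 2), e ^ (- u / 2))` with coordinates in `ℚ((u))`. -/
def eulerPoint : Fin 2 → LaurentSeries ℚ := ![expU (1 / 2), expU (-1 / 2)]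

/-- `1 + ∑_{n ≥ 1} ℍ_{(n-1,1)}(e ^ (u/2), e ^ (-u/2)) T ^ n`, a power series in `T` over
`ℚ((u))`, with genus one. -/
def hookSeries : PowerSeries (LaurentSeries ℚ) :=
  1 + PowerSeries.X * PowerSeries.mk fun n => evalAt (bbH 1 (hookPartition n)) eulerPoint

/-- The Eisenstein series `G_k(T) = - B_k / (2k) + ∑_{n ≥ 1} ∑_{d ∣ n} d ^ (k-1) T ^ n`. -/
def eisG (k : ℕ) : PowerSeries ℚ :=
  PowerSeries.mk fun n =>
    if n = 0 then -bernoulli k / (2 * (k : ℚ)) else ∑ d ∈ n.divisors, (d : ℚ) ^ (k - 1)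

/-- `2 ∑ G_k(T) u ^ k / k!` over the even `k ≥ 2`, as a power series in `u` over `ℚ[[T]]`. -/
def eisExponent : PowerSeries (PowerSeries ℚ) :=
  2 * PowerSeries.mk fun k =>
    if 2 ≤ k ∧ Even k then ((k.factorial : ℚ)⁻¹) • eisG k else 0

/-- `exp f` for a power series without constant term. -/
def expOf (f : PowerSeries (PowerSeries ℚ)) : PowerSeries (PowerSeries ℚ) :=
  (PowerSeries.exp (PowerSeries ℚ)).subst f

/-- Rewrites a power series in `u` over `ℚ[[T]]` as a power series in `T` over `ℚ((u))`. -/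
def swapSeries (f : PowerSeries (PowerSeries ℚ)) : PowerSeries (LaurentSeries ℚ) :=
  PowerSeries.mk fun n => HahnSeries.ofPowerSeries ℤ ℚ
    (PowerSeries.mk fun m => PowerSeries.coeff n (PowerSeries.coeff m f))

/-- The ring `ℚ[G_2, G_4, G_6]` of quasi-modular forms (through their expansions in `T`). -/
def quasiModular : Subalgebra ℚ (PowerSeries ℚ) := Algebra.adjoin ℚ {eisG 2, eisG 4, eisG 6}

/-- The coefficient of `u ^ m` of a power series in `T` over `ℚ((u))`, a power series in `T`. -/
def coeffU (m : ℤ) (f : PowerSeries (LaurentSeries ℚ)) : PowerSeries ℚ :=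
  PowerSeries.mk fun n => (PowerSeries.coeff n f).coeff m

end CharVar

end

/-! On the curve zw = 1 put q = z², so that w⁻² = q. There Macdonald's pairing with parameters (q,
w⁻²) becomes the Hall pairing. The Schur functions are already orthonormal for it (`hall_schur`), so
Gram–Schmidt leaves them alone and P_λ becomes s_λ (`symHasValue_macP`). Each factor of the genus
one hook function becomes 1 (`hasValue_hookFun`).

On homogeneous functions of degree n, pairing with h_n sets all p_k = 1, and pairing with h_{n-1}
h_1 first applies ∂/∂p_1. Combined with the substitution X/(1 - q) this leads to the principal
specialization p_k ↦ 1/(1 - q^k) of s_λ and of ∂s_λ/∂p_1. By the hook formula the first pairing of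
H̃_λ has the value 1, and the second the value ∑ q^(j-i) over the cells (i, j) of λ
(`principal_schur`, `principal_pderiv_schur`, `hasValue_eval_macH`). For d > 1 the image of ψ_d does
not involve p_1, so Log may be replaced by log, and since ∂/∂p_1 is a derivation the logarithm turns
into a quotient (`bbH_eq`). The left-hand side is therefore H = 1 + (q - 1)(1 - q⁻¹) (∑_λ ∑_{(i,j) ∈
λ} q^(j-i) T^|λ|) / (∑_λ T^|λ|).

Peeling off first rows turns the numerator into a q-binomial series with base T, which is a product.
The result is H = ∏_k (1 - T^k)² / ((1 - q T^k)(1 - q⁻¹ T^k)) (`X_pow_dvd_contentSeries`,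
`X_pow_dvd_quotient`).

For q = e^u the logarithmic derivative of H in u is ∑_n ∑_{d ∣ n} (e^(du) - e^(-du)) T^n. This is
the u-derivative of the Eisenstein exponent without its part constant in T. That part is made of
Bernoulli numbers and is cancelled by the logarithmic derivative of (e^(u/2) - e^(-u/2))/u. Both
sides are 1 at u = 0, hence equal (`eq_sinhQuot_mul_swapVars`).

The coefficients of the powers of u are rational polynomials in the G_k. For even k ≥ 4 the series
G_k is a rational polynomial in E₄ and E₆: subtract a multiple of some E₄^a E₆^b to kill the
constant term, divide by the discriminant and use induction on the weight
(`mem_quasiModular_of_qExpansion`). -/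

noncomputable section
namespace CharVar

/-! ### Complete functions and the Hall pairing in the power sum basis. -/

section SymmetricFunctions

variable {K : Type*} [Field K]

/-- The weight `∑ k a_k` of a monomial in the power sums. -/
def wt (a : ℕ+ →₀ ℕ) : ℕ := a.sum fun k m => m * (k : ℕ)

/-- `z_a = ∏ k ^ {a_k} a_k !`. -/
def zFac (a : ℕ+ →₀ ℕ) : ℕ := a.prod fun k m => (k : ℕ) ^ m * m.factorial

/-- The exponent vector of `p_λ`. -/
def expo {n : ℕ} (l : n.Partition) : ℕ+ →₀ ℕ :=
  Multiset.toFinsupp (l.parts.map Nat.toPNat')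

theorem wt_add (a b : ℕ+ →₀ ℕ) : wt (a + b) = wt a + wt b := by
  unfold wt
  exact Finsupp.sum_add_index' (by simp) (by intros; ring)

theorem wt_single (k : ℕ+) (m : ℕ) : wt (Finsupp.single k m) = m * k := by
  simp [wt]

theorem zFac_ne_zero (a : ℕ+ →₀ ℕ) : zFac a ≠ 0 := by
  unfold zFac Finsupp.prod
  exact Finset.prod_ne_zero_iff.2 fun k _ =>
    mul_ne_zero (pow_ne_zero _ k.ne_zero) (Nat.factorial_ne_zero _)

theorem zFac_add_single (a : ℕ+ →₀ ℕ) (k : ℕ+) :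
    zFac (a + Finsupp.single k 1) = (k : ℕ) * (a k + 1) * zFac a := by
  classical
  have h1 : ∀ b : ℕ+ →₀ ℕ, b.support ⊆ a.support ∪ {k} → zFac b =
      ((k : ℕ) ^ b k * (b k).factorial) *
        ∏ j ∈ (a.support ∪ {k}).erase k, ((j : ℕ) ^ b j * (b j).factorial) := by
    intro b hb
    rw [Finset.mul_prod_erase (a.support ∪ {k}) (fun j : ℕ+ => (j : ℕ) ^ b j * (b j).factorial)
      (by simp)]
    unfold zFac
    exact Finsupp.prod_of_support_subset _ hb _ (by simp)
  rw [h1 a (by simp), h1 (a + Finsupp.single k 1)]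
  · have : ∀ j ∈ (a.support ∪ {k}).erase k,
        ((j : ℕ) ^ (a + Finsupp.single k 1 : ℕ+ →₀ ℕ) j *
          ((a + Finsupp.single k 1 : ℕ+ →₀ ℕ) j).factorial) =
        ((j : ℕ) ^ a j * (a j).factorial) := by
      intro j hj
      rw [Finset.mem_erase] at hj
      simp [hj.1.symm]
    rw [Finset.prod_congr rfl this]
    simp [Nat.factorial_succ, pow_succ]
    ring
  · refine Finsupp.support_add.trans (Finset.union_subset_union_right ?_)
    exact Finsupp.support_single_subset

theorem psumPart_eq {n : ℕ} (l : n.Partition) :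
    (psumPart l : Sym K) = MvPolynomial.monomial (expo l) 1 := by
  have : ∀ s : Multiset ℕ+, (s.map fun k => (MvPolynomial.X k : Sym K)).prod =
      MvPolynomial.monomial (Multiset.toFinsupp s) 1 := by
    intro s
    induction s using Multiset.induction_on with
    | empty => simp
    | cons k s ih =>
      rw [Multiset.map_cons, Multiset.prod_cons, ih, ← Multiset.singleton_add, map_add,
        Multiset.toFinsupp_singleton, MvPolynomial.X, MvPolynomial.monomial_mul, one_mul]
  rw [psumPart, expo, ← this, Multiset.map_map]
  rfl

theorem map_toPNat'_map_coe {s : Multiset ℕ} (h : ∀ i ∈ s, 0 < i) :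
    (s.map Nat.toPNat').map (fun k : ℕ+ => (k : ℕ)) = s := by
  rw [Multiset.map_map]
  conv_rhs => rw [← Multiset.map_id s]
  refine Multiset.map_congr rfl fun i hi => ?_
  simp [Nat.toPNat'_coe, h i hi]

theorem expo_injective {n : ℕ} : Function.Injective (expo (n := n)) := by
  intro l m h
  have h1 : l.parts.map Nat.toPNat' = m.parts.map Nat.toPNat' := Multiset.toFinsupp.injective h
  apply Nat.Partition.ext
  rw [← map_toPNat'_map_coe (fun i hi => l.parts_pos hi), h1,
    map_toPNat'_map_coe (fun i hi => m.parts_pos hi)]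

theorem wt_toFinsupp (s : Multiset ℕ+) :
    wt (Multiset.toFinsupp s) = (s.map fun k : ℕ+ => (k : ℕ)).sum := by
  induction s using Multiset.induction_on with
  | empty => simp [wt]
  | cons k s ih =>
    rw [← Multiset.singleton_add, map_add, wt_add, ih, Multiset.toFinsupp_singleton, wt_single]
    simp

theorem wt_expo {n : ℕ} (l : n.Partition) : wt (expo l) = n := by
  rw [expo, wt_toFinsupp, map_toPNat'_map_coe (fun i hi => l.parts_pos hi), l.parts_sum]

theorem exists_expo_eq {n : ℕ} {a : ℕ+ →₀ ℕ} (h : wt a = n) :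
    ∃ l : n.Partition, expo l = a := by
  refine ⟨⟨(Finsupp.toMultiset a).map (fun k : ℕ+ => (k : ℕ)), ?_, ?_⟩, ?_⟩
  · intro i hi
    obtain ⟨k, -, rfl⟩ := Multiset.mem_map.1 hi
    exact k.pos
  · rw [← wt_toFinsupp, Finsupp.toMultiset_toFinsupp, h]
  · unfold expo
    simp [Multiset.map_map]

theorem zNum_eq {n : ℕ} (l : n.Partition) : zNum l = zFac (expo l) := by
  classical
  have hp := map_toPNat'_map_coe (fun i hi => l.parts_pos hi)
  have inj : Function.Injective (fun k : ℕ+ => (k : ℕ)) := PNat.coe_injective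
  unfold zNum zFac expo Finsupp.prod
  conv_lhs => rw [← hp]
  rw [Multiset.toFinsupp_support, Multiset.toFinset_map, Finset.prod_image (inj.injOn)]
  refine Finset.prod_congr rfl fun k _ => ?_
  rw [Multiset.count_map_eq_count' _ _ inj, Multiset.toFinsupp_apply]

theorem coeff_hsym (n : ℕ) (a : ℕ+ →₀ ℕ) :
    MvPolynomial.coeff a (hsym n : Sym K) = if wt a = n then ((zFac a : ℕ) : K)⁻¹ else 0 := by
  classical
  unfold hsym
  simp only [psumPart_eq, MvPolynomial.coeff_sum, MvPolynomial.coeff_C_mul,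
    MvPolynomial.coeff_monomial, mul_ite, mul_one, mul_zero]
  split_ifs with h
  · obtain ⟨l, rfl⟩ := exists_expo_eq h
    rw [Finset.sum_eq_single l]
    · simp [zNum_eq]
    · intro m _ hm
      rw [if_neg fun h' => hm (expo_injective h')]
    · simp
  · refine Finset.sum_eq_zero fun l _ => if_neg ?_
    rintro rfl
    exact h (wt_expo l)

theorem hsym_zero : (hsym 0 : Sym K) = 1 := by
  classical
  ext a
  rw [coeff_hsym, MvPolynomial.coeff_one]
  by_cases h : a = 0
  · subst h; simp [wt, zFac]
  · rw [if_neg, if_neg (Ne.symm h)]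
    intro h0
    apply h
    unfold wt Finsupp.sum at h0
    rw [Finset.sum_eq_zero_iff] at h0
    ext k
    by_contra hk
    have := h0 k (Finsupp.mem_support_iff.2 hk)
    simp at this
    exact hk this

/-- In ∑ h_n t^n = exp(∑ p_k t^k / k) the operator k ∂/∂p_k is multiplication by t^k. -/
theorem pderiv_hsym [CharZero K] (k : ℕ+) (n : ℕ) :
    MvPolynomial.C ((k : ℕ) : K) * MvPolynomial.pderiv k (hsym n : Sym K) =
      if (k : ℕ) ≤ n then hsym (n - k) else 0 := by
  classical
  ext a
  have hz := zFac_add_single a k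
  have hz0 : ((zFac a : ℕ) : K) ≠ 0 := Nat.cast_ne_zero.2 (zFac_ne_zero a)
  have hk0 : ((k : ℕ) : K) ≠ 0 := Nat.cast_ne_zero.2 k.ne_zero
  have ha : ((a k : ℕ) : K) + 1 ≠ 0 := by exact_mod_cast (Nat.succ_ne_zero (a k))
  rw [MvPolynomial.coeff_C_mul, MvPolynomial.coeff_pderiv, coeff_hsym, wt_add, wt_single, one_mul]
  by_cases h : (k : ℕ) ≤ n
  · rw [if_pos h, coeff_hsym]
    by_cases h' : wt a + k = n
    · rw [if_pos h', if_pos (by omega), hz]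
      push_cast
      field_simp
    · rw [if_neg h', if_neg (by omega)]
      simp
  · rw [if_neg h, if_neg (by omega)]
    simp

/-- Newton's identity, checked on the coefficient of each monomial p^a: removing one p_i multiplies
1/z_a by i a_i, and ∑ i a_i is the weight of a. -/
theorem sum_X_mul_hsym [CharZero K] (m : ℕ) :
    ∑ p ∈ Finset.HasAntidiagonal.antidiagonal m,
      (if 0 < p.1 then (MvPolynomial.X p.1.toPNat' : Sym K) else 0) * hsym p.2 =
      MvPolynomial.C (m : K) * hsym m := by
  classical
  ext a
  have hz0 : ((zFac a : ℕ) : K) ≠ 0 := Nat.cast_ne_zero.2 (zFac_ne_zero a)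
  have key : ∀ p ∈ Finset.HasAntidiagonal.antidiagonal m, MvPolynomial.coeff a
      ((if 0 < p.1 then (MvPolynomial.X p.1.toPNat' : Sym K) else 0) * hsym p.2) =
      if wt a = m then (if 0 < p.1 then (p.1 : K) * (a p.1.toPNat') else 0) *
        ((zFac a : ℕ) : K)⁻¹ else 0 := by
    rintro ⟨i, j⟩ hij
    rw [Finset.HasAntidiagonal.mem_antidiagonal] at hij
    simp only at hij ⊢
    by_cases hi : 0 < i
    · rw [if_pos hi, if_pos hi, MvPolynomial.coeff_X_mul']
      have hk : ((i.toPNat' : ℕ+) : ℕ) = i := by simp [Nat.toPNat'_coe, hi]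
      generalize i.toPNat' = k at hk
      subst hk
      by_cases hk : k ∈ a.support
      · obtain ⟨b, rfl⟩ : ∃ b : ℕ+ →₀ ℕ, a = b + Finsupp.single k 1 := by
          refine ⟨a - Finsupp.single k 1, ?_⟩
          rw [tsub_add_cancel_of_le]
          rw [Finsupp.single_le_iff]
          exact Nat.one_le_iff_ne_zero.2 (Finsupp.mem_support_iff.1 hk)
        rw [if_pos hk, add_tsub_cancel_right, coeff_hsym, wt_add, wt_single, one_mul]
        have hb0 : ((zFac b : ℕ) : K) ≠ 0 := Nat.cast_ne_zero.2 (zFac_ne_zero b)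
        have hk0 : ((k : ℕ) : K) ≠ 0 := Nat.cast_ne_zero.2 k.ne_zero
        have hbk : ((b k : ℕ) : K) + 1 ≠ 0 := by exact_mod_cast (Nat.succ_ne_zero (b k))
        by_cases hw : wt b = j
        · rw [if_pos hw, if_pos (by omega), zFac_add_single]
          simp only [Finsupp.add_apply, Finsupp.single_eq_same]
          push_cast
          field_simp
        · rw [if_neg hw, if_neg (by omega)]
      · rw [if_neg hk]
        rw [Finsupp.notMem_support_iff] at hk
        simp [hk]
    · simp [hi]
  rw [MvPolynomial.coeff_sum, Finset.sum_congr rfl key, MvPolynomial.coeff_C_mul, coeff_hsym]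
  split_ifs with hw
  · rw [← Finset.sum_mul]
    congr 1
    rw [Finset.Nat.sum_antidiagonal_eq_sum_range_succ_mk, ← hw, wt, Finsupp.sum, Nat.cast_sum,
      ← Finset.sum_filter]
    symm
    refine Finset.sum_bij_ne_zero (fun k _ _ => (k : ℕ)) ?_ ?_ ?_ ?_
    · intro k hk _
      rw [Finset.mem_filter, Finset.mem_range]
      refine ⟨?_, k.pos⟩
      have h1 : a k * (k : ℕ) ≤ wt a := by
        unfold wt Finsupp.sum
        exact Finset.single_le_sum (f := fun k : ℕ+ => a k * (k : ℕ)) (fun _ _ => Nat.zero_le _) hk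
      have h2 : 1 ≤ a k := Nat.one_le_iff_ne_zero.2 (Finsupp.mem_support_iff.1 hk)
      unfold wt Finsupp.sum at h1
      nlinarith
    · intro k _ _ j _ _ h
      exact PNat.coe_injective h
    · intro i hi hne
      rw [Finset.mem_filter] at hi
      have hk : ((i.toPNat' : ℕ+) : ℕ) = i := by simp [Nat.toPNat'_coe, hi.2]
      have h0 : a i.toPNat' ≠ 0 := by
        intro h0
        exact hne (by simp [h0])
      refine ⟨i.toPNat', Finsupp.mem_support_iff.2 h0, ?_, hk⟩
      rw [hk]
      simp [h0, hi.2.ne']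
    · intro k _ _
      rw [PNat.coe_toPNat']
      push_cast
      ring
  · simp

theorem pairing_eq_sum (c : ℕ+ → K) (f g : Sym K) (s : Finset (ℕ+ →₀ ℕ)) (hs : f.support ⊆ s) :
    pairing c f g = ∑ a ∈ s, f.coeff a * g.coeff a *
      a.prod fun k m => (((k : ℕ) : K) * c k) ^ m * (m.factorial : K) := by
  unfold pairing
  refine Finset.sum_subset hs fun a _ ha => ?_
  rw [MvPolynomial.notMem_support_iff.1 ha]
  simp

theorem hall_eq_sum (f g : Sym K) (s : Finset (ℕ+ →₀ ℕ)) (hs : f.support ⊆ s) :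
    hall f g = ∑ a ∈ s, f.coeff a * g.coeff a * ((zFac a : ℕ) : K) := by
  rw [hall, pairing_eq_sum _ f g s hs]
  refine Finset.sum_congr rfl fun a _ => ?_
  simp [zFac, Finsupp.prod]

theorem hall_comm (f g : Sym K) : hall f g = hall g f := by
  classical
  rw [hall_eq_sum f g (f.support ∪ g.support) Finset.subset_union_left,
    hall_eq_sum g f (f.support ∪ g.support) Finset.subset_union_right]
  exact Finset.sum_congr rfl fun a _ => by ring

theorem hall_add_left (f f' g : Sym K) : hall (f + f') g = hall f g + hall f' g := by
  classical
  rw [hall_eq_sum f g (f.support ∪ f'.support) Finset.subset_union_left,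
    hall_eq_sum f' g (f.support ∪ f'.support) Finset.subset_union_right,
    hall_eq_sum _ g (f.support ∪ f'.support) MvPolynomial.support_add, ← Finset.sum_add_distrib]
  exact Finset.sum_congr rfl fun a _ => by rw [MvPolynomial.coeff_add]; ring

theorem hall_C_mul_left (c : K) (f g : Sym K) :
    hall (MvPolynomial.C c * f) g = c * hall f g := by
  rw [hall_eq_sum f g f.support subset_rfl, hall_eq_sum _ g f.support, Finset.mul_sum]
  · exact Finset.sum_congr rfl fun a _ => by rw [MvPolynomial.coeff_C_mul]; ring
  · rw [← MvPolynomial.smul_eq_C_mul]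
    exact MvPolynomial.support_smul

/-- The Hall pairing as a linear functional of its second argument. -/
def hallRight (f : Sym K) : Sym K →ₗ[K] K where
  toFun := hall f
  map_add' g g' := by rw [hall_comm, hall_add_left, hall_comm g, hall_comm g']
  map_smul' c g := by
    rw [MvPolynomial.smul_eq_C_mul, hall_comm, hall_C_mul_left, hall_comm g]
    rfl

theorem hallRight_apply (f g : Sym K) : hallRight f g = hall f g := rfl

theorem hall_sum_left {ι : Type*} (s : Finset ι) (f : ι → Sym K) (g : Sym K) :
    hall (∑ i ∈ s, f i) g = ∑ i ∈ s, hall (f i) g := by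
  rw [hall_comm, ← hallRight_apply, map_sum]
  exact Finset.sum_congr rfl fun i _ => by rw [hallRight_apply, hall_comm]

theorem hall_C (c : K) (g : Sym K) :
    hall (MvPolynomial.C c) g = c * MvPolynomial.constantCoeff g := by
  rw [hall_eq_sum _ g {0}]
  · simp [zFac, MvPolynomial.constantCoeff_eq]
  · rw [← MvPolynomial.monomial_zero']
    exact MvPolynomial.support_monomial_subset

/-- Multiplication by `p_k` is adjoint to `k ∂ / ∂ p_k`. -/
theorem hall_mul_X (f g : Sym K) (k : ℕ+) :
    hall (f * MvPolynomial.X k) g =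
      hall f (MvPolynomial.C ((k : ℕ) : K) * MvPolynomial.pderiv k g) := by
  rw [hall_eq_sum _ g _ subset_rfl, hall_eq_sum f _ _ subset_rfl, MvPolynomial.support_mul_X,
    Finset.sum_map]
  refine Finset.sum_congr rfl fun a _ => ?_
  rw [addRightEmbedding_apply, MvPolynomial.coeff_mul_X, MvPolynomial.coeff_C_mul,
    MvPolynomial.coeff_pderiv, zFac_add_single]
  push_cast
  ring

/-- The coefficient 1/z_a of h_n cancels the norm z_a of the monomial p^a. -/
theorem hall_hsym [CharZero K] {n : ℕ} (f : Sym K) (hf : ∀ a, f.coeff a ≠ 0 → wt a = n) :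
    hall f (hsym n) = MvPolynomial.eval (fun _ => 1) f := by
  rw [hall_eq_sum f _ _ subset_rfl, MvPolynomial.eval_eq]
  refine Finset.sum_congr rfl fun a ha => ?_
  have hz0 : ((zFac a : ℕ) : K) ≠ 0 := Nat.cast_ne_zero.2 (zFac_ne_zero a)
  rw [coeff_hsym, if_pos (hf a (MvPolynomial.mem_support_iff.1 ha)), mul_assoc,
    inv_mul_cancel₀ hz0]
  simp

end SymmetricFunctions

/-! ### Generating series of specialized power sums and complete functions. -/

section GeneratingSeries

open PowerSeries

variable {K : Type*} [Field K] {R : Type*} [CommRing R]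

/-- `∑_{k ≥ 1} φ(p_k) t ^ k`. -/
def psumSeries (φ : Sym K →+* R) : PowerSeries R :=
  PowerSeries.mk fun k => if 0 < k then φ (MvPolynomial.X k.toPNat') else 0

/-- `∑ φ(h_m) t ^ m`. -/
def hsymSeries (φ : Sym K →+* R) : PowerSeries R := PowerSeries.mk fun m => φ (hsym m)

/-- Newton's identity as a differential equation. Together with `eq_of_X_mul_derivative_eq` it
identifies the series of the h_m under any specialization of the p_k. -/
theorem X_mul_derivative_hsymSeries [CharZero K] (φ : Sym K →+* R) :
    X * d⁄dX R (hsymSeries φ) = psumSeries φ * hsymSeries φ := by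
  ext m
  have h := congrArg φ (sum_X_mul_hsym (K := K) m)
  rw [map_sum] at h
  rw [coeff_mul m (psumSeries φ) (hsymSeries φ)]
  simp only [psumSeries, hsymSeries, coeff_mk]
  have h2 : ∀ p ∈ Finset.HasAntidiagonal.antidiagonal m,
      (if 0 < p.1 then φ (MvPolynomial.X p.1.toPNat') else 0) * φ (hsym p.2) =
      φ ((if 0 < p.1 then (MvPolynomial.X p.1.toPNat' : Sym K) else 0) * hsym p.2) := by
    intro p _
    rw [map_mul]
    split_ifs <;> simp
  rw [Finset.sum_congr rfl h2, h, φ.map_mul, map_natCast, map_natCast]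
  cases m with
  | zero => simp
  | succ m =>
    rw [coeff_succ_X_mul, coeff_derivative, coeff_mk]
    push_cast
    ring

/-- A first order equation `t f' = a f`, `a(0) = 0`, has at most one normalized solution. -/
theorem eq_of_X_mul_derivative_eq [IsAddTorsionFree R] {a f g : PowerSeries R}
    (ha : constantCoeff a = 0)
    (hf : X * d⁄dX R f = a * f) (hg : X * d⁄dX R g = a * g)
    (h0 : constantCoeff f = constantCoeff g) : f = g := by
  have key : ∀ f : PowerSeries R, X * d⁄dX R f = a * f → constantCoeff f = 0 → f = 0 := by
    intro f hf h0
    ext m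
    induction m using Nat.strong_induction_on with
    | _ m ih =>
      cases m with
      | zero => simpa using h0
      | succ m =>
        have h := congrArg (coeff (m + 1)) hf
        rw [coeff_succ_X_mul, coeff_derivative, coeff_mul, Finset.sum_eq_zero] at h
        · have h' : (m + 1) • coeff (m + 1) f = (m + 1) • 0 := by
            rw [nsmul_eq_mul, mul_comm]
            push_cast
            simpa using h
          simpa using nsmul_right_injective (Nat.succ_ne_zero m) h'
        · rintro ⟨i, j⟩ hij
          rw [Finset.HasAntidiagonal.mem_antidiagonal] at hij
          simp only at hij ⊢
          cases i with
          | zero =>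
            rw [coeff_zero_eq_constantCoeff_apply, ha, zero_mul]
          | succ i =>
            rw [ih j (by omega), map_zero, mul_zero]
  have := key (f - g) (by rw [map_sub, mul_sub, mul_sub, hf, hg]) (by simp [h0])
  exact sub_eq_zero.1 this

theorem constantCoeff_psumSeries (φ : Sym K →+* R) : constantCoeff (psumSeries φ) = 0 := by
  simp [psumSeries]

theorem constantCoeff_hsymSeries (φ : Sym K →+* R) : constantCoeff (hsymSeries φ) = 1 := by
  simp [hsymSeries, hsym_zero]

end GeneratingSeries

end CharVar
end

noncomputable section
namespace CharVar

/-! ### The bialternant formula and orthonormality of Jacobi–Trudi determinants. -/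

section Orthonormality

open PowerSeries

theorem derivation_prod {R A ι : Type*} [CommRing R] [CommRing A] [Algebra R A] [DecidableEq ι]
    (D : Derivation R A A) (s : Finset ι) (f : ι → A) :
    D (∏ i ∈ s, f i) = ∑ j ∈ s, (∏ i ∈ s.erase j, f i) • D (f j) := by
  induction s using Finset.induction_on with
  | empty => simp
  | insert a s ha ih =>
    rw [Finset.prod_insert ha, Derivation.leibniz, ih, Finset.sum_insert ha,
      Finset.erase_insert ha, add_comm, Finset.smul_sum]
    congr 1
    refine Finset.sum_congr rfl fun j hj => ?_
    have hne : a ≠ j := by rintro rfl; exact ha hj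
    rw [Finset.erase_insert_of_ne hne, Finset.prod_insert (fun h => ha (Finset.mem_of_mem_erase h)),
      mul_smul]

variable {K : Type*} [Field K] {N : ℕ}

theorem hsymInt_natCast (m : ℕ) : (hsymInt (m : ℤ) : Sym K) = hsym m := by
  simp [hsymInt]

theorem hsymInt_of_neg {m : ℤ} (hm : m < 0) : (hsymInt m : Sym K) = 0 := by
  simp [hsymInt, hm]

theorem pderiv_hsymInt [CharZero K] (k : ℕ+) (m : ℤ) :
    MvPolynomial.C ((k : ℕ) : K) * MvPolynomial.pderiv k (hsymInt m : Sym K) =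
      hsymInt (m - k) := by
  rcases lt_or_ge m 0 with hm | hm
  · have := k.pos
    rw [hsymInt_of_neg hm, hsymInt_of_neg (by omega), map_zero, mul_zero]
  · lift m to ℕ using hm
    rw [hsymInt_natCast, pderiv_hsym]
    split_ifs with h
    · rw [← Nat.cast_sub h, hsymInt_natCast]
    · rw [hsymInt_of_neg (by omega)]

theorem constantCoeff_hsymInt (m : ℤ) :
    MvPolynomial.constantCoeff (hsymInt m : Sym K) = if m = 0 then 1 else 0 := by
  rcases lt_or_ge m 0 with hm | hm
  · rw [hsymInt_of_neg hm, map_zero, if_neg hm.ne]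
  · lift m to ℕ using hm
    rw [hsymInt_natCast, MvPolynomial.constantCoeff_eq, coeff_hsym]
    by_cases h : m = 0
    · subst h; simp [wt, zFac]
    · rw [if_neg, if_neg (by exact_mod_cast h)]
      simpa [wt] using Ne.symm h

variable (K N) in
/-- Specialization of a symmetric function to `N` variables. -/
def toVars : Sym K →ₐ[K] MvPolynomial (Fin N) K :=
  MvPolynomial.aeval fun k : ℕ+ => ∑ i, MvPolynomial.X i ^ (k : ℕ)

/-- Pairing with products of complete functions extracts coefficients of monomials. -/
theorem hall_prod_hsymInt [CharZero K] (f : Sym K) (α β : Fin N →₀ ℕ) :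
    hall f (∏ i, hsymInt ((α i : ℤ) - β i)) =
      MvPolynomial.coeff α (toVars K N f * MvPolynomial.monomial β 1) := by
  classical
  induction f using MvPolynomial.induction_on generalizing β with
  | C c =>
    rw [hall_C, map_prod, toVars, MvPolynomial.algHom_C, MvPolynomial.algebraMap_eq,
      MvPolynomial.coeff_C_mul, MvPolynomial.coeff_monomial]
    congr 1
    simp only [constantCoeff_hsymInt, Finset.prod_ite_zero, Finset.prod_const_one]
    refine if_congr ?_ rfl rfl
    simp only [Finset.mem_univ, true_imp_iff, sub_eq_zero, Nat.cast_inj, Finsupp.ext_iff]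
    exact forall_congr' fun _ => eq_comm
  | add p q hp hq =>
    rw [hall_add_left, hp, hq, map_add, add_mul, MvPolynomial.coeff_add]
  | mul_X p k ih =>
    -- Multiplication by p_k is adjoint to k ∂/∂p_k, which lowers one index of the product by k. In
    -- N variables this matches multiplication by ∑ x_j^k.
    have h1 : MvPolynomial.C ((k : ℕ) : K) * MvPolynomial.pderiv k
        (∏ i, (hsymInt ((α i : ℤ) - β i) : Sym K)) =
        ∑ j, ∏ i, hsymInt ((α i : ℤ) - (β + Finsupp.single j (k : ℕ) : Fin N →₀ ℕ) i) := by
      rw [derivation_prod, Finset.mul_sum]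
      refine Finset.sum_congr rfl fun j _ => ?_
      rw [smul_eq_mul, mul_left_comm, pderiv_hsymInt,
        ← Finset.prod_erase_mul Finset.univ _ (Finset.mem_univ j)]
      congr 1
      · refine Finset.prod_congr rfl fun i hi => ?_
        rw [Finset.mem_erase] at hi
        simp [hi.1.symm]
      · simp [sub_sub]
    rw [hall_mul_X, h1, ← hallRight_apply, map_sum]
    simp only [hallRight_apply, ih]
    rw [← MvPolynomial.coeff_sum, ← Finset.mul_sum, map_mul, mul_assoc]
    congr 2
    simp only [toVars, MvPolynomial.aeval_X, Finset.sum_mul]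
    refine Finset.sum_congr rfl fun j _ => ?_
    rw [MvPolynomial.X_pow_eq_monomial, MvPolynomial.monomial_mul, one_mul, add_comm]

theorem mk_pow_mul_one_sub {R : Type*} [CommRing R] (x : R) :
    (PowerSeries.mk fun m => x ^ m) * (1 - C x * X) = 1 := by
  ext m
  rw [mul_sub, mul_one, map_sub, ← mul_assoc, mul_comm _ (C x), mul_assoc]
  cases m with
  | zero => simp
  | succ m => simp [coeff_one, pow_succ']

theorem X_mul_derivative_mk_pow {R : Type*} [CommRing R] (x : R) :
    X * d⁄dX R (PowerSeries.mk fun m => x ^ m) =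
      (PowerSeries.mk fun k => if 0 < k then x ^ k else 0) * PowerSeries.mk fun m => x ^ m := by
  have h1 := mk_pow_mul_one_sub x
  set G := PowerSeries.mk fun m => x ^ m with hG
  have h2 : (PowerSeries.mk fun k => if 0 < k then x ^ k else 0) = G - 1 := by
    ext k
    cases k <;> simp [hG, coeff_one]
  have h3 := congrArg (d⁄dX R) h1
  rw [Derivation.leibniz] at h3
  simp only [map_sub, Derivation.map_one_eq_zero, Derivation.leibniz, derivative_X, derivative_C,
    smul_eq_mul] at h3
  rw [h2]
  have h4 : X * d⁄dX R G * (1 - C x * X) = G * (C x * X) := by linear_combination X * h3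
  calc X * d⁄dX R G = X * d⁄dX R G * (G * (1 - C x * X)) := by rw [h1, mul_one]
    _ = (X * d⁄dX R G * (1 - C x * X)) * G := by ring
    _ = G * (1 - (1 - C x * X)) * G := by rw [h4]; ring
    _ = (G - 1) * G := by rw [mul_sub, h1, mul_one]

/-- Both sides solve t f' = (∑ p_k t^k) f, because logarithmic derivatives of the geometric series
add up to the power sums. -/
theorem hsymSeries_toVars [CharZero K] :
    hsymSeries (toVars K N : Sym K →+* MvPolynomial (Fin N) K) =
      ∏ i : Fin N, PowerSeries.mk fun m => (MvPolynomial.X i : MvPolynomial (Fin N) K) ^ m := by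
  classical
  refine eq_of_X_mul_derivative_eq (constantCoeff_psumSeries _) (X_mul_derivative_hsymSeries _)
    ?_ ?_
  · have hp : psumSeries (toVars K N : Sym K →+* MvPolynomial (Fin N) K) =
        ∑ i : Fin N, PowerSeries.mk fun k => if 0 < k then
          (MvPolynomial.X i : MvPolynomial (Fin N) K) ^ k else 0 := by
      ext1 k
      rw [map_sum]
      simp only [psumSeries, coeff_mk]
      split_ifs with h
      · simp [toVars, Nat.toPNat'_coe, h]
      · simp
    rw [hp, derivation_prod, Finset.mul_sum, Finset.sum_mul]
    refine Finset.sum_congr rfl fun j _ => ?_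
    rw [smul_eq_mul, mul_left_comm, X_mul_derivative_mk_pow,
      ← Finset.mul_prod_erase Finset.univ _ (Finset.mem_univ j)]
    ring
  · rw [constantCoeff_hsymSeries, map_prod]
    simp

/-- `∏_{i ≠ k} (1 - x_i t)`. -/
def elemSeries (K : Type*) [Field K] {N : ℕ} (k : Fin N) : PowerSeries (MvPolynomial (Fin N) K) :=
  ∏ i ∈ Finset.univ.erase k, (1 - C (MvPolynomial.X i : MvPolynomial (Fin N) K) * X)

theorem coeff_elemSeries (k : Fin N) {m : ℕ} (hm : N ≤ m) : coeff m (elemSeries K k) = 0 := by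
  classical
  have key : ∀ (s : Finset (Fin N)) (m : ℕ), s.card < m →
      coeff m (∏ i ∈ s, (1 - C (MvPolynomial.X i : MvPolynomial (Fin N) K) * X)) = 0 := by
    intro s
    induction s using Finset.induction_on with
    | empty =>
      intro m hm
      rw [Finset.prod_empty, coeff_one, if_neg]
      rintro rfl
      simp at hm
    | insert i s hi ih =>
      intro m hm
      rw [Finset.card_insert_of_notMem hi] at hm
      obtain ⟨m, rfl⟩ : ∃ m', m = m' + 1 := ⟨m - 1, by omega⟩
      rw [Finset.prod_insert hi, sub_mul, one_mul, map_sub, mul_assoc, coeff_C_mul,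
        coeff_succ_X_mul, ih _ (by omega), ih _ (by omega)]
      simp
  refine key _ _ (lt_of_lt_of_le ?_ hm)
  rw [Finset.card_erase_of_mem (Finset.mem_univ k), Finset.card_univ, Fintype.card_fin]
  have := k.pos
  omega

theorem hsymSeries_mul_elemSeries [CharZero K] (k : Fin N) :
    hsymSeries (toVars K N : Sym K →+* MvPolynomial (Fin N) K) * elemSeries K k =
      PowerSeries.mk fun m => (MvPolynomial.X k : MvPolynomial (Fin N) K) ^ m := by
  classical
  rw [hsymSeries_toVars, ← Finset.mul_prod_erase Finset.univ _ (Finset.mem_univ k), mul_assoc,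
    elemSeries, ← Finset.prod_mul_distrib, Finset.prod_congr rfl fun i _ => mk_pow_mul_one_sub _,
    Finset.prod_const_one, mul_one]

/-- Multiplying ∏_i 1/(1 - x_i t) by all the factors except the k-th leaves 1/(1 - x_k t); this is
its coefficient of t^α. -/
theorem sum_hsymInt_mul_elemSeries [CharZero K] (k : Fin N) (α : ℕ) :
    ∑ j : Fin N, toVars K N (hsymInt ((α : ℤ) - (N - 1 : ℕ) + j)) *
      coeff (N - 1 - j) (elemSeries K k) = MvPolynomial.X k ^ α := by
  classical
  have h := congrArg (coeff α) (hsymSeries_mul_elemSeries (K := K) k)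
  rw [coeff_mk, mul_comm, coeff_mul, Finset.Nat.sum_antidiagonal_eq_sum_range_succ_mk] at h
  rw [← h]
  have h1 : ∀ d : ℕ, toVars K N (hsymInt ((α : ℤ) - d)) =
      if d ≤ α then toVars K N (hsym (α - d)) else 0 := by
    intro d
    split_ifs with hd
    · rw [← Nat.cast_sub hd, hsymInt_natCast]
    · rw [hsymInt_of_neg (by omega), map_zero]
  have h2 : ∑ j : Fin N, toVars K N (hsymInt ((α : ℤ) - (N - 1 : ℕ) + j)) *
      coeff (N - 1 - j) (elemSeries K k) =
      ∑ d : Fin N, toVars K N (hsymInt ((α : ℤ) - (d : ℕ))) *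
        coeff (d : ℕ) (elemSeries K k) := by
    rw [← Equiv.sum_comp Fin.revPerm]
    refine Finset.sum_congr rfl fun d _ => ?_
    have := d.isLt
    have e1 : ((Fin.revPerm d : Fin N) : ℕ) = N - 1 - d := by
      simp only [Fin.revPerm_apply, Fin.val_rev]; omega
    have e2 : (α : ℤ) - (N - 1 : ℕ) + (N - 1 - (d : ℕ) : ℕ) = α - (d : ℕ) := by omega
    have e3 : N - 1 - (N - 1 - (d : ℕ)) = d := by omega
    rw [e1, e2, e3]
  rw [h2, Fin.sum_univ_eq_sum_range (fun d => toVars K N (hsymInt ((α : ℤ) - (d : ℕ))) *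
        coeff (d : ℕ) (elemSeries K k)) N]
  have h3 : ∀ M, N ≤ M → α < M → ∑ d ∈ Finset.range N, toVars K N (hsymInt ((α : ℤ) - (d : ℕ))) *
        coeff (d : ℕ) (elemSeries K k) = ∑ d ∈ Finset.range (α + 1),
        coeff d (elemSeries K k) * toVars K N (hsym (α - d)) := by
    intro M hM hα
    rw [Finset.sum_subset (Finset.range_mono hM), ← Finset.sum_subset (Finset.range_mono hα)]
    · refine Finset.sum_congr rfl fun d hd => ?_
      rw [Finset.mem_range] at hd
      rw [h1, if_pos (by omega), mul_comm]
    · intro d _ hd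
      rw [Finset.mem_range] at hd
      rw [h1, if_neg (by omega), zero_mul]
    · intro d _ hd
      rw [Finset.mem_range, not_lt] at hd
      rw [coeff_elemSeries k hd, mul_zero]
  rw [h3 (N + α + 1) (by omega) (by omega)]
  simp [hsymSeries]

/-- The alternant `det (x_k ^ {α_i})`. -/
def alternant (K : Type*) [Field K] {N : ℕ} (α : Fin N → ℕ) : MvPolynomial (Fin N) K :=
  Matrix.det (Matrix.of fun i k : Fin N => (MvPolynomial.X k : MvPolynomial (Fin N) K) ^ α i)

/-- `det (h_{α_i - (N - 1) + j})`. -/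
def jacobiTrudi (K : Type*) [Field K] {N : ℕ} (α : Fin N → ℕ) : Sym K :=
  Matrix.det (Matrix.of fun i j : Fin N =>
    (hsymInt ((α i : ℤ) - (N - 1 : ℕ) + (j : ℕ)) : Sym K))

/-- `sum_hsymInt_mul_elemSeries` is a matrix identity whose second factor does not depend on α. The
staircase α, where the first factor has determinant 1, then identifies that factor's determinant
with the denominator alternant. -/
theorem toVars_jacobiTrudi_mul_det [CharZero K] (α : Fin N → ℕ) :
    toVars K N (jacobiTrudi K α) *
      Matrix.det (Matrix.of fun j k : Fin N => coeff (N - 1 - j) (elemSeries K k)) =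
      alternant K α := by
  rw [jacobiTrudi, AlgHom.map_det, ← Matrix.det_mul, alternant]
  congr 1
  ext1 i k
  rw [Matrix.mul_apply, Matrix.of_apply, ← sum_hsymInt_mul_elemSeries k (α i)]
  rfl

theorem jacobiTrudi_staircase : jacobiTrudi K (fun i : Fin N => N - 1 - (i : ℕ)) = 1 := by
  rw [jacobiTrudi, Matrix.det_of_isUpperTriangular]
  · refine Finset.prod_eq_one fun i _ => ?_
    have := i.isLt
    rw [Matrix.of_apply]
    have : (((N - 1 - (i : ℕ) : ℕ) : ℤ) - (N - 1 : ℕ) + (i : ℕ)) = ((0 : ℕ) : ℤ) := by omega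
    rw [this, hsymInt_natCast, hsym_zero]
  · intro i j hij
    have h1 : (j : ℕ) < (i : ℕ) := hij
    have := i.isLt
    rw [Matrix.of_apply, hsymInt_of_neg (by omega)]

/-- The bialternant formula. -/
theorem toVars_jacobiTrudi_mul_alternant [CharZero K] (α : Fin N → ℕ) :
    toVars K N (jacobiTrudi K α) * alternant K (fun i : Fin N => N - 1 - (i : ℕ)) =
      alternant K α := by
  have h := toVars_jacobiTrudi_mul_det (K := K) (fun i : Fin N => N - 1 - (i : ℕ))
  rw [jacobiTrudi_staircase, map_one, one_mul] at h
  rw [← h, toVars_jacobiTrudi_mul_det]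

/-- Each permutation in the expansion of the determinant gives a product of complete functions,
which extracts the coefficient of x^α in f times one monomial. The signed sum of these monomials is
the staircase alternant. -/
theorem hall_jacobiTrudi [CharZero K] (f : Sym K) (α : Fin N → ℕ) :
    hall f (jacobiTrudi K α) = MvPolynomial.coeff (Finsupp.equivFunOnFinite.symm α)
      (toVars K N f * alternant K (fun i : Fin N => N - 1 - (i : ℕ))) := by
  classical
  rw [jacobiTrudi, ← Matrix.det_transpose, Matrix.det_apply, ← hallRight_apply, map_sum, alternant,
    Matrix.det_apply, Finset.mul_sum, MvPolynomial.coeff_sum]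
  refine Finset.sum_congr rfl fun σ _ => ?_
  have h := hall_prod_hsymInt f (Finsupp.equivFunOnFinite.symm α)
    (Finsupp.equivFunOnFinite.symm fun i => N - 1 - (σ i : ℕ))
  have e1 : ∏ i, (Matrix.of fun i j : Fin N =>
      (hsymInt ((α i : ℤ) - (N - 1 : ℕ) + (j : ℕ)) : Sym K)).transpose (σ i) i =
      ∏ i, hsymInt (((Finsupp.equivFunOnFinite.symm α : Fin N →₀ ℕ) i : ℤ) -
        (Finsupp.equivFunOnFinite.symm (fun i => N - 1 - (σ i : ℕ)) : Fin N →₀ ℕ) i) := by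
    refine Finset.prod_congr rfl fun i _ => ?_
    have := (σ i).isLt
    simp only [Matrix.transpose_apply, Matrix.of_apply, Finsupp.equivFunOnFinite_symm_apply_apply]
    congr 1
    omega
  have e2 : ∏ i, (Matrix.of fun i k : Fin N => (MvPolynomial.X k : MvPolynomial (Fin N) K) ^
      (N - 1 - (i : ℕ))) (σ i) i = MvPolynomial.monomial
        (Finsupp.equivFunOnFinite.symm fun i => N - 1 - (σ i : ℕ)) 1 := by
    rw [MvPolynomial.monomial_eq, map_one, one_mul, Finsupp.prod_fintype _ _ (by simp)]
    rfl
  rw [map_zsmul_unit, hallRight_apply, e1, h, e2, mul_smul_comm]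
  rcases Int.units_eq_one_or (Equiv.Perm.sign σ) with hs | hs <;> simp [hs, Units.smul_def]

/-- The pairing is the coefficient of x^β in the alternant of α. Both exponent sequences decrease
strictly, so only the identity permutation can contribute. -/
theorem hall_jacobiTrudi_jacobiTrudi [CharZero K] {α β : Fin N → ℕ} (hα : StrictAnti α)
    (hβ : StrictAnti β) :
    hall (jacobiTrudi K α) (jacobiTrudi K β) = if α = β then 1 else 0 := by
  classical
  rw [hall_jacobiTrudi, toVars_jacobiTrudi_mul_alternant, alternant, Matrix.det_apply,
    MvPolynomial.coeff_sum]
  have e2 : ∀ σ : Equiv.Perm (Fin N),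
      ∏ i, (Matrix.of fun i k : Fin N => (MvPolynomial.X k : MvPolynomial (Fin N) K) ^
      (α i)) (σ i) i = MvPolynomial.monomial
        (Finsupp.equivFunOnFinite.symm fun i => α (σ i)) 1 := by
    intro σ
    rw [MvPolynomial.monomial_eq, map_one, one_mul, Finsupp.prod_fintype _ _ (by simp)]
    rfl
  have e3 : ∀ σ : Equiv.Perm (Fin N), (fun i => α (σ i)) = β → σ = 1 := by
    intro σ h
    have h1 : StrictMono σ := by
      intro i j hij
      have := hβ hij
      rw [← h] at this
      exact hα.lt_iff_gt.1 this
    have h2 : (OrderIso.ofSurjective (OrderEmbedding.ofStrictMono σ h1) σ.surjective) =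
      OrderIso.refl (Fin N) := Subsingleton.elim _ _
    ext i
    have h3 : (OrderIso.ofSurjective (OrderEmbedding.ofStrictMono σ h1) σ.surjective) i = i :=
      congrArg (fun e : Fin N ≃o Fin N => e i) h2
    exact congrArg Fin.val h3
  have e4 : ∀ σ : Equiv.Perm (Fin N), MvPolynomial.coeff (Finsupp.equivFunOnFinite.symm β)
      (MvPolynomial.monomial (Finsupp.equivFunOnFinite.symm fun i => α (σ i)) (1 : K)) =
      if (fun i => α (σ i)) = β then 1 else 0 := by
    intro σ
    rw [MvPolynomial.coeff_monomial]
    exact if_congr Finsupp.equivFunOnFinite.symm.injective.eq_iff rfl rfl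
  rw [Finset.sum_eq_single 1]
  · rw [e2, Equiv.Perm.sign_one, one_smul, e4]
    rfl
  · intro σ _ hσ
    rw [e2]
    have : MvPolynomial.coeff (Finsupp.equivFunOnFinite.symm β)
      (MvPolynomial.monomial (Finsupp.equivFunOnFinite.symm fun i => α (σ i)) (1 : K)) = 0 := by
      rw [e4, if_neg fun h => hσ (e3 σ h)]
    rcases Int.units_eq_one_or (Equiv.Perm.sign σ) with hs | hs <;> simp [hs, this]
  · simp

end Orthonormality
end CharVar
end

noncomputable section
namespace CharVar

/-! ### Rows, columns and hooks; orthonormality of the Schur functions. -/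

section Partitions

variable {n : ℕ}

theorem lt_getD_iff_lt_countP {L : List ℕ} (hL : L.Pairwise (· ≥ ·)) (j k : ℕ) :
    j < L.getD k 0 ↔ k < L.countP (fun i => j < i) := by
  induction L generalizing k with
  | nil => simp
  | cons a t ih =>
    rw [List.pairwise_cons] at hL
    by_cases h : j < a
    · rw [List.countP_cons_of_pos (by simpa using h)]
      cases k with
      | zero => simpa using h
      | succ k => simpa using ih hL.2 k
    · have h0 : ∀ b ∈ a :: t, ¬ j < b := by
        intro b hb
        rcases List.mem_cons.1 hb with rfl | hb
        · exact h
        · have := hL.1 b hb; omega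
      rw [List.countP_eq_zero.2 (by simpa using h0)]
      simp only [Nat.not_lt_zero, iff_false]
      rw [List.getD_eq_getElem?_getD]
      rcases h1 : (a :: t)[k]? with _ | b
      · simp
      · exact h0 b (List.mem_of_getElem? h1)

theorem rows_pairwise (l : n.Partition) : (rows l).Pairwise (· ≥ ·) :=
  Multiset.pairwise_sort _ _

theorem coe_rows (l : n.Partition) : ((rows l : List ℕ) : Multiset ℕ) = l.parts :=
  Multiset.sort_eq _ _

theorem length_rows (l : n.Partition) : (rows l).length = len l := by
  rw [len, ← coe_rows, Multiset.coe_card]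

/-- Both sides say that (k, j) is a cell. All the arm and leg arithmetic rests on this duality. -/
theorem lt_row_iff (l : n.Partition) (j k : ℕ) : j < row l k ↔ k < col l j := by
  rw [row, lt_getD_iff_lt_countP (rows_pairwise l), col, ← coe_rows, Multiset.coe_countP]

theorem col_zero (l : n.Partition) : col l 0 = len l := by
  rw [col, len, Multiset.countP_eq_card]
  exact fun i hi => l.parts_pos hi

theorem col_anti (l : n.Partition) : Antitone (col l) := by
  intro i j hij
  by_contra! h
  have h1 := (lt_row_iff l j (col l i)).2 h
  exact lt_irrefl _ ((lt_row_iff l i (col l i)).1 (lt_of_le_of_lt hij h1))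

theorem row_anti (l : n.Partition) : Antitone (row l) := by
  intro i j hij
  by_contra! h
  have h1 := (lt_row_iff l (row l i) j).1 h
  exact lt_irrefl _ ((lt_row_iff l (row l i) i).2 (lt_of_le_of_lt hij h1))

theorem row_pos_iff (l : n.Partition) (i : ℕ) : 0 < row l i ↔ i < len l := by
  rw [lt_row_iff, col_zero]

theorem row_eq_zero (l : n.Partition) {i : ℕ} (h : len l ≤ i) : row l i = 0 := by
  have := row_pos_iff l i
  omega

theorem sum_row (l : n.Partition) : ∑ i ∈ Finset.range (len l), row l i = n := by
  refine Eq.trans ?_ l.parts_sum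
  rw [← coe_rows, Multiset.sum_coe, ← length_rows,
    ← Fin.sum_univ_eq_sum_range, ← Fin.sum_univ_getElem]
  exact Finset.sum_congr rfl fun i _ => by simp [row]

theorem row_le (l : n.Partition) (i : ℕ) : row l i ≤ n := by
  rcases lt_or_ge i (len l) with h | h
  · conv_rhs => rw [← sum_row l]
    exact Finset.single_le_sum (fun _ _ => Nat.zero_le _) (Finset.mem_range.2 h)
  · rw [row_eq_zero l h]; exact Nat.zero_le _

theorem row_injective {l m : n.Partition} (h : ∀ i, row l i = row m i) : l = m := by
  have key : ∀ l m : n.Partition, (∀ i, row l i = row m i) → len l ≤ len m := by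
    intro l m h
    by_contra! h1
    have h2 := (row_pos_iff l _).2 h1
    rw [h, row_eq_zero m le_rfl] at h2
    exact lt_irrefl _ h2
  have hl := le_antisymm (key l m h) (key m l fun i => (h i).symm)
  apply Nat.Partition.ext
  rw [← coe_rows l, ← coe_rows m]
  congr 1
  refine List.ext_getElem (by rw [length_rows, length_rows, hl]) fun i h1 h2 => ?_
  have := h i
  simpa [row, h1, h2] using this

/-- The strictly decreasing sequence `λ_i + N - 1 - i` (rows numbered from `0`). -/
def betaSeq (l : n.Partition) (N : ℕ) (i : ℕ) : ℕ := row l i + (N - 1 - i)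

theorem betaSeq_strictAnti (l : n.Partition) (N : ℕ) :
    StrictAnti fun i : Fin N => betaSeq l N i := by
  intro i j hij
  have h1 : (i : ℕ) < j := hij
  have := row_anti l h1.le
  have := j.isLt
  simp only [betaSeq]
  omega

variable {K : Type*} [Field K]

theorem schur_eq_jacobiTrudi_len (l : n.Partition) :
    (schur l : Sym K) = jacobiTrudi K fun i : Fin (len l) => betaSeq l (len l) i := by
  unfold schur jacobiTrudi
  congr 1
  ext1 i j
  have := i.isLt
  simp only [Matrix.of_apply, betaSeq]
  congr 1
  push_cast
  omega

/-- A zero part adds the last row (0, …, 0, 1). Thus two partitions of different lengths can be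
compared in determinants of the same size. -/
theorem jacobiTrudi_betaSeq_succ (l : n.Partition) {N : ℕ} (hN : len l ≤ N) :
    (jacobiTrudi K fun i : Fin (N + 1) => betaSeq l (N + 1) i) =
      jacobiTrudi K fun i : Fin N => betaSeq l N i := by
  conv_lhs => rw [jacobiTrudi, Matrix.det_succ_row _ (Fin.last N)]
  rw [Finset.sum_eq_single (Fin.last N)]
  · have h0 : ((betaSeq l (N + 1) (Fin.last N : ℕ) : ℕ) : ℤ) - (N + 1 - 1 : ℕ) +
        ((Fin.last N : Fin (N + 1)) : ℕ) = ((0 : ℕ) : ℤ) := by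
      simp [betaSeq, row_eq_zero l hN]
    rw [Matrix.of_apply, h0, hsymInt_natCast, hsym_zero, Even.neg_one_pow ⟨_, rfl⟩, one_mul, one_mul,
      jacobiTrudi]
    congr 1
    ext1 i j
    have := i.isLt
    simp only [Matrix.submatrix_apply, Matrix.of_apply, Fin.succAbove_last, betaSeq,
      Fin.val_castSucc]
    congr 1
    push_cast
    omega
  · intro j _ hj
    have : (j : ℕ) < N := by
      have h1 : (j : ℕ) ≠ N := fun h => hj (Fin.ext h)
      have := j.isLt
      omega
    rw [Matrix.of_apply, hsymInt_of_neg, mul_zero, zero_mul]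
    simp [betaSeq, row_eq_zero l hN]
    omega
  · simp

theorem schur_eq_jacobiTrudi (l : n.Partition) {N : ℕ} (hN : len l ≤ N) :
    (schur l : Sym K) = jacobiTrudi K fun i : Fin N => betaSeq l N i := by
  induction N, hN using Nat.le_induction with
  | base => exact schur_eq_jacobiTrudi_len l
  | succ N hN ih => rw [jacobiTrudi_betaSeq_succ l hN, ih]

/-- The Schur functions are orthonormal for the Hall pairing. -/
theorem hall_schur [CharZero K] [DecidableEq n.Partition] (l m : n.Partition) :
    hall (schur l : Sym K) (schur m) = if l = m then 1 else 0 := by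
  rw [schur_eq_jacobiTrudi l (Nat.le_add_right (len l) (len m)),
    schur_eq_jacobiTrudi m (Nat.le_add_left (len m) (len l)),
    hall_jacobiTrudi_jacobiTrudi (betaSeq_strictAnti l _) (betaSeq_strictAnti m _)]
  refine if_congr ⟨fun h => row_injective fun i => ?_, fun h => by rw [h]⟩ rfl rfl
  rcases lt_or_ge i (len l + len m) with hi | hi
  · have := congrFun h ⟨i, hi⟩
    simpa [betaSeq] using this
  · rw [row_eq_zero l (by omega), row_eq_zero m (by omega)]

theorem cells_eq_sigma (l : n.Partition) {M : Type*} [CommMonoid M] (f : ℕ × ℕ → M) :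
    ∏ s ∈ cells l, f s = ∏ i ∈ Finset.range (len l), ∏ j ∈ Finset.range (row l i), f (i, j) := by
  rw [cells, Finset.prod_filter, Finset.prod_product]
  refine Finset.prod_congr rfl fun i _ => ?_
  rw [← Finset.prod_filter]
  refine Finset.prod_congr ?_ fun _ _ => rfl
  ext j
  have := row_le l i
  simp only [Finset.mem_filter, Finset.mem_range]
  omega

/-- In row `i` the hook lengths and the differences `β_i - β_k` fill up `{1, …, β_i}`. -/
theorem prod_hook_row (l : n.Partition) {M : Type*} [CommMonoid M] (f : ℕ → M) {i : ℕ}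
    (hi : i < len l) :
    (∏ j ∈ Finset.range (row l i), f (arm l (i, j) + leg l (i, j) + 1)) *
      ∏ k ∈ Finset.Ioo i (len l), f (betaSeq l (len l) i - betaSeq l (len l) k) =
      ∏ m ∈ Finset.Icc 1 (betaSeq l (len l) i), f m := by
  classical
  set A := fun j => arm l (i, j) + leg l (i, j) + 1
  set B := fun k => betaSeq l (len l) i - betaSeq l (len l) k
  have hA : ∀ j < row l i, i < col l j ∧ col l j ≤ len l ∧
      A j + j + i + 1 = row l i + col l j := by
    intro j hj
    have h1 := (lt_row_iff l j i).1 hj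
    have h2 := col_anti l (Nat.zero_le j)
    rw [col_zero] at h2
    refine ⟨h1, h2, ?_⟩
    simp only [A, arm, leg]
    omega
  have hB : ∀ k, i < k → k < len l → row l k ≤ row l i ∧ B k + row l k + i = row l i + k := by
    intro k hk hk'
    have h1 := row_anti l hk.le
    refine ⟨h1, ?_⟩
    simp only [B, betaSeq]
    omega
  have injA : Set.InjOn A (Finset.range (row l i)) := by
    intro j hj j' hj' h
    simp only [Finset.coe_range, Set.mem_Iio] at hj hj'
    have h1 := hA j hj
    have h2 := hA j' hj'
    rcases lt_trichotomy j j' with h3 | h3 | h3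
    · have := col_anti l h3.le; omega
    · exact h3
    · have := col_anti l h3.le; omega
  have injB : Set.InjOn B (Finset.Ioo i (len l)) := by
    intro k hk k' hk' h
    simp only [Finset.coe_Ioo, Set.mem_Ioo] at hk hk'
    have h1 := hB k hk.1 hk.2
    have h2 := hB k' hk'.1 hk'.2
    rcases lt_trichotomy k k' with h3 | h3 | h3
    · have := row_anti l h3.le; omega
    · exact h3
    · have := row_anti l h3.le; omega
  have disj : Disjoint ((Finset.range (row l i)).image A) ((Finset.Ioo i (len l)).image B) := by
    rw [Finset.disjoint_left]
    intro x hx hx'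
    obtain ⟨j, hj, rfl⟩ := Finset.mem_image.1 hx
    obtain ⟨k, hk, hk'⟩ := Finset.mem_image.1 hx'
    rw [Finset.mem_range] at hj
    rw [Finset.mem_Ioo] at hk
    have h1 := hA j hj
    have h2 := hB k hk.1 hk.2
    -- Equality would mean col j - k = j + 1 - row k. The left side is positive exactly when (k, j)
    -- is a cell, the right side exactly when it is not.
    have h3 := lt_row_iff l j k
    omega
  have heq : (Finset.range (row l i)).image A ∪ (Finset.Ioo i (len l)).image B =
      -- The disjoint images lie in the interval and together have as many elements as it.
      Finset.Icc 1 (betaSeq l (len l) i) := by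
    refine Finset.eq_of_subset_of_card_le ?_ ?_
    · intro x hx
      rw [Finset.mem_Icc]
      have hb : betaSeq l (len l) i = row l i + (len l - 1 - i) := rfl
      rcases Finset.mem_union.1 hx with hx | hx
      · obtain ⟨j, hj, rfl⟩ := Finset.mem_image.1 hx
        rw [Finset.mem_range] at hj
        have h1 := hA j hj
        omega
      · obtain ⟨k, hk, rfl⟩ := Finset.mem_image.1 hx
        rw [Finset.mem_Ioo] at hk
        have h2 := hB k hk.1 hk.2
        have h3 := (row_pos_iff l k).2 hk.2
        omega
    · rw [Finset.card_union_of_disjoint disj, Finset.card_image_of_injOn injA,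
        Finset.card_image_of_injOn injB, Finset.card_range, Nat.card_Icc, Nat.card_Ioo, betaSeq]
      omega
  rw [← heq, Finset.prod_union disj, Finset.prod_image injA, Finset.prod_image injB]

end Partitions
end CharVar
end

noncomputable section
namespace CharVar

/-! ### Determinants of polynomial values and derivations of determinants. -/

section Determinants

theorem derivation_det {R A ι : Type*} [CommRing R] [CommRing A] [Algebra R A] [DecidableEq ι]
    [Fintype ι] (D : Derivation R A A) (M : Matrix ι ι A) :
    D M.det = ∑ k, (M.updateCol k fun i => D (M i k)).det := by
  simp only [Matrix.det_apply, map_sum]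
  rw [Finset.sum_comm]
  refine Finset.sum_congr rfl fun σ _ => ?_
  rw [Units.smul_def, map_zsmul, derivation_prod, Finset.smul_sum]
  refine Finset.sum_congr rfl fun k _ => ?_
  rw [← Finset.mul_prod_erase Finset.univ _ (Finset.mem_univ k), Matrix.updateCol_self, smul_eq_mul,
    mul_comm, Units.smul_def]
  congr 2
  refine Finset.prod_congr rfl fun i hi => ?_
  rw [Matrix.updateCol_ne (Finset.ne_of_mem_erase hi)]

/-- The matrix is the Vandermonde matrix times the upper triangular matrix of coefficients. -/
theorem det_eval_polynomials {R : Type*} [CommRing R] {N : ℕ} (v : Fin N → R)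
    (p : Fin N → Polynomial R) (hp : ∀ j, (p j).natDegree ≤ j) :
    (Matrix.of fun i j => (p j).eval (v i)).det =
      (Matrix.vandermonde v).det * ∏ j : Fin N, (p j).coeff j := by
  rw [Matrix.eval_matrixOfPolynomials_eq_vandermonde_mul_matrixOfPolynomials v p hp, Matrix.det_mul,
    Matrix.det_of_isUpperTriangular (M := Matrix.of fun i j : Fin N => (p j).coeff i)]
  · rfl
  · intro i j hij
    exact Polynomial.coeff_eq_zero_of_natDegree_lt (lt_of_le_of_lt (hp j) hij)

theorem sign_revPerm_mul (N : ℕ) :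
    ((Equiv.Perm.sign (Fin.revPerm : Equiv.Perm (Fin N)) : ℤˣ) : ℤ) =
      ∏ j : Fin N, (-1 : ℤ) ^ (j : ℕ) := by
  have h : (Equiv.Perm.sign (Fin.revPerm : Equiv.Perm (Fin N)) : ℤˣ) =
      ∏ j : Fin N, ∏ i ∈ Finset.Iio j, (-1 : ℤˣ) := by
    rw [Equiv.Perm.sign_eq_prod_prod_Iio]
    refine Finset.prod_congr rfl fun j _ => Finset.prod_congr rfl fun i hi => ?_
    rw [Finset.mem_Iio] at hi
    rw [if_neg]
    simpa using hi.le
  rw [h]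
  simp

end Determinants

/-! ### Principal specialization of s_λ and of ∂s_λ/∂p_1. -/

section PrincipalSpecialization

open PowerSeries

variable {K : Type*} [Field K] {q : K}

/-- `(1 - q) ⋯ (1 - q ^ m)`. -/
def qFac (q : K) (m : ℕ) : K := ∏ i ∈ Finset.Icc 1 m, (1 - q ^ i)

theorem qFac_succ (m : ℕ) : qFac q (m + 1) = qFac q m * (1 - q ^ (m + 1)) := by
  rw [qFac, Finset.prod_Icc_succ_top (by omega), qFac]

theorem qFac_ne_zero (hq : ∀ k : ℕ, 0 < k → q ^ k ≠ 1) (m : ℕ) : qFac q m ≠ 0 := by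
  refine Finset.prod_ne_zero_iff.2 fun i hi => ?_
  rw [Finset.mem_Icc] at hi
  exact sub_ne_zero.2 (hq i (by omega)).symm

/-- The principal specialization `p_k ↦ 1 / (1 - q ^ k)`. -/
def principal (q : K) : Sym K →+* K := MvPolynomial.eval fun k : ℕ+ => (1 - q ^ (k : ℕ))⁻¹

theorem coeff_X_mul_derivative {R : Type*} [CommRing R] (f : PowerSeries R) (m : ℕ) :
    coeff m (X * d⁄dX R f) = m * coeff m f := by
  cases m with
  | zero => simp
  | succ m =>
    rw [coeff_succ_X_mul, coeff_derivative]
    push_cast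
    ring

/-- Here p_k - q^k p_k = 1, so passing from t to qt divides exp(∑ p_k t^k / k) by 1/(1 - t). The
resulting recursion determines the values of the h_m. -/
theorem rescale_hsymSeries [CharZero K] (hq : ∀ k : ℕ, 0 < k → q ^ k ≠ 1) :
    rescale q (hsymSeries (principal q)) = (1 - X) * hsymSeries (principal q) := by
  have hP : (psumSeries (principal q) - rescale q (psumSeries (principal q))) * (1 - X) = X := by
    have : psumSeries (principal q) - rescale q (psumSeries (principal q)) =
        PowerSeries.mk fun k => if 0 < k then 1 else 0 := by
      ext k
      rw [map_sub, coeff_rescale, psumSeries, coeff_mk, coeff_mk]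
      split_ifs with hk
      · have h1 : (1 - q ^ k) ≠ 0 := sub_ne_zero.2 (hq k hk).symm
        simp only [principal, MvPolynomial.eval_X, Nat.toPNat'_coe, hk, if_true]
        field_simp
      · simp
    rw [this]
    ext k
    rw [mul_sub, mul_one, map_sub]
    rcases k with _ | _ | k
    · simp
    · simp [coeff_succ_mul_X]
    · rw [coeff_succ_mul_X]
      simp [coeff_X]
  have hd := X_mul_derivative_hsymSeries (K := K) (principal q)
  refine eq_of_X_mul_derivative_eq (a := rescale q (psumSeries (principal q))) ?_ ?_ ?_ ?_
  · rw [← coeff_zero_eq_constantCoeff_apply, coeff_rescale, coeff_zero_eq_constantCoeff_apply,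
      constantCoeff_psumSeries, mul_zero]
  · rw [← map_mul, ← hd]
    ext m
    rw [coeff_X_mul_derivative, coeff_rescale, coeff_rescale, coeff_X_mul_derivative]
    ring
  · rw [Derivation.leibniz, map_sub, Derivation.map_one_eq_zero, derivative_X, smul_eq_mul,
      smul_eq_mul]
    linear_combination (1 - X) * hd + hsymSeries (principal q) * hP
  · rw [← coeff_zero_eq_constantCoeff_apply, coeff_rescale, coeff_zero_eq_constantCoeff_apply,
      map_mul, constantCoeff_hsymSeries]
    simp

theorem principal_hsym [CharZero K] (hq : ∀ k : ℕ, 0 < k → q ^ k ≠ 1) (m : ℕ) :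
    principal q (hsym m) = (qFac q m)⁻¹ := by
  induction m with
  | zero => simp [hsym_zero, qFac]
  | succ m ih =>
    have h := congrArg (coeff (m + 1)) (rescale_hsymSeries hq)
    rw [coeff_rescale, sub_mul, one_mul, map_sub, coeff_succ_X_mul, hsymSeries, coeff_mk, coeff_mk,
      ih] at h
    have h1 : (1 - q ^ (m + 1)) ≠ 0 := sub_ne_zero.2 (hq _ (Nat.succ_pos m)).symm
    rw [qFac_succ, mul_inv]
    field_simp
    linear_combination -h

/-- The polynomial `∏_{r < d} (1 - q ^ {-r} x)`. -/
def fallPoly (q : K) (d : ℕ) : Polynomial K :=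
  Polynomial.C (∏ r ∈ Finset.range d, (-(q⁻¹) ^ r)) *
    ∏ r ∈ Finset.range d, (Polynomial.X - Polynomial.C (q ^ r))

theorem eval_fallPoly (hq0 : q ≠ 0) (d : ℕ) (x : K) :
    (fallPoly q d).eval x = ∏ r ∈ Finset.range d, (1 - x * (q⁻¹) ^ r) := by
  rw [fallPoly, Polynomial.eval_mul, Polynomial.eval_C, Polynomial.eval_prod,
    ← Finset.prod_mul_distrib]
  refine Finset.prod_congr rfl fun r _ => ?_
  rw [Polynomial.eval_sub, Polynomial.eval_X, Polynomial.eval_C, inv_pow]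
  field_simp
  ring

theorem natDegree_prod_X_sub_C {ι : Type*} (s : Finset ι) (f : ι → K) :
    (∏ r ∈ s, (Polynomial.X - Polynomial.C (f r))).natDegree = s.card := by
  rw [Polynomial.natDegree_prod_of_monic _ _ fun r _ => Polynomial.monic_X_sub_C _]
  simp

theorem natDegree_fallPoly (d : ℕ) : (fallPoly q d).natDegree ≤ d := by
  refine (Polynomial.natDegree_C_mul_le _ _).trans ?_
  rw [natDegree_prod_X_sub_C, Finset.card_range]

theorem coeff_fallPoly (d : ℕ) :
    (fallPoly q d).coeff d = ∏ r ∈ Finset.range d, (-(q⁻¹) ^ r) := by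
  have h : (∏ r ∈ Finset.range d, (Polynomial.X - Polynomial.C (q ^ r))).coeff d = 1 := by
    have h1 := natDegree_prod_X_sub_C (Finset.range d) fun r => q ^ r
    rw [Finset.card_range] at h1
    have h2 : (∏ r ∈ Finset.range d, (Polynomial.X - Polynomial.C (q ^ r))).Monic :=
      Polynomial.monic_prod_of_monic _ _ fun r _ => Polynomial.monic_X_sub_C _
    have := h2.coeff_natDegree
    rwa [h1] at this
  rw [fallPoly, Polynomial.coeff_C_mul, h, mul_one]

/-- For fixed d the value is a polynomial in q^b up to a factor depending on b alone, which is what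
brings in Vandermonde determinants. The roots q^r with r < d account for h_{b-d} = 0 when b < d. -/
theorem principal_hsymInt [CharZero K] (hq0 : q ≠ 0) (hq : ∀ k : ℕ, 0 < k → q ^ k ≠ 1)
    (b d : ℕ) :
    principal q (hsymInt ((b : ℤ) - d)) = (qFac q b)⁻¹ * (fallPoly q d).eval (q ^ b) := by
  have key : ∀ m : ℤ, principal q (hsymInt (m - 1)) = principal q (hsymInt m) * (1 - q ^ m) := by
    intro m
    rcases lt_trichotomy m 0 with hm | rfl | hm
    · rw [hsymInt_of_neg hm, hsymInt_of_neg (by omega), map_zero, zero_mul]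
    · rw [hsymInt_of_neg (by omega)]; simp
    · obtain ⟨k, rfl⟩ : ∃ k : ℕ, m = ((k + 1 : ℕ) : ℤ) := ⟨(m - 1).toNat, by omega⟩
      have : (((k + 1 : ℕ) : ℤ) - 1) = (k : ℕ) := by omega
      have h1 : (1 - q ^ (k + 1)) ≠ 0 := sub_ne_zero.2 (hq _ (Nat.succ_pos k)).symm
      rw [this, hsymInt_natCast, hsymInt_natCast, principal_hsym hq, principal_hsym hq, qFac_succ,
        mul_inv, mul_assoc, zpow_natCast, inv_mul_cancel₀ h1, mul_one]
  rw [eval_fallPoly hq0]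
  induction d with
  | zero => simp [hsymInt_natCast, principal_hsym hq]
  | succ d ih =>
    have : ((b : ℤ) - (d + 1 : ℕ)) = ((b : ℤ) - d) - 1 := by push_cast; ring
    rw [this, key, ih, Finset.prod_range_succ, mul_assoc]
    congr 2
    rw [zpow_sub₀ hq0, zpow_natCast, zpow_natCast, inv_pow, div_eq_mul_inv]

variable {N : ℕ}

theorem det_of_rev {R : Type*} [CommRing R] (f : ℕ → Fin N → R) :
    (Matrix.of fun i j : Fin N => f (N - 1 - j) i).det =
      (∏ j : Fin N, (-1 : R) ^ (j : ℕ)) * (Matrix.of fun i j : Fin N => f j i).det := by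
  have h := Matrix.det_permute' (Fin.revPerm : Equiv.Perm (Fin N))
    (Matrix.of fun i j : Fin N => f j i)
  have h1 : ((Equiv.Perm.sign (Fin.revPerm : Equiv.Perm (Fin N)) : ℤ) : R) =
      ∏ j : Fin N, (-1 : R) ^ (j : ℕ) := by
    rw [sign_revPerm_mul]
    push_cast
    rfl
  rw [← h1, ← h]
  congr 1
  ext1 i j
  simp only [Matrix.submatrix_apply, Matrix.of_apply, id, Fin.revPerm_apply, Fin.val_rev]
  congr 1
  omega

/-- Taking 1/((1 - q) ⋯ (1 - q^(α_i))) out of each row and reversing the columns leaves values at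
q^(α_i) of polynomials of degrees at most 0, …, N - 1. -/
theorem principal_jacobiTrudi [CharZero K] (hq0 : q ≠ 0) (hq : ∀ k : ℕ, 0 < k → q ^ k ≠ 1)
    (α : Fin N → ℕ) :
    principal q (jacobiTrudi K α) = (∏ i, (qFac q (α i))⁻¹) * ((∏ j : Fin N, (-1 : K) ^ (j : ℕ)) *
      ((Matrix.vandermonde fun i => q ^ α i).det * ∏ j : Fin N, (fallPoly q j).coeff j)) := by
  rw [jacobiTrudi, RingHom.map_det, ← det_eval_polynomials _ _ (fun j => natDegree_fallPoly _),
    ← det_of_rev (fun j i => (fallPoly q j).eval (q ^ α i)), ← Matrix.det_mul_column]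
  congr 1
  ext1 i j
  have := j.isLt
  have h : ((α i : ℤ) - (N - 1 : ℕ) + (j : ℕ)) = (α i : ℤ) - (N - 1 - (j : ℕ) : ℕ) := by omega
  simp only [RingHom.mapMatrix_apply, Matrix.map_apply, Matrix.of_apply]
  rw [h, principal_hsymInt hq0 hq]

/-- The derivative lowers an index by one, so a differentiated column repeats its left neighbour.
Only differentiating the first column gives a nonzero determinant. -/
theorem pderiv_one_jacobiTrudi [CharZero K] (α : Fin (N + 1) → ℕ) :
    MvPolynomial.pderiv 1 (jacobiTrudi K α) = Matrix.det (Matrix.of fun i j : Fin (N + 1) =>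
      (hsymInt (if j = 0 then (α i : ℤ) - (N + 1 : ℕ) else (α i : ℤ) - N + (j : ℕ)) : Sym K)) := by
  have hp : ∀ m : ℤ, MvPolynomial.pderiv 1 (hsymInt m : Sym K) = hsymInt (m - 1) := by
    intro m
    have := pderiv_hsymInt (K := K) 1 m
    simpa using this
  rw [jacobiTrudi, derivation_det, Finset.sum_eq_single 0]
  · congr 1
    ext1 i j
    by_cases hj : j = 0
    · subst hj
      rw [Matrix.updateCol_self]
      simp only [Matrix.of_apply, hp, if_true]
      congr 1
      push_cast
      simp
      ring
    · rw [Matrix.updateCol_ne hj]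
      simp [hj]
  · intro k _ hk
    obtain ⟨k', rfl⟩ := Fin.exists_succ_eq.2 hk
    refine Matrix.det_zero_of_column_eq (i := k'.succ) (j := k'.castSucc)
      (Fin.castSucc_lt_succ).ne' fun i => ?_
    rw [Matrix.updateCol_self, Matrix.updateCol_ne (Fin.castSucc_lt_succ).ne]
    simp only [Matrix.of_apply, hp]
    congr 1
    push_cast
    simp
    ring
  · simp

/-- The changed column holds values of a polynomial of degree N + 1, one too many for the
Vandermonde argument. Subtracting a multiple of ∏ (X - q^(α_i)) keeps these values and brings the
degree down to N; the coefficient of X^N in the resulting `R` then comes from the difference of the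
two sums of roots. -/
theorem principal_pderiv_jacobiTrudi [CharZero K] (hq0 : q ≠ 0)
    (hq : ∀ k : ℕ, 0 < k → q ^ k ≠ 1) (α : Fin (N + 1) → ℕ) :
    principal q (MvPolynomial.pderiv 1 (jacobiTrudi K α)) =
      (q⁻¹) ^ N * (∑ r ∈ Finset.range (N + 1), q ^ r - ∑ i, q ^ α i) *
        principal q (jacobiTrudi K α) := by
  classical
  set R : Polynomial K := Polynomial.C (∏ r ∈ Finset.range (N + 1), (-(q⁻¹) ^ r)) *
    (∏ r ∈ Finset.range (N + 1), (Polynomial.X - Polynomial.C (q ^ r)) -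
      ∏ i : Fin (N + 1), (Polynomial.X - Polynomial.C (q ^ α i))) with hR
  have hRev : ∀ i, R.eval (q ^ α i) = (fallPoly q (N + 1)).eval (q ^ α i) := by
    intro i
    rw [hR, fallPoly, Polynomial.eval_mul, Polynomial.eval_mul, Polynomial.eval_sub]
    rw [Polynomial.eval_prod Finset.univ, Finset.prod_eq_zero (Finset.mem_univ i) (by simp), sub_zero]
  have hRdeg : R.natDegree ≤ N := by
    refine (Polynomial.natDegree_C_mul_le _ _).trans ?_
    rw [Polynomial.natDegree_le_iff_coeff_eq_zero]
    intro m hm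
    have m1 : (∏ r ∈ Finset.range (N + 1), (Polynomial.X - Polynomial.C (q ^ r))).Monic :=
      Polynomial.monic_prod_of_monic _ _ fun r _ => Polynomial.monic_X_sub_C _
    have m2 : (∏ i : Fin (N + 1), (Polynomial.X - Polynomial.C (q ^ α i))).Monic :=
      Polynomial.monic_prod_of_monic _ _ fun r _ => Polynomial.monic_X_sub_C _
    have d1 := natDegree_prod_X_sub_C (Finset.range (N + 1)) fun r => q ^ r
    have d2 := natDegree_prod_X_sub_C (Finset.univ : Finset (Fin (N + 1))) fun i => q ^ α i
    rw [Finset.card_range] at d1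
    rw [Finset.card_univ, Fintype.card_fin] at d2
    rw [Polynomial.coeff_sub]
    rcases (show N + 1 ≤ m from hm).eq_or_lt with rfl | hm'
    · have c1 := m1.coeff_natDegree
      have c2 := m2.coeff_natDegree
      rw [d1] at c1
      rw [d2] at c2
      rw [c1, c2, sub_self]
    · rw [Polynomial.coeff_eq_zero_of_natDegree_lt (by omega),
        Polynomial.coeff_eq_zero_of_natDegree_lt (by omega), sub_self]
  have hRcoeff : R.coeff N = (q⁻¹) ^ N * (∑ r ∈ Finset.range (N + 1), q ^ r - ∑ i, q ^ α i) *
      (fallPoly q N).coeff N := by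
    have c1 := Polynomial.prod_X_sub_C_coeff_card_pred (Finset.range (N + 1)) (fun r => q ^ r)
      (by simp)
    have c2 := Polynomial.prod_X_sub_C_coeff_card_pred (Finset.univ : Finset (Fin (N + 1)))
      (fun i => q ^ α i) (by simp)
    rw [Finset.card_range, Nat.add_sub_cancel] at c1
    rw [Finset.card_univ, Fintype.card_fin, Nat.add_sub_cancel] at c2
    rw [hR, Polynomial.coeff_C_mul, Polynomial.coeff_sub, c1, c2, coeff_fallPoly,
      Finset.prod_range_succ]
    ring
  set p : Fin (N + 1) → Polynomial K := fun j => if (j : ℕ) = N then R else fallPoly q j with hp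
  have hpdeg : ∀ j, (p j).natDegree ≤ j := by
    intro j
    simp only [hp]
    split_ifs with h
    · rw [h]; exact hRdeg
    · exact natDegree_fallPoly _
  have hpcoeff : ∏ j, (p j).coeff j =
      (q⁻¹) ^ N * (∑ r ∈ Finset.range (N + 1), q ^ r - ∑ i, q ^ α i) *
        ∏ j : Fin (N + 1), (fallPoly q j).coeff j := by
    rw [Fin.prod_univ_castSucc, Fin.prod_univ_castSucc (fun j : Fin (N + 1) =>
      (fallPoly q j).coeff (j : ℕ))]
    have e1 : p (Fin.last N) = R := by simp [hp]
    have e2 : ∀ j : Fin N, p j.castSucc = fallPoly q j := by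
      intro j
      have := j.isLt
      simp only [hp, Fin.val_castSucc]
      rw [if_neg (by omega)]
    simp only [e1, e2, Fin.val_last, Fin.val_castSucc, hRcoeff]
    ring
  have hdet : principal q (MvPolynomial.pderiv 1 (jacobiTrudi K α)) =
      (∏ i, (qFac q (α i))⁻¹) * ((∏ j : Fin (N + 1), (-1 : K) ^ (j : ℕ)) *
      ((Matrix.vandermonde fun i => q ^ α i).det * ∏ j : Fin (N + 1), (p j).coeff j)) := by
    rw [pderiv_one_jacobiTrudi, RingHom.map_det, ← det_eval_polynomials _ _ hpdeg]
    have e := det_of_rev (R := K) (N := N + 1)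
      (fun j i => if j = N then R.eval (q ^ α i) else (fallPoly q j).eval (q ^ α i))
    have e' : (Matrix.of fun i j : Fin (N + 1) => (p j).eval (q ^ α i)) =
      Matrix.of fun i j : Fin (N + 1) =>
        if (j : ℕ) = N then R.eval (q ^ α i) else (fallPoly q j).eval (q ^ α i) := by
      ext1 i j
      simp only [hp, Matrix.of_apply]
      split_ifs <;> rfl
    rw [e', ← e, ← Matrix.det_mul_column]
    congr 1
    ext1 i j
    have := j.isLt
    simp only [RingHom.mapMatrix_apply, Matrix.map_apply, Matrix.of_apply]
    by_cases hj : j = 0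
    · subst hj
      rw [if_pos rfl, if_pos (by simp), principal_hsymInt hq0 hq, hRev]
    · have hj' : (j : ℕ) ≠ 0 := fun h => hj (Fin.ext h)
      have h : ((α i : ℤ) - N + (j : ℕ)) = (α i : ℤ) - (N + 1 - 1 - (j : ℕ) : ℕ) := by omega
      rw [if_neg hj, if_neg (by omega), h, principal_hsymInt hq0 hq]
  rw [hdet, hpcoeff, principal_jacobiTrudi hq0 hq]
  ring

theorem prod_Ioi_eq_prod_Ioo {M : Type*} [CommMonoid M] (F : ℕ → ℕ → M) :
    ∏ i : Fin N, ∏ j ∈ Finset.Ioi i, F i j =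
      ∏ i ∈ Finset.range N, ∏ k ∈ Finset.Ioo i N, F i k := by
  rw [← Fin.prod_univ_eq_prod_range (fun i => ∏ k ∈ Finset.Ioo i N, F i k) N]
  refine Finset.prod_congr rfl fun i _ => ?_
  rw [← Fin.map_valEmbedding_Ioi, Finset.prod_map]
  rfl

theorem prod_Ioo_comm {M : Type*} [CommMonoid M] (F : ℕ → ℕ → M) (N : ℕ) :
    ∏ i ∈ Finset.range N, ∏ k ∈ Finset.Ioo i N, F i k =
      ∏ k ∈ Finset.range N, ∏ i ∈ Finset.range k, F i k := by
  refine Finset.prod_comm' fun i k => ?_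
  simp only [Finset.mem_range, Finset.mem_Ioo]
  omega

theorem prod_staircase_pow (N : ℕ) :
    ∏ j ∈ Finset.range N, ∏ r ∈ Finset.range j, q ^ r =
      ∏ k ∈ Finset.range N, q ^ (k * (N - 1 - k)) := by
  rw [← prod_Ioo_comm (fun i _ => q ^ i)]
  refine Finset.prod_congr rfl fun i _ => ?_
  rw [Finset.prod_const, Nat.card_Ioo, ← pow_mul]
  congr 2
  omega

/-- The principal specialization of a Schur function. -/
theorem principal_schur [CharZero K] (hq0 : q ≠ 0) (hq : ∀ k : ℕ, 0 < k → q ^ k ≠ 1)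
    {n : ℕ} (l : n.Partition) :
    (∏ s ∈ cells l, (1 - q ^ (arm l s + leg l s + 1))) * principal q (schur l) =
      q ^ nStat l := by
  set β := betaSeq l (len l) with hβ
  set N := len l with hN
  have hhook : (∏ s ∈ cells l, (1 - q ^ (arm l s + leg l s + 1))) *
      ∏ i ∈ Finset.range N, ∏ k ∈ Finset.Ioo i N, (1 - q ^ (β i - β k)) =
      ∏ i ∈ Finset.range N, qFac q (β i) := by
    rw [cells_eq_sigma, ← Finset.prod_mul_distrib]
    refine Finset.prod_congr rfl fun i hi => ?_
    exact prod_hook_row l (fun m => 1 - q ^ m) (Finset.mem_range.1 hi)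
  have hvan : (Matrix.vandermonde fun i : Fin N => q ^ β i).det =
      (∏ k ∈ Finset.range N, q ^ (k * β k)) *
        ∏ i ∈ Finset.range N, ∏ k ∈ Finset.Ioo i N, (1 - q ^ (β i - β k)) := by
    rw [Matrix.det_vandermonde, prod_Ioi_eq_prod_Ioo (fun i k => q ^ β k - q ^ β i)]
    have h1 : ∏ k ∈ Finset.range N, q ^ (k * β k) =
        ∏ i ∈ Finset.range N, ∏ k ∈ Finset.Ioo i N, q ^ β k := by
      rw [prod_Ioo_comm (fun _ k => q ^ β k)]
      refine Finset.prod_congr rfl fun k _ => ?_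
      rw [Finset.prod_const, Finset.card_range, ← pow_mul, mul_comm]
    rw [h1, ← Finset.prod_mul_distrib]
    refine Finset.prod_congr rfl fun i hi => ?_
    rw [← Finset.prod_mul_distrib]
    refine Finset.prod_congr rfl fun k hk => ?_
    rw [Finset.mem_Ioo] at hk
    have h2 : β k ≤ β i := by
      have := row_anti l hk.1.le
      simp only [hβ, betaSeq]
      omega
    rw [mul_sub, mul_one, ← pow_add, Nat.add_sub_cancel' h2]
  -- The signs from reversing the columns cancel those of the leading coefficients.
  have hsign : (∏ j : Fin N, (-1 : K) ^ (j : ℕ)) * ∏ j : Fin N, (fallPoly q j).coeff j =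
      (∏ k ∈ Finset.range N, q ^ (k * (N - 1 - k)))⁻¹ := by
    rw [← prod_staircase_pow, ← Finset.prod_mul_distrib,
      Fin.prod_univ_eq_prod_range (fun j => (-1 : K) ^ j * (fallPoly q j).coeff j) N,
      ← Finset.prod_inv_distrib]
    refine Finset.prod_congr rfl fun j _ => ?_
    rw [coeff_fallPoly, Finset.prod_neg, Finset.card_range, ← mul_assoc, ← mul_pow,
      ← Finset.prod_inv_distrib]
    simp
  -- Since k β_k = k λ_k + k (N - 1 - k), the first summands build up n(λ) and the second cancel the
  -- power of q in `hsign`.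
  have hpow : ∏ k ∈ Finset.range N, q ^ (k * β k) =
      q ^ nStat l * ∏ k ∈ Finset.range N, q ^ (k * (N - 1 - k)) := by
    rw [nStat, ← Finset.prod_pow_eq_pow_sum, ← Finset.prod_mul_distrib]
    refine Finset.prod_congr rfl fun k _ => ?_
    rw [← pow_add, ← mul_add]
    rfl
  have hfac : ∏ i : Fin N, (qFac q (β i))⁻¹ = (∏ i ∈ Finset.range N, qFac q (β i))⁻¹ := by
    rw [Fin.prod_univ_eq_prod_range (fun i => (qFac q (β i))⁻¹) N, Finset.prod_inv_distrib]
  have n1 : ∏ i ∈ Finset.range N, qFac q (β i) ≠ 0 :=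
    Finset.prod_ne_zero_iff.2 fun i _ => qFac_ne_zero hq _
  have n2 : ∏ k ∈ Finset.range N, q ^ (k * (N - 1 - k)) ≠ 0 :=
    Finset.prod_ne_zero_iff.2 fun i _ => pow_ne_zero _ hq0
  rw [schur_eq_jacobiTrudi_len, principal_jacobiTrudi hq0 hq, hfac, hvan, hpow,
    mul_left_comm (∏ j : Fin N, (-1 : K) ^ (j : ℕ)), hsign, ← hhook]
  rw [← hhook] at n1
  field_simp
  exact div_self n1

/-- Summing geometrically along each row turns the content sum into ∑ q^(-i) (1 - q^(λ_i)), the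
factor found in `principal_pderiv_jacobiTrudi`. -/
theorem principal_pderiv_schur [CharZero K] (hq0 : q ≠ 0) (hq : ∀ k : ℕ, 0 < k → q ^ k ≠ 1)
    {n : ℕ} (l : n.Partition) :
    principal q (MvPolynomial.pderiv 1 (schur l)) =
      (1 - q) * (∑ s ∈ cells l, q ^ s.2 * (q⁻¹) ^ s.1) * principal q (schur l) := by
  have hsum : ∑ s ∈ cells l, q ^ s.2 * (q⁻¹) ^ s.1 =
      ∑ i ∈ Finset.range (len l), ∑ j ∈ Finset.range (row l i), q ^ j * (q⁻¹) ^ i := by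
    have := cells_eq_sigma (M := Multiplicative K) l
      (fun s => Multiplicative.ofAdd (q ^ s.2 * (q⁻¹) ^ s.1))
    exact this
  have hgeom : (1 - q) * ∑ s ∈ cells l, q ^ s.2 * (q⁻¹) ^ s.1 =
      ∑ i ∈ Finset.range (len l), (q⁻¹) ^ i * (1 - q ^ row l i) := by
    rw [hsum, Finset.mul_sum]
    refine Finset.sum_congr rfl fun i _ => ?_
    rw [← Finset.sum_mul, ← mul_assoc, mul_neg_geom_sum, mul_comm]
  rw [hgeom]
  have hcase : ∀ N, N = len l → (principal q (MvPolynomial.pderiv 1 (schur l)) =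
      (∑ i ∈ Finset.range N, (q⁻¹) ^ i * (1 - q ^ row l i)) * principal q (schur l)) := by
    intro N hN
    rw [schur_eq_jacobiTrudi l hN.ge]
    cases N with
    | zero => simp [jacobiTrudi]
    | succ N =>
      rw [principal_pderiv_jacobiTrudi hq0 hq]
      congr 1
      -- After reflection of the first sum, q^(N-i) stands next to q^(β_i) = q^(λ_i) q^(N-i).
      rw [Fin.sum_univ_eq_sum_range (fun i => q ^ betaSeq l (N + 1) i), ← Finset.sum_range_reflect,
        ← Finset.sum_sub_distrib, Finset.mul_sum]
      refine Finset.sum_congr rfl fun i hi => ?_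
      rw [Finset.mem_range] at hi
      have h1 : (q⁻¹) ^ N * q ^ (N - i) = (q⁻¹) ^ i := by
        obtain ⟨k, rfl⟩ : ∃ k, N = i + k := ⟨N - i, by omega⟩
        rw [Nat.add_sub_cancel_left, pow_add, mul_assoc, ← mul_pow, inv_mul_cancel₀ hq0, one_pow,
          mul_one]
      simp only [betaSeq, Nat.add_sub_cancel, pow_add]
      linear_combination (1 - q ^ row l i) * h1
  exact hcase _ rfl

end PrincipalSpecialization
end CharVar
end

noncomputable section
namespace CharVar

/-! ### Values of rational functions and the specialization at zw = 1. -/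

section Reduction

variable {L : Type*} [Field L] [Algebra ℚ L]

theorem algebraMap_ne_zero_of_aeval {a : Fin 2 → L} {d : MvPolynomial (Fin 2) ℚ}
    (hd : MvPolynomial.aeval a d ≠ 0) : algebraMap (MvPolynomial (Fin 2) ℚ) QZW d ≠ 0 := by
  intro h
  apply hd
  rw [IsFractionRing.injective (MvPolynomial (Fin 2) ℚ) QZW (h.trans (map_zero _).symm), map_zero]

/-- The pairs `(f, f(a))` for the rational functions `f` defined at `a`. -/
def valuePairs (a : Fin 2 → L) : Subalgebra ℚ (QZW × L) where
  carrier := {x | ∃ p d : MvPolynomial (Fin 2) ℚ, MvPolynomial.aeval a d ≠ 0 ∧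
    x.1 = algebraMap (MvPolynomial (Fin 2) ℚ) QZW p / algebraMap (MvPolynomial (Fin 2) ℚ) QZW d ∧
    x.2 = MvPolynomial.aeval a p / MvPolynomial.aeval a d}
  mul_mem' := by
    rintro ⟨x, y⟩ ⟨x', y'⟩ ⟨p, d, hd, rfl, rfl⟩ ⟨p', d', hd', rfl, rfl⟩
    refine ⟨p * p', d * d', by rw [map_mul]; exact mul_ne_zero hd hd', ?_, ?_⟩
    · simp only [Prod.mk_mul_mk, map_mul]; rw [div_mul_div_comm]
    · simp only [Prod.mk_mul_mk, map_mul]; rw [div_mul_div_comm]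
  add_mem' := by
    rintro ⟨x, y⟩ ⟨x', y'⟩ ⟨p, d, hd, rfl, rfl⟩ ⟨p', d', hd', rfl, rfl⟩
    refine ⟨p * d' + d * p', d * d', by rw [map_mul]; exact mul_ne_zero hd hd', ?_, ?_⟩
    · simp only [Prod.mk_add_mk, map_mul, map_add]
      rw [div_add_div _ _ (algebraMap_ne_zero_of_aeval hd) (algebraMap_ne_zero_of_aeval hd')]
    · simp only [Prod.mk_add_mk, map_mul, map_add]
      rw [div_add_div _ _ hd hd']
  algebraMap_mem' := by
    intro r
    refine ⟨MvPolynomial.C r, 1, by simp, ?_, ?_⟩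
    · rw [map_one, div_one, ← MvPolynomial.algebraMap_eq, ← IsScalarTower.algebraMap_apply]
      rfl
    · rw [map_one, div_one, ← MvPolynomial.algebraMap_eq, AlgHom.commutes]
      rfl

/-- `f` is defined at `a` with value `y`. -/
def HasValue (a : Fin 2 → L) (x : QZW) (y : L) : Prop := (x, y) ∈ valuePairs a

/-- The projection of a pair to the rational function. -/
def pairFun (a : Fin 2 → L) : valuePairs a →+* QZW :=
  (RingHom.fst QZW L).comp (valuePairs a).val.toRingHom

/-- The projection of a pair to the value. -/
def pairVal (a : Fin 2 → L) : valuePairs a →+* L :=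
  (RingHom.snd QZW L).comp (valuePairs a).val.toRingHom

variable {a : Fin 2 → L}

/-- Once the data are lifted to `valuePairs a`, a computation done there yields both the rational
function and its value, by the two projections. -/
theorem hasValue_iff {x : QZW} {y : L} :
    HasValue a x y ↔ ∃ s : valuePairs a, pairFun a s = x ∧ pairVal a s = y :=
  ⟨fun h => ⟨⟨(x, y), h⟩, rfl, rfl⟩, by rintro ⟨s, rfl, rfl⟩; exact s.2⟩

theorem HasValue.regularAt {x : QZW} {y : L} (h : HasValue a x y) : RegularAt x a := by
  obtain ⟨p, d, hd, h1, -⟩ := h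
  exact ⟨(p, d), hd, h1⟩

theorem HasValue.evalAt {x : QZW} {y : L} (h : HasValue a x y) : evalAt x a = y := by
  obtain ⟨p, d, hd, h1, h2⟩ := h
  rw [evalAt_eq x a (p, d) ⟨hd, h1⟩]
  exact h2.symm

theorem HasValue.sub {x x' : QZW} {y y' : L} (h : HasValue a x y) (h' : HasValue a x' y') :
    HasValue a (x - x') (y - y') := (valuePairs a).sub_mem h h'

theorem HasValue.mul {x x' : QZW} {y y' : L} (h : HasValue a x y) (h' : HasValue a x' y') :
    HasValue a (x * x') (y * y') := (valuePairs a).mul_mem h h'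

theorem HasValue.pow {x : QZW} {y : L} (h : HasValue a x y) (m : ℕ) :
    HasValue a (x ^ m) (y ^ m) := (valuePairs a).pow_mem h m

theorem HasValue.one : HasValue a 1 1 := (valuePairs a).one_mem

theorem HasValue.inv {x : QZW} {y : L} (h : HasValue a x y) (hy : y ≠ 0) :
    HasValue a x⁻¹ y⁻¹ := by
  obtain ⟨p, d, hd, h1, h2⟩ := h
  simp only at h1 h2
  refine ⟨d, p, ?_, ?_, ?_⟩
  · intro h0
    rw [h0, zero_div] at h2
    exact hy h2
  · simp only [h1, inv_div]
  · simp only [h2, inv_div]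

theorem HasValue.div {x x' : QZW} {y y' : L} (h : HasValue a x y) (h' : HasValue a x' y')
    (hy : y' ≠ 0) : HasValue a (x / x') (y / y') := by
  rw [div_eq_mul_inv, div_eq_mul_inv]
  exact h.mul (h'.inv hy)

theorem HasValue.sum {ι : Type*} (s : Finset ι) {x : ι → QZW} {y : ι → L}
    (h : ∀ i ∈ s, HasValue a (x i) (y i)) : HasValue a (∑ i ∈ s, x i) (∑ i ∈ s, y i) := by
  have h' : ∀ i ∈ s, (x i, y i) ∈ valuePairs a := h
  have := (valuePairs a).sum_mem h'
  have e : ∑ i ∈ s, (x i, y i) = (∑ i ∈ s, x i, ∑ i ∈ s, y i) :=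
    Prod.ext (Prod.fst_sum ..) (Prod.snd_sum ..)
  rwa [e] at this

theorem HasValue.prod {ι : Type*} (s : Finset ι) {x : ι → QZW} {y : ι → L}
    (h : ∀ i ∈ s, HasValue a (x i) (y i)) : HasValue a (∏ i ∈ s, x i) (∏ i ∈ s, y i) := by
  have h' : ∀ i ∈ s, (x i, y i) ∈ valuePairs a := h
  have := (valuePairs a).prod_mem h'
  have e : ∏ i ∈ s, (x i, y i) = (∏ i ∈ s, x i, ∏ i ∈ s, y i) :=
    Prod.ext (Prod.fst_prod ..) (Prod.snd_prod ..)
  rwa [e] at this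

theorem hasValue_zv : HasValue a zv (a 0) := ⟨MvPolynomial.X 0, 1, by simp, by simp [zv], by simp⟩

theorem hasValue_wv : HasValue a wv (a 1) := ⟨MvPolynomial.X 1, 1, by simp, by simp [wv], by simp⟩

/-- The coefficients of `f` are defined at `a` and have the coefficients of `g` as values. -/
def SymHasValue (a : Fin 2 → L) (f : Sym QZW) (g : Sym L) : Prop :=
  ∃ F : MvPolynomial ℕ+ (valuePairs a),
    MvPolynomial.map (pairFun a) F = f ∧ MvPolynomial.map (pairVal a) F = g

theorem SymHasValue.sub {f f' : Sym QZW} {g g' : Sym L} (h : SymHasValue a f g)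
    (h' : SymHasValue a f' g') : SymHasValue a (f - f') (g - g') := by
  obtain ⟨F, rfl, rfl⟩ := h
  obtain ⟨F', rfl, rfl⟩ := h'
  exact ⟨F - F', by simp, by simp⟩

theorem SymHasValue.sum {ι : Type*} (s : Finset ι) {x : ι → Sym QZW} {y : ι → Sym L}
    (h : ∀ i ∈ s, SymHasValue a (x i) (y i)) :
    SymHasValue a (∑ i ∈ s, x i) (∑ i ∈ s, y i) := by
  classical
  choose! F hF using h
  refine ⟨∑ i ∈ s, F i, ?_, ?_⟩
  · rw [map_sum]; exact Finset.sum_congr rfl fun i hi => (hF i hi).1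
  · rw [map_sum]; exact Finset.sum_congr rfl fun i hi => (hF i hi).2

theorem SymHasValue.C_mul {x : QZW} {y : L} {f : Sym QZW} {g : Sym L} (hx : HasValue a x y)
    (h : SymHasValue a f g) : SymHasValue a (MvPolynomial.C x * f) (MvPolynomial.C y * g) := by
  obtain ⟨F, rfl, rfl⟩ := h
  obtain ⟨s, rfl, rfl⟩ := hasValue_iff.1 hx
  exact ⟨MvPolynomial.C s * F, by simp, by simp⟩

theorem SymHasValue.pderiv {f : Sym QZW} {g : Sym L} (k : ℕ+) (h : SymHasValue a f g) :
    SymHasValue a (MvPolynomial.pderiv k f) (MvPolynomial.pderiv k g) := by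
  obtain ⟨F, rfl, rfl⟩ := h
  exact ⟨MvPolynomial.pderiv k F, by rw [MvPolynomial.pderiv_map], by rw [MvPolynomial.pderiv_map]⟩

theorem SymHasValue.eval {f : Sym QZW} {g : Sym L} {x : ℕ+ → QZW} {y : ℕ+ → L}
    (h : SymHasValue a f g) (hxy : ∀ k, HasValue a (x k) (y k)) :
    HasValue a (MvPolynomial.eval x f) (MvPolynomial.eval y g) := by
  obtain ⟨F, rfl, rfl⟩ := h
  choose s hs using fun k => hasValue_iff.1 (hxy k)
  obtain rfl : (fun k => pairFun a (s k)) = x := funext fun k => (hs k).1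
  obtain rfl : (fun k => pairVal a (s k)) = y := funext fun k => (hs k).2
  refine hasValue_iff.2 ⟨MvPolynomial.eval s F, ?_, ?_⟩
  · rw [MvPolynomial.eval_map]; exact MvPolynomial.eval₂_comp (pairFun a) s F
  · rw [MvPolynomial.eval_map]; exact MvPolynomial.eval₂_comp (pairVal a) s F

theorem SymHasValue.pairing {f f' : Sym QZW} {g g' : Sym L} {c : ℕ+ → QZW} {c' : ℕ+ → L}
    (h : SymHasValue a f g) (h' : SymHasValue a f' g') (hc : ∀ k, HasValue a (c k) (c' k)) :
    HasValue a (pairing c f f') (pairing c' g g') := by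
  obtain ⟨F, rfl, rfl⟩ := h
  obtain ⟨F', rfl, rfl⟩ := h'
  choose s hs using fun k => hasValue_iff.1 (hc k)
  obtain rfl : (fun k => pairFun a (s k)) = c := funext fun k => (hs k).1
  obtain rfl : (fun k => pairVal a (s k)) = c' := funext fun k => (hs k).2
  rw [pairing_eq_sum _ _ _ F.support (MvPolynomial.support_map_subset _ _),
    pairing_eq_sum _ _ _ F.support (MvPolynomial.support_map_subset _ _)]
  refine hasValue_iff.2 ⟨∑ b ∈ F.support, F.coeff b * F'.coeff b *
      b.prod fun k m => (((k : ℕ) : valuePairs a) * s k) ^ m * (m.factorial : valuePairs a), ?_, ?_⟩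
  · simp [map_sum, Finsupp.prod, map_prod, MvPolynomial.coeff_map]
  · simp [map_sum, Finsupp.prod, map_prod, MvPolynomial.coeff_map]

theorem map_hsym {K K' : Type*} [Field K] [Field K'] (φ : K →+* K') (n : ℕ) :
    MvPolynomial.map φ (hsym n : Sym K) = hsym n := by
  ext b
  rw [MvPolynomial.coeff_map, coeff_hsym, coeff_hsym]
  split_ifs <;> simp

theorem map_schur {K K' : Type*} [Field K] [Field K'] (φ : K →+* K') {n : ℕ}
    (l : n.Partition) : MvPolynomial.map φ (schur l : Sym K) = schur l := by
  rw [schur, RingHom.map_det, schur]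
  congr 1
  ext1 i j
  simp only [RingHom.mapMatrix_apply, Matrix.map_apply, Matrix.of_apply, hsymInt]
  split_ifs
  · exact map_hsym φ _
  · exact map_zero _

theorem symHasValue_schur {n : ℕ} (l : n.Partition) :
    SymHasValue a (schur l) (schur l) := by
  refine ⟨MvPolynomial.map (algebraMap ℚ (valuePairs a)) (schur l), ?_, ?_⟩
  · rw [MvPolynomial.map_map, map_schur]
  · rw [MvPolynomial.map_map, map_schur]

/-- At `w = z⁻¹` the Macdonald functions `P_λ(x; z², w⁻²)` become the Schur functions. -/
theorem symHasValue_macP [CharZero L] (h01 : a 0 * a 1 = 1)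
    (hq : ∀ k : ℕ, 0 < k → (a 0 ^ 2) ^ k ≠ 1)
    {n : ℕ} (l : n.Partition) :
    SymHasValue a (macP (zv ^ 2) (wv ^ 2)⁻¹ l) (schur l) := by
  classical
  have ha1 : a 1 ≠ 0 := right_ne_zero_of_mul_eq_one h01
  have hinv : (a 1 ^ 2)⁻¹ = a 0 ^ 2 := by
    rw [← inv_pow, ← eq_inv_of_mul_eq_one_left h01]
  have ht : HasValue a (wv ^ 2)⁻¹ (a 0 ^ 2) := by
    rw [← hinv]
    exact (hasValue_wv.pow 2).inv (pow_ne_zero 2 ha1)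
  have hz : HasValue a (zv ^ 2) (a 0 ^ 2) := hasValue_zv.pow 2
  -- These quotients are the weights of Macdonald's pairing; their value 1 turns it into the Hall
  -- pairing.
  have hc : ∀ k : ℕ+, HasValue a
      ((1 - (zv ^ 2) ^ (k : ℕ)) / (1 - ((wv ^ 2)⁻¹) ^ (k : ℕ))) 1 := by
    intro k
    have hne : 1 - (a 0 ^ 2) ^ (k : ℕ) ≠ 0 := sub_ne_zero.2 (hq k k.pos).symm
    have := (HasValue.one.sub (hz.pow k)).div (HasValue.one.sub (ht.pow k)) hne
    rwa [div_self hne] at this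
  induction l using (lexLT_wf n).induction with
  | _ l ih =>
    -- The Gram–Schmidt coefficients have the values ⟨s_λ, s_μ⟩ / ⟨s_μ, s_μ⟩ = 0/1. That the
    -- denominator takes the value 1 keeps P_λ defined at the point.
    have hcoef : ∀ m : {m : n.Partition // LexLT m l}, HasValue a
        (hallQT (zv ^ 2) (wv ^ 2)⁻¹ (schur l) (macP (zv ^ 2) (wv ^ 2)⁻¹ m.1) /
          hallQT (zv ^ 2) (wv ^ 2)⁻¹ (macP (zv ^ 2) (wv ^ 2)⁻¹ m.1)
            (macP (zv ^ 2) (wv ^ 2)⁻¹ m.1)) 0 := by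
      intro m
      have h1 := (symHasValue_schur l).pairing (ih m.1 m.2) hc
      have h2 := (ih m.1 m.2).pairing (ih m.1 m.2) hc
      have e1 : pairing (fun _ => (1 : L)) (schur l) (schur m.1) = 0 := by
        have := hall_schur (K := L) l m.1
        rw [if_neg] at this
        · exact this
        · intro h
          have hm := m.2
          rw [← h] at hm
          exact lt_irrefl _ hm
      have e2 : pairing (fun _ => (1 : L)) (schur m.1) (schur m.1) = 1 := by
        have := hall_schur (K := L) m.1 m.1
        rwa [if_pos rfl] at this
      rw [e1] at h1
      rw [e2] at h2
      have := h1.div h2 one_ne_zero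
      rwa [zero_div] at this
    have hs := (symHasValue_schur (a := a) l).sub
      (SymHasValue.sum Finset.univ fun m (_ : m ∈ Finset.univ) => (ih m.1 m.2).C_mul (hcoef m))
    rw [macP]
    simpa using hs

/-- Let h be the hook length. Every difference z^u - w^v in the factor has u + v = 2h, hence equals
w^v (z^(2h) - 1) on zw = 1. The powers of w agree in numerator and denominator, and genus one makes
the powers of z^(2h) - 1 agree as well. -/
theorem hasValue_hookFun (h01 : a 0 * a 1 = 1) (hq : ∀ k : ℕ, 0 < k → (a 0 ^ 2) ^ k ≠ 1)
    {n : ℕ} (l : n.Partition) : HasValue a (hookFun 1 l) 1 := by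
  rw [hookFun, ← Finset.prod_const_one (M := L) (s := cells l)]
  refine HasValue.prod _ fun s _ => ?_
  have ha0 : a 0 ≠ 0 := left_ne_zero_of_mul_eq_one h01
  have ha1 : a 1 ≠ 0 := right_ne_zero_of_mul_eq_one h01
  have hm : ∀ m : ℕ, a 0 ^ m * a 1 ^ m = 1 := fun m => by rw [← mul_pow, h01, one_pow]
  generalize arm l s = i
  generalize leg l s = j
  set Q := (a 0 ^ 2) ^ (i + j + 1) - 1 with hQ
  have hQ0 : Q ≠ 0 := sub_ne_zero.2 (hq _ (Nat.succ_pos _))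
  have e : ∀ u v : ℕ, u + v = 2 * (i + j + 1) → a 0 ^ u - a 1 ^ v = a 1 ^ v * Q := by
    intro u v huv
    rw [hQ, ← pow_mul, ← huv, pow_add]
    linear_combination (-a 0 ^ u) * hm v
  have h1 : HasValue a ((zv ^ (2 * i + 1) - wv ^ (2 * j + 1)) ^ (2 * 1))
      ((a 1 ^ (2 * j + 1) * Q) ^ (2 * 1)) := by
    rw [← e (2 * i + 1) (2 * j + 1) (by ring)]
    exact ((hasValue_zv.pow _).sub (hasValue_wv.pow _)).pow _
  have h2 : HasValue a (zv ^ (2 * i + 2) - wv ^ (2 * j)) (a 1 ^ (2 * j) * Q) := by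
    rw [← e (2 * i + 2) (2 * j) (by ring)]
    exact (hasValue_zv.pow _).sub (hasValue_wv.pow _)
  have h3 : HasValue a (zv ^ (2 * i) - wv ^ (2 * j + 2)) (a 1 ^ (2 * j + 2) * Q) := by
    rw [← e (2 * i) (2 * j + 2) (by ring)]
    exact (hasValue_zv.pow _).sub (hasValue_wv.pow _)
  have hne : (a 1 ^ (2 * j) * Q) * (a 1 ^ (2 * j + 2) * Q) ≠ 0 :=
    mul_ne_zero (mul_ne_zero (pow_ne_zero _ ha1) hQ0) (mul_ne_zero (pow_ne_zero _ ha1) hQ0)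
  have h4 := h1.div (h2.mul h3) hne
  have e1 : (a 1 ^ (2 * j + 1) * Q) ^ (2 * 1) / ((a 1 ^ (2 * j) * Q) * (a 1 ^ (2 * j + 2) * Q)) =
      1 := by
    rw [div_eq_one_iff_eq hne]
    ring
  rwa [e1] at h4

/-- The coefficient extraction `⟨f, h_{n-1} h_1⟩` on homogeneous functions. -/
def hookCoeff {K : Type*} [Field K] : Sym K →ₗ[K] K :=
  (MvPolynomial.aeval (fun _ : ℕ+ => (1 : K))).toLinearMap ∘ₗ
    (MvPolynomial.pderiv (1 : ℕ+) : Derivation K (Sym K) (Sym K)).toLinearMap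

theorem hookCoeff_apply {K : Type*} [Field K] (f : Sym K) :
    hookCoeff f = MvPolynomial.eval (fun _ => 1) (MvPolynomial.pderiv 1 f) := by
  simp [hookCoeff, MvPolynomial.aeval_eq_eval]

theorem eval_one_plethDiv {K : Type*} [Field K] (t : K) (f : Sym K) :
    MvPolynomial.eval (fun _ => 1) (plethDiv t f) = principal t f := by
  induction f using MvPolynomial.induction_on with
  | C c => simp [plethDiv, principal]
  | add p q hp hq => rw [map_add, map_add, hp, hq, map_add]
  | mul_X p k ih =>
    rw [map_mul, map_mul, ih, map_mul]
    simp [plethDiv, principal]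

theorem pderiv_one_plethDiv {K : Type*} [Field K] (t : K) (f : Sym K) :
    MvPolynomial.pderiv 1 (plethDiv t f) =
      MvPolynomial.C (1 - t)⁻¹ * plethDiv t (MvPolynomial.pderiv 1 f) := by
  classical
  induction f using MvPolynomial.induction_on with
  | C c => simp [plethDiv]
  | add p q hp hq => rw [map_add, map_add, hp, hq, map_add, map_add, mul_add]
  | mul_X p k ih =>
    rw [map_mul, Derivation.leibniz, ih, Derivation.leibniz, smul_eq_mul, smul_eq_mul, smul_eq_mul,
      smul_eq_mul, map_add, map_mul, map_mul, MvPolynomial.pderiv_X]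
    have h1 : MvPolynomial.pderiv 1 (plethDiv t (MvPolynomial.X k)) =
        MvPolynomial.C (1 - t)⁻¹ * plethDiv t ((Pi.single 1 1 : ℕ+ → Sym K) k) := by
      by_cases hk : k = 1
      · subst hk
        simp [plethDiv]
      · have : ((Pi.single 1 1 : ℕ+ → Sym K) k) = 0 := by simp [hk]
        rw [this]
        simp [plethDiv, MvPolynomial.pderiv_X, hk]
    rw [h1]
    ring

/-- The normalization of H̃_λ becomes q^(-n(λ)) times the hook product, the inverse of the principal
specialization of s_λ. In the second value, 1/(1 - q) from differentiating the plethysm cancels the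
factor of `principal_pderiv_schur`. -/
theorem hasValue_eval_macH [CharZero L] (h01 : a 0 * a 1 = 1)
    (hq : ∀ k : ℕ, 0 < k → (a 0 ^ 2) ^ k ≠ 1)
    {n : ℕ} (l : n.Partition) :
    HasValue a (MvPolynomial.eval (fun _ => 1) (macH (zv ^ 2) (wv ^ 2) l)) 1 ∧
    HasValue a (hookCoeff (macH (zv ^ 2) (wv ^ 2) l))
      (∑ s ∈ cells l, (a 0 ^ 2) ^ s.2 * ((a 0 ^ 2)⁻¹) ^ s.1) := by
  have ha0 : a 0 ≠ 0 := left_ne_zero_of_mul_eq_one h01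
  have ha1 : a 1 ≠ 0 := right_ne_zero_of_mul_eq_one h01
  have hinv : (a 1 ^ 2)⁻¹ = a 0 ^ 2 := by
    rw [← inv_pow, ← eq_inv_of_mul_eq_one_left h01]
  have hinv' : a 1 ^ 2 = (a 0 ^ 2)⁻¹ := by rw [← hinv, inv_inv]
  have hz : HasValue a (zv ^ 2) (a 0 ^ 2) := hasValue_zv.pow 2
  have hw : HasValue a (wv ^ 2) (a 0 ^ 2)⁻¹ := hinv' ▸ hasValue_wv.pow 2
  have ht : HasValue a (wv ^ 2)⁻¹ (a 0 ^ 2) := by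
    rw [← hinv]
    exact (hasValue_wv.pow 2).inv (pow_ne_zero 2 ha1)
  set Q := a 0 ^ 2 with hQ
  have hQ0 : Q ≠ 0 := pow_ne_zero 2 ha0
  have hpt : ∀ k : ℕ+, HasValue a (1 - ((wv ^ 2)⁻¹) ^ (k : ℕ))⁻¹ (1 - Q ^ (k : ℕ))⁻¹ := fun k =>
    (HasValue.one.sub (ht.pow k)).inv (sub_ne_zero.2 (hq k k.pos).symm)
  have hP := symHasValue_macP h01 hq l
  have hpre : HasValue a ((wv ^ 2) ^ nStat l * ∏ s ∈ cells l,
      (1 - (zv ^ 2) ^ arm l s * ((wv ^ 2)⁻¹) ^ (leg l s + 1)))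
      ((Q⁻¹) ^ nStat l * ∏ s ∈ cells l, (1 - Q ^ (arm l s + leg l s + 1))) := by
    refine (hw.pow _).mul (HasValue.prod _ fun s _ => ?_)
    rw [add_assoc, pow_add Q]
    exact HasValue.one.sub ((hz.pow _).mul (ht.pow _))
  have hval : (Q⁻¹) ^ nStat l * (∏ s ∈ cells l, (1 - Q ^ (arm l s + leg l s + 1))) *
      principal Q (schur l) = 1 := by
    rw [mul_assoc, principal_schur hQ0 hq, ← mul_pow, inv_mul_cancel₀ hQ0, one_pow]
  constructor
  · have h := hpre.mul (hP.eval hpt)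
    have e1 : MvPolynomial.eval (fun k : ℕ+ => (1 - Q ^ (k : ℕ))⁻¹) (schur l) =
      principal Q (schur l) := rfl
    rw [e1, hval] at h
    convert! h using 1
    rw [macH, macJ, map_mul, eval_one_plethDiv, map_mul, principal, MvPolynomial.eval_C,
      MvPolynomial.eval_C, mul_assoc]
  · have h := (hpre.mul ((HasValue.one.sub ht).inv
      (sub_ne_zero.2 (by simpa using (hq 1 one_pos).symm)))).mul ((hP.pderiv 1).eval hpt)
    have e1 : MvPolynomial.eval (fun k : ℕ+ => (1 - Q ^ (k : ℕ))⁻¹)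
      (MvPolynomial.pderiv 1 (schur l)) =
      principal Q (MvPolynomial.pderiv 1 (schur l)) := rfl
    have e2 : (Q⁻¹) ^ nStat l * (∏ s ∈ cells l, (1 - Q ^ (arm l s + leg l s + 1))) * (1 - Q)⁻¹ *
        principal Q (MvPolynomial.pderiv 1 (schur l)) = ∑ s ∈ cells l, Q ^ s.2 * (Q⁻¹) ^ s.1 := by
      have hne : 1 - Q ≠ 0 := sub_ne_zero.2 (by simpa using (hq 1 one_pos).symm)
      rw [principal_pderiv_schur hQ0 hq]
      calc _ = ((Q⁻¹) ^ nStat l * (∏ s ∈ cells l, (1 - Q ^ (arm l s + leg l s + 1))) *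
            principal Q (schur l)) * ((1 - Q)⁻¹ * (1 - Q)) *
              ∑ s ∈ cells l, Q ^ s.2 * (Q⁻¹) ^ s.1 := by ring
        _ = _ := by rw [hval, inv_mul_cancel₀ hne, one_mul, one_mul]
    rw [e1, e2] at h
    convert! h using 1
    rw [macH, macJ, hookCoeff_apply, MvPolynomial.pderiv_C_mul, map_mul,
      pderiv_one_plethDiv, MvPolynomial.pderiv_C_mul, map_mul, eval_one_plethDiv, map_mul,
      principal, MvPolynomial.eval_C, MvPolynomial.eval_C, MvPolynomial.eval_C]
    ring

end Reduction
end CharVar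
end

noncomputable section
namespace CharVar

/-! ### Homogeneity, which allows Hall pairings to be replaced by evaluations. -/

section Homogeneity

open MvPolynomial

variable {K : Type*} [Field K]

/-- The weights of the power sums. -/
def psumWeight (k : ℕ+) : ℤ := ((k : ℕ) : ℤ)

theorem weight_psumWeight (a : ℕ+ →₀ ℕ) : Finsupp.weight psumWeight a = (wt a : ℤ) := by
  simp [Finsupp.weight_apply, wt, Finsupp.sum, psumWeight]

theorem isWeightedHomogeneous_hsymInt (m : ℤ) :
    IsWeightedHomogeneous psumWeight (hsymInt m : Sym K) m := by
  rcases lt_or_ge m 0 with hm | hm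
  · rw [hsymInt_of_neg hm]
    exact isWeightedHomogeneous_zero _ _ _
  · lift m to ℕ using hm
    rw [hsymInt_natCast]
    intro a ha
    rw [coeff_hsym] at ha
    rw [weight_psumWeight]
    by_contra h
    rw [if_neg (by exact_mod_cast h)] at ha
    exact ha rfl

theorem isWeightedHomogeneous_C_mul {f : Sym K} {m : ℤ} (c : K)
    (hf : IsWeightedHomogeneous psumWeight f m) :
    IsWeightedHomogeneous psumWeight (C c * f) m := by
  have := (isWeightedHomogeneous_C psumWeight c).mul hf
  rwa [zero_add] at this

/-- In each term of the determinant the row and column shifts cancel in the sum of the indices,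
which leaves ∑ λ_i. -/
theorem isWeightedHomogeneous_schur {n : ℕ} (l : n.Partition) :
    IsWeightedHomogeneous psumWeight (schur l : Sym K) n := by
  rw [schur, ← Matrix.det_transpose, Matrix.det_apply]
  refine IsWeightedHomogeneous.sum _ _ _ fun σ _ => ?_
  have h : IsWeightedHomogeneous psumWeight (∏ i, (Matrix.of fun i j : Fin (len l) =>
      (hsymInt ((row l i : ℤ) - (i : ℤ) + (j : ℤ)) : Sym K)).transpose (σ i) i) n := by
    have h1 : (n : ℤ) = ∑ i : Fin (len l), ((row l i : ℤ) - ((i : ℕ) : ℤ) + ((σ i : ℕ) : ℤ)) := by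
      rw [Finset.sum_add_distrib, Finset.sum_sub_distrib,
        Equiv.sum_comp σ (fun i : Fin (len l) => ((i : ℕ) : ℤ)), sub_add_cancel,
        Fin.sum_univ_eq_sum_range (fun i => (row l i : ℤ)), ← Nat.cast_sum, sum_row]
    conv => arg 3; rw [h1]
    refine IsWeightedHomogeneous.prod _ _ _ fun i _ => ?_
    exact isWeightedHomogeneous_hsymInt _
  rcases Int.units_eq_one_or (Equiv.Perm.sign σ) with hs | hs
  · rw [hs, one_smul]; exact h
  · rw [hs, Units.smul_def, Units.val_neg, Units.val_one, neg_one_zsmul]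
    exact h.neg

theorem isWeightedHomogeneous_macP (q t : K) {n : ℕ} (l : n.Partition) :
    IsWeightedHomogeneous psumWeight (macP q t l) n := by
  induction l using (lexLT_wf n).induction with
  | _ l ih =>
    rw [macP]
    refine (isWeightedHomogeneous_schur l).sub (IsWeightedHomogeneous.sum _ _ _ fun m _ => ?_)
    exact isWeightedHomogeneous_C_mul _ (ih m.1 m.2)

/-- The substitution is diagonal in the monomials p^a, hence preserves the degree. -/
theorem coeff_plethDiv (t : K) (f : Sym K) (a : ℕ+ →₀ ℕ) :
    coeff a (plethDiv t f) = coeff a f * a.prod fun k m => ((1 - t ^ (k : ℕ))⁻¹) ^ m := by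
  classical
  induction f using MvPolynomial.induction_on' with
  | monomial b c =>
    have : plethDiv t (monomial b c) =
        monomial b (c * b.prod fun k m => ((1 - t ^ (k : ℕ))⁻¹) ^ m) := by
      rw [plethDiv, aeval_monomial, algebraMap_eq, monomial_eq (s := b), C_mul, mul_assoc]
      simp only [mul_pow, Finsupp.prod_mul]
      congr 2
      simp only [Finsupp.prod, map_prod, map_pow]
    rw [this, coeff_monomial, coeff_monomial]
    split_ifs with h
    · rw [h]
    · rw [zero_mul]
  | add p q hp hq => rw [map_add, coeff_add, coeff_add, hp, hq, add_mul]

theorem isWeightedHomogeneous_macH (q t : K) {n : ℕ} (l : n.Partition) :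
    IsWeightedHomogeneous psumWeight (macH q t l) n := by
  refine isWeightedHomogeneous_C_mul _ fun a ha => ?_
  rw [coeff_plethDiv] at ha
  exact isWeightedHomogeneous_C_mul _ (isWeightedHomogeneous_macP q t⁻¹ l)
    (left_ne_zero_of_mul ha)

end Homogeneity

/-! ### The logarithm of a series and the coefficient functional ⟨·, h_n h_1⟩. -/

section Logarithm

open PowerSeries

theorem mul_derivative_logOf {A : Type*} [CommRing A] [Algebra ℚ A] {f : PowerSeries A}
    (hf : constantCoeff f = 1) : f * d⁄dX A (logOf f) = d⁄dX A f := by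
  have hs : HasSubst (f - 1) :=
    HasSubst.of_constantCoeff_zero' (by rw [map_sub, hf, map_one, sub_self])
  have h1 : (1 + X) * d⁄dX A (log A) = 1 := by
    rw [deriv_log]
    ext n
    cases n with
    | zero => simp [add_mul]
    | succ n => simp [add_mul, coeff_succ_X_mul, coeff_one, pow_succ]
  have h2 := congrArg (subst (f - 1)) h1
  rw [subst_mul hs, subst_add hs, subst_X hs, ← coe_substAlgHom hs, map_one,
    coe_substAlgHom hs] at h2
  rw [logOf_eq, derivative_subst hs, ← mul_assoc, map_sub, Derivation.map_one_eq_zero, sub_zero]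
  have h3 : f * (d⁄dX A (log A)).subst (f - 1) = 1 := by
    rwa [add_sub_cancel] at h2
  rw [h3, one_mul]

variable {K : Type*} [Field K]

/-- The coefficients of f (log f)' = f' give a recursion for those of log f that respects the
grading. -/
theorem isWeightedHomogeneous_coeff_logOf [CharZero K] {f : PowerSeries (Sym K)}
    (h0 : constantCoeff f = 1)
    (hf : ∀ n, MvPolynomial.IsWeightedHomogeneous psumWeight (coeff n f) (n : ℤ)) (n : ℕ) :
    MvPolynomial.IsWeightedHomogeneous psumWeight (coeff n (logOf f)) (n : ℤ) := by
  induction n using Nat.strong_induction_on with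
  | _ n ih =>
    cases n with
    | zero =>
      rw [coeff_zero_eq_constantCoeff_apply, constantCoeff_logOf h0]
      exact MvPolynomial.isWeightedHomogeneous_zero _ _ _
    | succ m =>
      have h := congrArg (coeff m) (mul_derivative_logOf h0)
      rw [coeff_mul, Finset.Nat.sum_antidiagonal_eq_sum_range_succ_mk, Finset.sum_range_succ',
        coeff_zero_eq_constantCoeff_apply, h0, one_mul, Nat.sub_zero, coeff_derivative,
        coeff_derivative] at h
      have hne : ((m + 1 : ℕ) : K) ≠ 0 := Nat.cast_ne_zero.2 (Nat.succ_ne_zero m)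
      have hC : (MvPolynomial.C (((m + 1 : ℕ) : K)⁻¹) : Sym K) * ((m : Sym K) + 1) = 1 := by
        have : ((m : Sym K) + 1) = MvPolynomial.C ((m + 1 : ℕ) : K) := by
          rw [map_natCast]; push_cast; rfl
        rw [this, ← MvPolynomial.C_mul, inv_mul_cancel₀ hne, MvPolynomial.C_1]
      have h1 : coeff (m + 1) (logOf f) = coeff (m + 1) f -
          MvPolynomial.C (((m + 1 : ℕ) : K)⁻¹) * ∑ k ∈ Finset.range m,
            coeff (k + 1) f * coeff (m - (k + 1)) (d⁄dX (Sym K) (logOf f)) := by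
        linear_combination MvPolynomial.C (((m + 1 : ℕ) : K)⁻¹) * h +
          (coeff (m + 1) f - coeff (m + 1) (logOf f)) * hC
      rw [h1]
      refine (hf _).sub (isWeightedHomogeneous_C_mul _
        (MvPolynomial.IsWeightedHomogeneous.sum _ _ _ fun k hk => ?_))
      rw [Finset.mem_range] at hk
      have e : ((m + 1 : ℕ) : ℤ) = ((k + 1 : ℕ) : ℤ) + ((m - (k + 1) + 1 : ℕ) : ℤ) := by omega
      rw [e]
      refine (hf _).mul ?_
      rw [coeff_derivative]
      have := isWeightedHomogeneous_C_mul ((m - (k + 1) + 1 : ℕ) : K)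
        (ih (m - (k + 1) + 1) (by omega))
      rw [map_natCast] at this
      rw [mul_comm]
      exact_mod_cast this

theorem hookCoeff_mul (f g : Sym K) : hookCoeff (f * g) =
    MvPolynomial.eval (fun _ => 1) f * hookCoeff g +
      hookCoeff f * MvPolynomial.eval (fun _ => 1) g := by
  simp only [hookCoeff_apply, Derivation.leibniz, smul_eq_mul, map_add, map_mul]
  ring

/-- `hookCoeff` applied to the coefficients of a power series. -/
def hookCoeffSeries (f : PowerSeries (Sym K)) : PowerSeries K :=
  PowerSeries.mk fun n => hookCoeff (coeff n f)

/-- All power sums set to `1` in the coefficients of a power series. -/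
def evalOneSeries : PowerSeries (Sym K) →+* PowerSeries K :=
  PowerSeries.map (MvPolynomial.eval fun _ => 1)

theorem hookCoeffSeries_mul (f g : PowerSeries (Sym K)) : hookCoeffSeries (f * g) =
    evalOneSeries f * hookCoeffSeries g + hookCoeffSeries f * evalOneSeries g := by
  ext n
  simp only [hookCoeffSeries, evalOneSeries, map_add, coeff_mul, coeff_mk, map_sum, coeff_map,
    hookCoeff_mul, Finset.sum_add_distrib]

theorem hookCoeffSeries_derivative (f : PowerSeries (Sym K)) :
    hookCoeffSeries (d⁄dX (Sym K) f) = d⁄dX K (hookCoeffSeries f) := by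
  ext n
  simp only [hookCoeffSeries, coeff_mk, coeff_derivative]
  have : coeff (n + 1) f * ((n : Sym K) + 1) = ((n : K) + 1) • coeff (n + 1) f := by
    rw [MvPolynomial.smul_eq_C_mul, map_add, map_natCast, map_one, mul_comm]
  rw [this, map_smul, smul_eq_mul, mul_comm]

theorem evalOneSeries_derivative (f : PowerSeries (Sym K)) :
    evalOneSeries (d⁄dX (Sym K) f) = d⁄dX K (evalOneSeries f) := by
  ext n
  simp [evalOneSeries, coeff_derivative]

/-- `hookCoeff` is a derivation over the evaluation p_k = 1, so formally it sends log f to its value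
on f divided by the evaluation of f. The proof applies both maps to f (log f)' = f' and concludes
that the two candidates have the same T-derivative and no constant term. -/
theorem hookCoeffSeries_logOf [CharZero K] {f : PowerSeries (Sym K)} (h0 : constantCoeff f = 1) :
    evalOneSeries f * hookCoeffSeries (logOf f) = hookCoeffSeries f := by
  have h := mul_derivative_logOf h0
  have h1 := congrArg hookCoeffSeries h
  have h2 := congrArg evalOneSeries h
  rw [hookCoeffSeries_mul, hookCoeffSeries_derivative, hookCoeffSeries_derivative,
    evalOneSeries_derivative] at h1
  rw [map_mul, evalOneSeries_derivative, evalOneSeries_derivative] at h2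
  set A := evalOneSeries f with hA
  set B := hookCoeffSeries f with hB
  set u := evalOneSeries (logOf f) with hu
  set v := hookCoeffSeries (logOf f) with hv
  have hA0 : constantCoeff A = 1 := by
    rw [hA, ← coeff_zero_eq_constantCoeff_apply, evalOneSeries, coeff_map,
      coeff_zero_eq_constantCoeff_apply, h0, map_one]
  have hone : hookCoeff (1 : Sym K) = 0 := by simp [hookCoeff_apply]
  have hB0 : constantCoeff B = 0 := by
    rw [hB, ← coeff_zero_eq_constantCoeff_apply, hookCoeffSeries, coeff_mk,
      coeff_zero_eq_constantCoeff_apply, h0, hone]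
  have hv0 : constantCoeff v = 0 := by
    rw [hv, ← coeff_zero_eq_constantCoeff_apply, hookCoeffSeries, coeff_mk,
      coeff_zero_eq_constantCoeff_apply, constantCoeff_logOf h0, map_zero]
  have hAne : constantCoeff A ≠ 0 := by rw [hA0]; exact one_ne_zero
  have hinv := PowerSeries.mul_inv_cancel A hAne
  have key : v = B * A⁻¹ := by
    refine derivative.ext ?_ (by simp [hv0, hB0])
    rw [Derivation.leibniz, derivative_inv', smul_eq_mul, smul_eq_mul]
    have hne : A ≠ 0 := by rintro h; simp [h] at hAne
    apply mul_left_cancel₀ hne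
    linear_combination h1 - B * A⁻¹ * h2 - (d⁄dX K B - B * A⁻¹ * d⁄dX K A - B * d⁄dX K u) * hinv
  rw [key]
  linear_combination B * hinv

theorem hsym_one [CharZero K] : (hsym 1 : Sym K) = MvPolynomial.X 1 := by
  have h := sum_X_mul_hsym (K := K) 1
  rw [Finset.Nat.sum_antidiagonal_eq_sum_range_succ_mk] at h
  simp [Finset.sum_range_succ, hsym_zero] at h
  rw [← h]
  rfl

theorem hall_hsymPart_hookPartition [CharZero K] (f : Sym K) (n : ℕ) :
    hall f (hsymPart (hookPartition n)) = hall (MvPolynomial.pderiv 1 f) (hsym n) := by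
  have h1 : (hsymPart (hookPartition n) : Sym K) = hsym n * MvPolynomial.X 1 := by
    rw [← hsym_one]
    -- For n = 0 the constructor `ofSums` drops the part 0, and the product formula survives because
    -- h_0 = 1.
    rcases Nat.eq_zero_or_pos n with rfl | hn
    · simp [hsymPart, hookPartition, Nat.Partition.ofSums, hsym_zero,
        Multiset.filter_singleton]
    · simp [hsymPart, hookPartition, Nat.Partition.ofSums,
        Multiset.filter_singleton, hn.ne']
  rw [h1, hall_comm, hall_mul_X, hall_comm]
  simp

theorem hall_hsymPart_hookPartition_eq_hookCoeff [CharZero K] {f : Sym K} {n : ℕ}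
    (hf : MvPolynomial.IsWeightedHomogeneous psumWeight f ((n + 1 : ℕ) : ℤ)) :
    hall f (hsymPart (hookPartition n)) = hookCoeff f := by
  rw [hall_hsymPart_hookPartition, hookCoeff_apply, hall_hsym]
  intro a ha
  rw [MvPolynomial.coeff_pderiv] at ha
  have h := hf (left_ne_zero_of_mul ha)
  rw [weight_psumWeight, wt_add, wt_single] at h
  simp at h
  exact_mod_cast h

end Logarithm

/-! ### Reduction of the plethystic logarithm to a quotient of two series. -/

section PlethysticLog

open PowerSeries

theorem adamsK_one : adamsK 1 = RingHom.id QZW := by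
  refine IsFractionRing.ringHom_ext (A := MvPolynomial (Fin 2) ℚ) fun x => ?_
  rw [adamsK, IsFractionRing.lift_algebraMap]
  simp

theorem adams_one (f : Sym QZW) : adams 1 f = f := by
  rw [adams, adamsK_one]
  simp

/-- The image of ψ_d involves only the p_{dk}, among which p_1 does not occur. -/
theorem pderiv_adams {d : ℕ+} (hd : d ≠ 1) (f : Sym QZW) :
    MvPolynomial.pderiv 1 (adams d f) = 0 := by
  induction f using MvPolynomial.induction_on with
  | C c => simp [adams]
  | add p q hp hq => rw [map_add, map_add, hp, hq, add_zero]
  | mul_X p k ih =>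
    have h1 : d * k ≠ 1 := by
      intro h
      apply hd
      have h2 := congrArg (fun x : ℕ+ => (x : ℕ)) h
      simp only [PNat.mul_coe, PNat.one_coe] at h2
      exact PNat.coe_injective (Nat.eq_one_of_mul_eq_one_right h2)
    rw [map_mul, Derivation.leibniz, ih]
    simp [adams, MvPolynomial.pderiv_X, h1]

/-- Pairing with h_n h_1 passes through ∂/∂p_1, so the terms with d > 1 vanish. -/
theorem hall_plethLog (f : PowerSeries (Sym QZW)) (n : ℕ) :
    hall (coeff (n + 1) (plethLog f)) (hsymPart (hookPartition n)) =
      hall (coeff (n + 1) (logOf f)) (hsymPart (hookPartition n)) := by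
  rw [plethLog, coeff_mk, hall_sum_left, Finset.sum_eq_single 1]
  · rw [hall_C_mul_left]
    have : Nat.toPNat' 1 = 1 := rfl
    rw [this, adams_one]
    simp
  · intro d hd hd1
    have hd0 : 0 < d := Nat.pos_of_mem_divisors hd
    rw [hall_C_mul_left, hall_hsymPart_hookPartition, pderiv_adams]
    · have : hall (0 : Sym QZW) (hsym n) = 0 := by simp [hall, pairing]
      rw [this, mul_zero]
    · intro h
      apply hd1
      have := congrArg (fun x : ℕ+ => (x : ℕ)) h
      simpa [Nat.toPNat'_coe, hd0] using this
  · simp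

theorem isWeightedHomogeneous_coeff_Omega (g n : ℕ) :
    MvPolynomial.IsWeightedHomogeneous psumWeight (coeff n (Omega g)) (n : ℤ) := by
  rw [Omega, coeff_mk]
  exact MvPolynomial.IsWeightedHomogeneous.sum _ _ _ fun l _ =>
    isWeightedHomogeneous_C_mul _ (isWeightedHomogeneous_macH _ _ l)

theorem constantCoeff_Omega (g : ℕ) : constantCoeff (Omega g) = 1 := by
  have hl : (default : Nat.Partition 0).parts = 0 := rfl
  have hlen : len (default : Nat.Partition 0) = 0 := by simp [len]
  have hcells : cells (default : Nat.Partition 0) = ∅ := by simp [cells, hlen]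
  rw [← coeff_zero_eq_constantCoeff_apply, Omega, coeff_mk, Fintype.sum_unique, hookFun, hcells]
  have hsch : (schur (default : Nat.Partition 0) : Sym QZW) = 1 := by
    have : IsEmpty (Fin (len (default : Nat.Partition 0))) := by rw [hlen]; infer_instance
    rw [schur, Matrix.det_isEmpty]
  have hP : ∀ q t : QZW, macP q t (default : Nat.Partition 0) = 1 := by
    intro q t
    have : IsEmpty {m : Nat.Partition 0 // LexLT m default} :=
      ⟨fun m => lt_irrefl (rows (default : Nat.Partition 0)) (by
        have := m.2
        rw [Subsingleton.elim m.1 default] at this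
        exact this)⟩
    rw [macP, hsch]
    simp
  simp [macH, macJ, hP, hcells, nStat, hlen]

theorem bbH_eq (n : ℕ) : bbH 1 (hookPartition n) = (zv ^ 2 - 1) * (1 - wv ^ 2) *
    coeff (n + 1) (hookCoeffSeries (Omega 1) * (evalOneSeries (Omega 1))⁻¹) := by
  have h0 := constantCoeff_Omega 1
  have hA : constantCoeff (evalOneSeries (Omega 1)) ≠ 0 := by
    rw [← coeff_zero_eq_constantCoeff_apply, evalOneSeries, coeff_map,
      coeff_zero_eq_constantCoeff_apply, h0, map_one]
    exact one_ne_zero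
  rw [bbH, hall_plethLog, hall_hsymPart_hookPartition_eq_hookCoeff
    (isWeightedHomogeneous_coeff_logOf h0 (isWeightedHomogeneous_coeff_Omega 1) _),
    ← hookCoeffSeries_logOf h0, mul_comm (evalOneSeries _), mul_assoc (hookCoeffSeries _),
    PowerSeries.mul_inv_cancel _ hA, mul_one, hookCoeffSeries, coeff_mk]

end PlethysticLog
end CharVar
end

noncomputable section
namespace CharVar

/-! ### The content series of partitions as an infinite product. -/

section QSeries

open PowerSeries

/-- The partitions of `n` with all parts at most `M`. -/
def partsLE (M n : ℕ) : Finset n.Partition := Finset.univ.filter fun l => ∀ i ∈ l.parts, i ≤ M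

variable {R : Type*} [CommRing R]

/-- The generating series of a statistic over the partitions with parts at most `M`. -/
def boundedSeries (f : List ℕ → R) (M : ℕ) : PowerSeries R :=
  PowerSeries.mk fun n => ∑ l ∈ partsLE M n, f (rows l)

theorem boundedSeries_zero (f : List ℕ → R) : boundedSeries f 0 = C (f []) := by
  ext n
  rw [boundedSeries, coeff_mk, coeff_C]
  have h0 : ∀ l ∈ partsLE 0 n, l.parts = 0 := by
    intro l hl
    refine Multiset.eq_zero_of_forall_notMem fun i hi => ?_
    have h1 := (Finset.mem_filter.1 hl).2 i hi
    have h2 := l.parts_pos hi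
    omega
  split_ifs with hn
  · subst hn
    rw [Finset.sum_eq_single (default : Nat.Partition 0)]
    · have : rows (default : Nat.Partition 0) = [] := by
        rw [← List.length_eq_zero_iff, length_rows]
        simp [len]
      rw [this]
    · intro l _ hl
      exact absurd (Subsingleton.elim _ _) hl
    · intro h
      exact absurd (Finset.mem_filter.2 ⟨Finset.mem_univ _, by simp⟩) h
  · refine Finset.sum_eq_zero fun l hl => ?_
    have := l.parts_sum
    rw [h0 l hl] at this
    exact absurd this.symm hn

theorem sum_partsLE_succ (f : List ℕ → R) (M m : ℕ) :
    ∑ l ∈ (partsLE (M + 1) (m + (M + 1))).filter (fun l => M + 1 ∈ l.parts), f (rows l) =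
      ∑ l ∈ partsLE (M + 1) m, f ((M + 1) :: rows l) := by
  symm
  refine Finset.sum_bij (fun l _ => ⟨(M + 1) ::ₘ l.parts, ?_, ?_⟩) ?_ ?_ ?_ ?_
  · intro i hi
    rcases Multiset.mem_cons.1 hi with rfl | hi
    · exact Nat.succ_pos M
    · exact l.parts_pos hi
  · rw [Multiset.sum_cons, l.parts_sum, add_comm]
  · intro l hl
    rw [partsLE, Finset.mem_filter] at hl
    rw [Finset.mem_filter, partsLE, Finset.mem_filter]
    refine ⟨⟨Finset.mem_univ _, fun i hi => ?_⟩, Multiset.mem_cons_self _ _⟩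
    rcases Multiset.mem_cons.1 hi with rfl | hi
    · exact le_rfl
    · exact hl.2 i hi
  · intro l _ l' _ h
    have h1 := congrArg Nat.Partition.parts h
    exact Nat.Partition.ext ((Multiset.cons_inj_right _).1 h1)
  · intro l hl
    rw [Finset.mem_filter, partsLE, Finset.mem_filter] at hl
    have hs := Multiset.cons_erase hl.2
    refine ⟨⟨l.parts.erase (M + 1), fun hi => l.parts_pos (Multiset.mem_of_mem_erase hi), ?_⟩,
      ?_, Nat.Partition.ext hs⟩
    · have h1 := congrArg Multiset.sum hs
      rw [Multiset.sum_cons, l.parts_sum] at h1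
      omega
    · rw [partsLE, Finset.mem_filter]
      exact ⟨Finset.mem_univ _, fun i hi => hl.1.2 i (Multiset.mem_of_mem_erase hi)⟩
  · intro l hl
    rw [partsLE, Finset.mem_filter] at hl
    congr 1
    unfold rows
    exact (Multiset.sort_cons _ _ _ hl.2).symm

/-- Either M + 1 is not a part, or it is the first row, and removing that row leaves an arbitrary
partition with parts at most M + 1. -/
theorem boundedSeries_succ (f : List ℕ → R) (M : ℕ) :
    boundedSeries f (M + 1) =
      boundedSeries f M + X ^ (M + 1) * boundedSeries (fun L => f ((M + 1) :: L)) (M + 1) := by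
  ext n
  rw [map_add, coeff_X_pow_mul']
  simp only [boundedSeries, coeff_mk]
  rw [← Finset.sum_filter_add_sum_filter_not (partsLE (M + 1) n) (fun l => M + 1 ∈ l.parts),
    add_comm]
  congr 1
  · refine Finset.sum_congr ?_ fun _ _ => rfl
    ext l
    simp only [partsLE, Finset.mem_filter, Finset.mem_univ, true_and]
    constructor
    · rintro ⟨h1, h2⟩ i hi
      have := h1 i hi
      rcases this.eq_or_lt with rfl | h
      · exact absurd hi h2
      · omega
    · intro h
      refine ⟨fun i hi => (h i hi).trans (Nat.le_succ M), fun h' => ?_⟩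
      have := h _ h'
      omega
  · split_ifs with hn
    · obtain ⟨m, rfl⟩ : ∃ m, n = m + (M + 1) := ⟨n - (M + 1), by omega⟩
      rw [sum_partsLE_succ, Nat.add_sub_cancel]
    · refine Finset.sum_eq_zero fun l hl => ?_
      have h1 := (Finset.mem_filter.1 hl).2
      have h2 := Multiset.single_le_sum (fun _ _ => Nat.zero_le _) _ h1
      rw [l.parts_sum] at h2
      exact absurd h2 hn

/-- A partition of n ≤ M has no part above M. Infinite sums and products are treated through such
congruences modulo powers of T. -/
theorem X_pow_dvd_sub_boundedSeries (f : List ℕ → R) (M : ℕ) :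
    X ^ (M + 1) ∣ (PowerSeries.mk fun n => ∑ l : n.Partition, f (rows l)) - boundedSeries f M := by
  rw [X_pow_dvd_iff]
  intro n hn
  rw [map_sub, boundedSeries, coeff_mk, coeff_mk, sub_eq_zero]
  refine Finset.sum_congr ?_ fun _ _ => rfl
  symm
  refine Finset.filter_true_of_mem fun l _ i hi => ?_
  have h2 := Multiset.single_le_sum (fun _ _ => Nat.zero_le _) _ hi
  rw [l.parts_sum] at h2
  omega

/-- `∑_i q ^ {-i} (q ^ {L_i} - 1)`, with `qi` the inverse of `q`. -/
def rowStat (q qi : R) : List ℕ → R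
  | [] => 0
  | m :: L => (q ^ m - 1) + qi * rowStat q qi L

theorem rowStat_eq_sum (q qi : R) (L : List ℕ) :
    rowStat q qi L = ∑ i ∈ Finset.range L.length, qi ^ i * (q ^ L.getD i 0 - 1) := by
  induction L with
  | nil => simp [rowStat]
  | cons m L ih =>
    rw [rowStat, ih, List.length_cons, Finset.sum_range_succ', add_comm, Finset.mul_sum]
    congr 1
    · refine Finset.sum_congr rfl fun i _ => ?_
      rw [List.getD_cons_succ, pow_succ']
      ring
    · simp

theorem rowStat_rows (q qi : R) {n : ℕ} (l : n.Partition) :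
    rowStat q qi (rows l) = (q - 1) * ∑ s ∈ cells l, q ^ s.2 * qi ^ s.1 := by
  have hsum : ∑ s ∈ cells l, q ^ s.2 * qi ^ s.1 =
      ∑ i ∈ Finset.range (len l), ∑ j ∈ Finset.range (row l i), q ^ j * qi ^ i :=
    cells_eq_sigma (M := Multiplicative R) l (fun s => Multiplicative.ofAdd (q ^ s.2 * qi ^ s.1))
  rw [rowStat_eq_sum, length_rows, hsum, Finset.mul_sum]
  refine Finset.sum_congr rfl fun i _ => ?_
  rw [← Finset.sum_mul, ← mul_assoc, mul_geom_sum, mul_comm]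
  rfl

/-- `∏_{k=1}^N (1 - c T ^ k)`. -/
def qProd (c : R) (N : ℕ) : PowerSeries R := ∏ k ∈ Finset.range N, (1 - C c * X ^ (k + 1))

theorem qProd_succ (c : R) (N : ℕ) : qProd c (N + 1) = qProd c N * (1 - C c * X ^ (N + 1)) :=
  Finset.prod_range_succ _ _

theorem boundedSeries_add (f g : List ℕ → R) (M : ℕ) :
    boundedSeries (fun L => f L + g L) M = boundedSeries f M + boundedSeries g M := by
  ext n
  simp [boundedSeries, Finset.sum_add_distrib]

theorem boundedSeries_const_mul (c : R) (f : List ℕ → R) (M : ℕ) :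
    boundedSeries (fun L => c * f L) M = C c * boundedSeries f M := by
  ext n
  simp [boundedSeries, Finset.mul_sum]

theorem boundedSeries_one_mul (N : ℕ) :
    boundedSeries (fun _ => (1 : R)) N * qProd 1 N = 1 := by
  induction N with
  | zero => simp [boundedSeries_zero, qProd]
  | succ N ih =>
    have h := boundedSeries_succ (fun _ => (1 : R)) N
    rw [qProd_succ]
    linear_combination ih + qProd 1 N * h + (-X ^ (N + 1) *
      boundedSeries (fun _ => (1 : R)) (N + 1) * qProd 1 N) * (map_one (C (R := R)))

variable {q qi : R}

/-- Removing the first row moves the others up by one, which is the factor q⁻¹ in the recursion for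
`rowStat`. -/
theorem boundedSeries_rowStat_succ (M : ℕ) :
    (1 - C qi * X ^ (M + 1)) * boundedSeries (rowStat q qi) (M + 1) =
      boundedSeries (rowStat q qi) M +
        X ^ (M + 1) * C (q ^ (M + 1) - 1) * boundedSeries (fun _ => (1 : R)) (M + 1) := by
  have h := boundedSeries_succ (rowStat q qi) M
  have h1 : boundedSeries (fun L => rowStat q qi ((M + 1) :: L)) (M + 1) =
      C (q ^ (M + 1) - 1) * boundedSeries (fun _ => (1 : R)) (M + 1) +
        C qi * boundedSeries (rowStat q qi) (M + 1) := by
    rw [← boundedSeries_const_mul, ← boundedSeries_const_mul, ← boundedSeries_add]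
    simp only [rowStat, mul_one]
  rw [h1] at h
  linear_combination h

/-- `∏_{i<k} (1 - q⁻¹ T ^ i)`. -/
def shiftedProd (qi : R) (k : ℕ) : PowerSeries R := ∏ i ∈ Finset.range k, (1 - C qi * X ^ i)

theorem shiftedProd_succ (k : ℕ) : shiftedProd qi (k + 1) = (1 - C qi) * qProd qi k := by
  rw [shiftedProd, Finset.prod_range_succ', mul_comm, pow_zero, mul_one]
  rfl

/-- The truncated `q`-binomial sum at `q T ^ j`. -/
def binomSum (q qi : R) (N j : ℕ) : PowerSeries R := ∑ k ∈ Finset.range (N + 1),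
  shiftedProd qi k * boundedSeries (fun _ => (1 : R)) k * (C q * X ^ j) ^ k

/-- Passing from N to N + 1 adds exactly one term of the q-binomial series ∑ (q⁻¹; T)_k / (T; T)_k
(qT)^k. -/
theorem qProd_mul_boundedSeries (hq : q * qi = 1) (N : ℕ) :
    qProd qi N * (boundedSeries (fun _ => (1 : R)) N +
      C (1 - qi) * boundedSeries (rowStat q qi) N) = binomSum q qi N 1 := by
  have hqC : C q * C qi = (1 : PowerSeries R) := by rw [← map_mul, hq, map_one]
  induction N with
  | zero => simp [binomSum, qProd, boundedSeries_zero, rowStat, shiftedProd]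
  | succ N ih =>
    have h1 := boundedSeries_succ (fun _ => (1 : R)) N
    have h2 := boundedSeries_rowStat_succ (q := q) (qi := qi) N
    rw [binomSum, Finset.sum_range_succ, ← binomSum, ← ih, qProd_succ, shiftedProd_succ]
    simp only [map_sub, map_one, map_pow] at h2 ⊢
    rw [mul_pow, pow_one]
    linear_combination qProd qi N * (1 - C qi) * h2 + qProd qi N * h1

/-- The q-binomial series F satisfies (1 - x) F(x) = (1 - a x) F(T x). Here a = q⁻¹ and x = q T^j,
and the right-hand side is the truncation error. -/
theorem binomSum_shift (hq : q * qi = 1) (N j : ℕ) :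
    (1 - C q * X ^ j) * binomSum q qi N j - (1 - X ^ j) * binomSum q qi N (j + 1) =
      -(shiftedProd qi (N + 1) * boundedSeries (fun _ => (1 : R)) N * (C q * X ^ j) ^ (N + 1)) := by
  have hqC : C q * C qi = (1 : PowerSeries R) := by rw [← map_mul, hq, map_one]
  induction N with
  | zero =>
    simp [binomSum, shiftedProd, boundedSeries_zero]
    linear_combination -X ^ j * hqC
  | succ N ih =>
    have h1 := boundedSeries_succ (fun _ => (1 : R)) N
    have e : ∀ j, binomSum q qi (N + 1) j = binomSum q qi N j + shiftedProd qi (N + 1) *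
        boundedSeries (fun _ => (1 : R)) (N + 1) * (C q * X ^ j) ^ (N + 1) := fun j => by
      rw [binomSum, Finset.sum_range_succ, ← binomSum]
    have e2 : shiftedProd qi (N + 1 + 1) = shiftedProd qi (N + 1) * (1 - C qi * X ^ (N + 1)) :=
      Finset.prod_range_succ _ _
    have e3 : (C q * X ^ (j + 1)) ^ (N + 1) =
        (C q * X ^ j) ^ (N + 1) * (X : PowerSeries R) ^ (N + 1) := by
      rw [pow_succ X j, ← mul_assoc, mul_pow]
    rw [e, e, e2, e3, pow_succ (C q * X ^ j) (N + 1)]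
    generalize hY : (C q * X ^ j) ^ (N + 1) = Y at *
    linear_combination ih + (shiftedProd qi (N + 1) * Y) * h1 -
      (shiftedProd qi (N + 1) * Y * boundedSeries (fun _ => (1 : R)) (N + 1) * X ^ j *
        X ^ (N + 1)) * hqC

/-- Iteration of `binomSum_shift` from j = 1; as j ≥ 1, every truncation error is divisible by
T^(N+1). At j = N + 1 only the term 1 of the sum survives modulo T^(N+1), so taking J = N gives the
truncated q-binomial theorem. -/
theorem X_pow_dvd_qProd_mul_binomSum (hq : q * qi = 1) (N J : ℕ) :
    X ^ (N + 1) ∣ qProd q J * binomSum q qi N 1 - qProd 1 J * binomSum q qi N (J + 1) := by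
  induction J with
  | zero => simp [qProd]
  | succ J ih =>
    have h := binomSum_shift hq N (J + 1)
    have hd : X ^ (N + 1) ∣ (C q * X ^ (J + 1)) ^ (N + 1) := by
      rw [mul_pow, ← pow_mul]
      exact dvd_mul_of_dvd_right (pow_dvd_pow X (by nlinarith)) _
    obtain ⟨u, hu⟩ := ih
    obtain ⟨v, hv⟩ := hd
    rw [qProd_succ, qProd_succ, map_one]
    refine ⟨u * (1 - C q * X ^ (J + 1)) - qProd 1 J *
      (shiftedProd qi (N + 1) * boundedSeries (fun _ => (1 : R)) N * v), ?_⟩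
    rw [hv] at h
    linear_combination (1 - C q * X ^ (J + 1)) * hu + qProd 1 J * h

theorem X_pow_dvd_binomSum_sub_one (N : ℕ) : X ^ (N + 1) ∣ binomSum q qi N (N + 1) - 1 := by
  rw [binomSum, Finset.sum_range_succ']
  have : shiftedProd qi 0 * boundedSeries (fun _ => (1 : R)) 0 * (C q * X ^ (N + 1)) ^ 0 = 1 := by
    simp [shiftedProd, boundedSeries_zero]
  rw [this, add_sub_cancel_right]
  refine Finset.dvd_sum fun k _ => dvd_mul_of_dvd_right ?_ _
  rw [mul_pow, ← pow_mul]
  exact dvd_mul_of_dvd_right (pow_dvd_pow X (by nlinarith)) _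

/-- `∑_λ T ^ |λ|`. -/
def partitionSeries (R : Type*) [CommRing R] : PowerSeries R :=
  PowerSeries.mk fun n => ∑ _l : n.Partition, 1

/-- `∑_λ (∑_{(i, j) ∈ λ} q ^ (j - i)) T ^ |λ|`. -/
def contentSeries (q qi : R) : PowerSeries R :=
  PowerSeries.mk fun n => ∑ l : n.Partition, ∑ s ∈ cells l, q ^ s.2 * qi ^ s.1

theorem X_pow_dvd_partitionSeries_mul (N : ℕ) :
    X ^ (N + 1) ∣ partitionSeries R * qProd 1 N - 1 := by
  obtain ⟨u, hu⟩ := X_pow_dvd_sub_boundedSeries (fun _ => (1 : R)) N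
  refine ⟨u * qProd 1 N, ?_⟩
  have h := boundedSeries_one_mul (R := R) N
  change partitionSeries R - _ = _ at hu
  linear_combination qProd 1 N * hu + h

/-- The one-point function of the contents of partitions, truncated. -/
theorem X_pow_dvd_contentSeries (hq : q * qi = 1) (N : ℕ) :
    X ^ (N + 1) ∣ qProd q N * qProd qi N *
      (partitionSeries R + C ((q - 1) * (1 - qi)) * contentSeries q qi) - qProd 1 N := by
  set F := fun L => (1 : R) + (1 - qi) * rowStat q qi L with hF
  have e1 : partitionSeries R + C ((q - 1) * (1 - qi)) * contentSeries q qi =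
      PowerSeries.mk fun n => ∑ l : n.Partition, F (rows l) := by
    ext n
    simp only [partitionSeries, contentSeries, map_add, coeff_mk, coeff_C_mul, hF, rowStat_rows,
      Finset.mul_sum, ← Finset.sum_add_distrib]
    refine Finset.sum_congr rfl fun l _ => ?_
    congr 1
    refine Finset.sum_congr rfl fun s _ => ?_
    ring
  have e2 : boundedSeries F N = boundedSeries (fun _ => (1 : R)) N +
      C (1 - qi) * boundedSeries (rowStat q qi) N := by
    rw [← boundedSeries_const_mul, ← boundedSeries_add]
  rw [e1]
  obtain ⟨u, hu⟩ := X_pow_dvd_sub_boundedSeries F N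
  obtain ⟨v, hv⟩ := X_pow_dvd_qProd_mul_binomSum hq N N
  obtain ⟨w, hw⟩ := X_pow_dvd_binomSum_sub_one (q := q) (qi := qi) N
  have h := qProd_mul_boundedSeries hq N
  rw [← e2] at h
  refine ⟨qProd q N * qProd qi N * u + v + qProd 1 N * w, ?_⟩
  linear_combination qProd q N * qProd qi N * hu + qProd q N * h + hv + qProd 1 N * hw

/-- Since `partitionSeries` is inverse to ∏ (1 - T^k), dividing the content identity by it produces
the second factor ∏ (1 - T^k). -/
theorem X_pow_dvd_quotient (hq : q * qi = 1) {H : PowerSeries R}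
    (hH : partitionSeries R * H =
      partitionSeries R + C ((q - 1) * (1 - qi)) * contentSeries q qi) (N : ℕ) :
    X ^ (N + 1) ∣ qProd q N * qProd qi N * H - qProd 1 N ^ 2 := by
  obtain ⟨u, hu⟩ := X_pow_dvd_contentSeries hq N
  obtain ⟨v, hv⟩ := X_pow_dvd_partitionSeries_mul (R := R) N
  rw [← hH] at hu
  refine ⟨qProd 1 N * u - qProd q N * qProd qi N * H * v, ?_⟩
  linear_combination qProd 1 N * hu - qProd q N * qProd qi N * H * hv

end QSeries
end CharVar
end

noncomputable section
namespace CharVar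

/-! ### Logarithmic derivative in u of the product. -/

section CoefficientDerivative

open PowerSeries

/-- The derivative `∂ / ∂ u` of a power series in `T` over `ℚ[[u]]`. -/
def derivU (f : PowerSeries (PowerSeries ℚ)) : PowerSeries (PowerSeries ℚ) :=
  PowerSeries.mk fun n => d⁄dX ℚ (coeff n f)

theorem coeff_derivU (f : PowerSeries (PowerSeries ℚ)) (n : ℕ) :
    coeff n (derivU f) = d⁄dX ℚ (coeff n f) := coeff_mk _ _

theorem derivU_sub (f g : PowerSeries (PowerSeries ℚ)) :
    derivU (f - g) = derivU f - derivU g := by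
  ext1 n
  simp [coeff_derivU]

theorem derivU_mul (f g : PowerSeries (PowerSeries ℚ)) :
    derivU (f * g) = derivU f * g + f * derivU g := by
  ext1 n
  simp only [coeff_derivU, coeff_mul, map_add, map_sum, Derivation.leibniz, smul_eq_mul,
    ← Finset.sum_add_distrib]
  refine Finset.sum_congr rfl fun p _ => ?_
  ring

theorem derivU_C (c : PowerSeries ℚ) : derivU (C c) = C (d⁄dX ℚ c) := by
  ext1 n
  rw [coeff_derivU, coeff_C, coeff_C]
  split_ifs <;> simp

theorem derivU_X_pow (k : ℕ) : derivU (X ^ k) = 0 := by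
  ext1 n
  rw [coeff_derivU, coeff_X_pow]
  split_ifs <;> simp

theorem derivU_one : derivU 1 = 0 := by simpa using derivU_X_pow 0

theorem X_pow_dvd_derivU {f : PowerSeries (PowerSeries ℚ)} {N : ℕ} (h : X ^ N ∣ f) :
    X ^ N ∣ derivU f := by
  obtain ⟨g, rfl⟩ := h
  exact ⟨derivU g, by rw [derivU_mul, derivU_X_pow, zero_mul, zero_add]⟩

/-- The equation `∂ f / ∂ u = g f`, with `g(T = 0) = 0`, determines `f` from `f(u = 0)`. -/
theorem eq_of_derivU_eq {g f f' : PowerSeries (PowerSeries ℚ)} (hg : constantCoeff g = 0)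
    (hf : derivU f = g * f) (hf' : derivU f' = g * f')
    (h0 : ∀ n, constantCoeff (coeff n f) = constantCoeff (coeff n f')) : f = f' := by
  ext1 n
  induction n using Nat.strong_induction_on with
  | _ n ih =>
    refine derivative.ext ?_ (h0 n)
    rw [← coeff_derivU, ← coeff_derivU, hf, hf', coeff_mul, coeff_mul]
    refine Finset.sum_congr rfl fun p hp => ?_
    rw [Finset.HasAntidiagonal.mem_antidiagonal] at hp
    -- As g has no term of degree 0 in T, only lower coefficients of f enter the derivative of the
    -- n-th one.
    rcases Nat.eq_zero_or_pos p.1 with h | h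
    · rw [h, coeff_zero_eq_constantCoeff_apply, hg, zero_mul, zero_mul]
    · rw [ih p.2 (by omega)]

/-- `∑_{k ≥ 1} c T ^ k / (1 - c T ^ k)`. -/
def lambert (c : PowerSeries ℚ) : PowerSeries (PowerSeries ℚ) :=
  PowerSeries.mk fun n => ∑ d ∈ n.divisors, c ^ d

/-- `c T ^ k / (1 - c T ^ k)`. -/
def geomTail (c : PowerSeries ℚ) (k : ℕ) : PowerSeries (PowerSeries ℚ) :=
  PowerSeries.mk fun n => if k ∣ n ∧ n ≠ 0 then c ^ (n / k) else 0

theorem one_sub_mul_geomTail (c : PowerSeries ℚ) {k : ℕ} (hk : 0 < k) :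
    (1 - C c * X ^ k) * geomTail c k = C c * X ^ k := by
  ext1 n
  rw [sub_mul, one_mul, map_sub, mul_assoc, coeff_C_mul, coeff_X_pow_mul', coeff_C_mul,
    coeff_X_pow]
  simp only [geomTail, coeff_mk]
  by_cases hn : k ≤ n
  · obtain ⟨m, rfl⟩ : ∃ m, n = m + k := ⟨n - k, by omega⟩
    rw [if_pos hn, Nat.add_sub_cancel]
    by_cases hm : m = 0
    · subst hm
      simp [hk.ne', Nat.div_self hk]
    · by_cases hd : k ∣ m
      · rw [if_pos ⟨(Nat.dvd_add_right hd).2 dvd_rfl, by omega⟩, if_pos ⟨hd, hm⟩,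
          Nat.add_div_right _ hk, pow_succ', sub_self, if_neg (by omega), mul_zero]
      · rw [if_neg (fun h => hd ((Nat.dvd_add_left dvd_rfl).1 h.1)), if_neg (fun h => hd h.1),
          if_neg (by omega)]
        simp
  · have h : ¬ (k ∣ n ∧ n ≠ 0) := fun h => hn (Nat.le_of_dvd (Nat.pos_of_ne_zero h.2) h.1)
    rw [if_neg hn, if_neg h, if_neg (by omega)]
    simp

/-- Complementary divisors d and k = n/d are exchanged; for 0 < n ≤ N every divisor k of n is at
most N. -/
theorem X_pow_dvd_lambert_sub (c : PowerSeries ℚ) (N : ℕ) :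
    X ^ (N + 1) ∣ lambert c - ∑ k ∈ Finset.range N, geomTail c (k + 1) := by
  rw [X_pow_dvd_iff]
  intro n hn
  rw [map_sub, map_sum, sub_eq_zero]
  simp only [lambert, geomTail, coeff_mk]
  rcases Nat.eq_zero_or_pos n with rfl | hn0
  · simp
  · rw [← Nat.sum_div_divisors, ← Finset.sum_filter]
    refine Finset.sum_bij (fun d _ => d - 1) ?_ ?_ ?_ ?_
    · intro d hd
      have h1 := Nat.pos_of_mem_divisors hd
      have h2 := Nat.divisor_le hd
      rw [Finset.mem_filter, Finset.mem_range, Nat.sub_add_cancel h1]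
      exact ⟨by omega, Nat.dvd_of_mem_divisors hd, hn0.ne'⟩
    · intro d hd d' hd' h
      have h1 := Nat.pos_of_mem_divisors hd
      have h2 := Nat.pos_of_mem_divisors hd'
      omega
    · intro k hk
      rw [Finset.mem_filter] at hk
      exact ⟨k + 1, Nat.mem_divisors.2 hk.2, by simp⟩
    · intro d hd
      rw [Nat.sub_add_cancel (Nat.pos_of_mem_divisors hd)]

/-- Each factor 1 - c T^k has logarithmic derivative -m c T^k / (1 - c T^k), because c' = m c. -/
theorem X_pow_dvd_derivU_qProd {c : PowerSeries ℚ} {m : ℚ} (hc : d⁄dX ℚ c = C m * c) (N : ℕ) :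
    X ^ (N + 1) ∣ derivU (qProd c N) + C (C m) * (qProd c N * lambert c) := by
  have key : ∀ N, derivU (qProd c N) =
      -C (C m) * (qProd c N * ∑ k ∈ Finset.range N, geomTail c (k + 1)) := by
    intro N
    induction N with
    | zero => simp [qProd, derivU_one]
    | succ N ih =>
      have h := one_sub_mul_geomTail c (Nat.succ_pos N)
      rw [qProd_succ, derivU_mul, ih, derivU_sub, derivU_one, derivU_mul, derivU_C, derivU_X_pow,
        hc, Finset.sum_range_succ, map_mul]
      rw [Nat.succ_eq_add_one] at h
      linear_combination C (C m) * qProd c N * h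
  obtain ⟨u, hu⟩ := X_pow_dvd_lambert_sub c N
  refine ⟨C (C m) * qProd c N * u, ?_⟩
  rw [key]
  linear_combination C (C m) * qProd c N * hu

theorem derivU_qProd_one (N : ℕ) : derivU (qProd 1 N) = 0 := by
  induction N with
  | zero => simp [qProd, derivU_one]
  | succ N ih =>
    rw [qProd_succ, derivU_mul, ih, derivU_sub, derivU_one, derivU_mul, derivU_C, derivU_X_pow]
    simp

theorem isUnit_qProd {R : Type*} [CommRing R] (c : R) (N : ℕ) : IsUnit (qProd c N) := by
  rw [PowerSeries.isUnit_iff_constantCoeff, qProd, map_prod]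
  simp

theorem eq_zero_of_forall_X_pow_dvd {R : Type*} [CommRing R] {f : PowerSeries R}
    (h : ∀ N, X ^ (N + 1) ∣ f) : f = 0 := by
  ext n
  exact X_pow_dvd_iff.1 (h n) n (Nat.lt_succ_self n)

variable {q qi : PowerSeries ℚ} {H : PowerSeries (PowerSeries ℚ)}

/-- The product ∏ (1 - T^k)² does not depend on u, so only the two denominators contribute; they are
units and can be cancelled from the congruence. -/
theorem derivU_eq_of_quotient (hq : q * qi = 1) (h1 : d⁄dX ℚ q = q) (h2 : d⁄dX ℚ qi = -qi)
    (hH : partitionSeries (PowerSeries ℚ) * H =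
      partitionSeries (PowerSeries ℚ) + C ((q - 1) * (1 - qi)) * contentSeries q qi) :
    derivU H = (lambert q - lambert qi) * H := by
  rw [← sub_eq_zero]
  refine eq_zero_of_forall_X_pow_dvd fun N => ?_
  obtain ⟨u, hu⟩ := X_pow_dvd_derivU (X_pow_dvd_quotient hq hH N)
  obtain ⟨v, hv⟩ := X_pow_dvd_derivU_qProd (c := q) (m := 1) (by simp [h1]) N
  obtain ⟨w, hw⟩ := X_pow_dvd_derivU_qProd (c := qi) (m := -1) (by simp [h2]) N
  rw [derivU_sub, derivU_mul, derivU_mul, pow_two, derivU_mul, derivU_qProd_one] at hu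
  have hcancel : X ^ (N + 1) ∣ (qProd q N * qProd qi N) *
      (derivU H - (lambert q - lambert qi) * H) := by
    refine ⟨u - v * qProd qi N * H - qProd q N * w * H, ?_⟩
    simp only [map_one, map_neg] at hv hw
    linear_combination hu - qProd qi N * H * hv - qProd q N * H * hw
  exact ((isUnit_qProd q N).mul (isUnit_qProd qi N)).dvd_mul_left.1 hcancel

/-- At u = 0 both q and q⁻¹ are 1, and the product formula collapses to H = 1. -/
theorem constantCoeff_of_quotient (hq : q * qi = 1) (h1 : constantCoeff q = 1)
    (hH : partitionSeries (PowerSeries ℚ) * H =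
      partitionSeries (PowerSeries ℚ) + C ((q - 1) * (1 - qi)) * contentSeries q qi) (n : ℕ) :
    constantCoeff (coeff n H) = if n = 0 then 1 else 0 := by
  have h2 : constantCoeff qi = 1 := by
    have := congrArg constantCoeff hq
    rwa [map_mul, h1, one_mul, map_one] at this
  have hmap : ∀ (c : PowerSeries ℚ) (N : ℕ), constantCoeff c = 1 →
      PowerSeries.map constantCoeff (qProd c N) = qProd (1 : ℚ) N := by
    intro c N hc
    rw [qProd, map_prod, qProd]
    refine Finset.prod_congr rfl fun k _ => ?_
    simp [hc]
  have key : PowerSeries.map constantCoeff H = 1 := by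
    rw [← sub_eq_zero]
    refine eq_zero_of_forall_X_pow_dvd fun N => ?_
    have h3 := map_dvd (PowerSeries.map (constantCoeff (R := ℚ))) (X_pow_dvd_quotient hq hH N)
    rw [map_pow, map_X, map_sub, map_mul, map_mul, map_pow, hmap q N h1, hmap qi N h2,
      hmap 1 N (map_one _)] at h3
    refine ((isUnit_qProd (1 : ℚ) N).pow 2).dvd_mul_left.1 ?_
    convert h3 using 1
    ring
  rw [← coeff_map, key, coeff_one]

end CoefficientDerivative

/-! ### The Eisenstein exponent and the factor (e^(u/2) - e^(-u/2))/u. -/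

section Eisenstein

open PowerSeries

/-- Exchanging the two variables of an iterated power series. -/
def swapVars : PowerSeries (PowerSeries ℚ) →+* PowerSeries (PowerSeries ℚ) where
  toFun f := PowerSeries.mk fun n => PowerSeries.mk fun m => coeff n (coeff m f)
  map_one' := by
    ext n m
    simp only [coeff_mk, coeff_one]
    split_ifs <;> simp_all [coeff_one]
  map_zero' := by ext n m; simp
  map_add' f g := by ext n m; simp
  map_mul' f g := by
    ext n m
    simp only [coeff_mk, coeff_mul, map_sum]
    rw [Finset.sum_comm]

theorem coeff_coeff_swapVars (f : PowerSeries (PowerSeries ℚ)) (n m : ℕ) :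
    coeff m (coeff n (swapVars f)) = coeff n (coeff m f) := by
  simp [swapVars]

theorem derivU_swapVars (f : PowerSeries (PowerSeries ℚ)) :
    derivU (swapVars f) = swapVars (d⁄dX (PowerSeries ℚ) f) := by
  ext n m
  rw [coeff_derivU, coeff_coeff_swapVars, coeff_derivative, coeff_derivative, coeff_coeff_swapVars,
    ← Nat.cast_succ, ← Nat.cast_succ, ← nsmul_eq_mul', ← nsmul_eq_mul', map_nsmul]

theorem swapVars_map_C (s : PowerSeries ℚ) : swapVars (PowerSeries.map C s) = C s := by
  ext n m
  rw [coeff_coeff_swapVars, coeff_map, coeff_C, coeff_C]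
  split_ifs <;> simp

theorem constantCoeff_eisExponent : constantCoeff eisExponent = 0 := by
  simp [eisExponent]

theorem hasSubst_eisExponent : HasSubst eisExponent :=
  HasSubst.of_constantCoeff_zero' constantCoeff_eisExponent

theorem derivative_expOf_eisExponent :
    d⁄dX (PowerSeries ℚ) (expOf eisExponent) =
      d⁄dX (PowerSeries ℚ) eisExponent * expOf eisExponent := by
  rw [expOf, derivative_subst hasSubst_eisExponent, derivative_exp, mul_comm]

theorem constantCoeff_expOf_eisExponent : constantCoeff (expOf eisExponent) = 1 := by
  rw [expOf, eq_X_mul_shift_add_const (exp (PowerSeries ℚ)), subst_add hasSubst_eisExponent,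
    subst_mul hasSubst_eisExponent, subst_X hasSubst_eisExponent, map_add, map_mul,
    constantCoeff_eisExponent, zero_mul, zero_add, constantCoeff_exp, map_one,
    ← coe_substAlgHom hasSubst_eisExponent, map_one]
  exact map_one _

/-- `e ^ u`. -/
abbrev expQ : PowerSeries ℚ := PowerSeries.exp ℚ

/-- `e ^ (-u)`. -/
def expNegQ : PowerSeries ℚ := rescale (-1) (PowerSeries.exp ℚ)

theorem derivative_rescale_exp (c : ℚ) :
    d⁄dX ℚ (rescale c (exp ℚ)) = C c * rescale c (exp ℚ) := by
  ext n
  rw [coeff_derivative, coeff_rescale, coeff_C_mul, coeff_rescale, coeff_exp, coeff_exp]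
  simp only [Algebra.algebraMap_self, RingHom.id_apply, Nat.factorial_succ]
  push_cast
  have : (n : ℚ) + 1 ≠ 0 := by positivity
  have h' : ((n.factorial : ℕ) : ℚ) ≠ 0 := by positivity
  field_simp
  ring

theorem rescale_exp_mul (a b : ℚ) :
    rescale a (exp ℚ) * rescale b (exp ℚ) = rescale (a + b) (exp ℚ) :=
  exp_mul_exp_eq_exp_add a b

/-- The part of the logarithmic derivative of the right-hand side constant in `T`. -/
def bernoulliPart : PowerSeries ℚ :=
  PowerSeries.mk fun m => coeff 0 (coeff m (d⁄dX (PowerSeries ℚ) eisExponent))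

theorem coeff_derivative_eisExponent (m : ℕ) :
    coeff m (d⁄dX (PowerSeries ℚ) eisExponent) =
      if Odd m then (2 * (m.factorial : ℚ)⁻¹) • eisG (m + 1) else 0 := by
  rw [coeff_derivative, eisExponent, two_mul, map_add, coeff_mk]
  by_cases hm : Odd m
  · have h1 : 2 ≤ m + 1 := by have := hm.pos; omega
    rw [if_pos ⟨h1, hm.add_one⟩, if_pos hm, ← Nat.cast_succ, ← nsmul_eq_mul', ← two_nsmul]
    ext n
    rw [map_nsmul, map_nsmul, map_smul, map_smul]
    simp only [smul_eq_mul, nsmul_eq_mul, Nat.factorial_succ]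
    push_cast
    have h2 : (m : ℚ) + 1 ≠ 0 := by positivity
    have h3 : ((m.factorial : ℕ) : ℚ) ≠ 0 := by positivity
    field_simp
  · rw [if_neg hm, if_neg]
    · simp
    · rintro ⟨-, h⟩
      apply hm
      rw [Nat.even_add_one, Nat.not_even_iff_odd] at h
      exact h

/-- The coefficient of u^m in e^(du) - e^(-du) is 2 d^m / m! for odd m and 0 for even m. What
remains is the part constant in T. -/
theorem swapVars_derivative_eisExponent :
    swapVars (d⁄dX (PowerSeries ℚ) eisExponent) =
      lambert expQ - lambert expNegQ + C bernoulliPart := by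
  ext n m
  rw [coeff_coeff_swapVars, map_add, map_sub, map_add, map_sub, coeff_C]
  rcases Nat.eq_zero_or_pos n with rfl | hn
  · simp [lambert, bernoulliPart]
  · have e1 : ∀ d : ℕ, coeff m (expQ ^ d) = (d : ℚ) ^ m * (m.factorial : ℚ)⁻¹ := by
      intro d
      rw [exp_pow_eq_rescale_exp, coeff_rescale, coeff_exp]
      simp
    have e2 : ∀ d : ℕ, coeff m (expNegQ ^ d) =
        (-1) ^ m * ((d : ℚ) ^ m * (m.factorial : ℚ)⁻¹) := by
      intro d
      rw [expNegQ, ← map_pow, coeff_rescale, ← e1]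
    rw [if_neg hn.ne', coeff_derivative_eisExponent, lambert, lambert, coeff_mk, coeff_mk, map_sum,
      map_sum, map_zero, add_zero, ← Finset.sum_sub_distrib]
    simp only [e1, e2]
    by_cases hm : Odd m
    · rw [if_pos hm, map_smul, eisG, coeff_mk, if_neg hn.ne', smul_eq_mul, Finset.mul_sum,
        hm.neg_one_pow, Nat.add_sub_cancel]
      exact Finset.sum_congr rfl fun d _ => by ring
    · rw [if_neg hm, map_zero, (Nat.not_odd_iff_even.1 hm).neg_one_pow]
      exact (Finset.sum_eq_zero fun d _ => by ring).symm

/-- This is u/(e^u - 1) with the terms for B_0 and B_1 removed; the other Bernoulli numbers of odd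
index vanish. -/
theorem X_mul_bernoulliPart :
    X * bernoulliPart = -(bernoulliPowerSeries ℚ - 1 + C (1 / 2) * X) := by
  ext k
  cases k with
  | zero =>
    rw [map_neg, map_add, map_sub, bernoulliPowerSeries, coeff_mk]
    simp
  | succ m =>
    rw [coeff_succ_X_mul, bernoulliPart, coeff_mk, coeff_derivative_eisExponent, map_neg, map_add,
      map_sub, coeff_succ_mul_X, coeff_C, coeff_one, if_neg (Nat.succ_ne_zero m),
      bernoulliPowerSeries, coeff_mk]
    simp only [Algebra.algebraMap_self, RingHom.id_apply]
    rcases Nat.eq_zero_or_pos m with rfl | hm0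
    · simp
      norm_num
    · rw [if_neg hm0.ne']
      by_cases hm : Odd m
      · rw [if_pos hm, map_smul, eisG, coeff_mk, if_pos rfl, smul_eq_mul, Nat.factorial_succ]
        push_cast
        have h2 : (m : ℚ) + 1 ≠ 0 := by positivity
        have h3 : ((m.factorial : ℕ) : ℚ) ≠ 0 := by positivity
        field_simp
        ring
      · rw [if_neg hm, bernoulli_eq_zero_of_odd (Nat.not_odd_iff_even.1 hm).add_one (by omega)]
        simp

/-- `(e ^ (u / 2) - e ^ (- u / 2)) / u`. -/
def sinhQuot : PowerSeries ℚ :=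
  PowerSeries.mk fun m => coeff (m + 1) (rescale (1 / 2) (exp ℚ) - rescale (-1 / 2) (exp ℚ))

theorem X_mul_sinhQuot :
    X * sinhQuot = rescale (1 / 2 : ℚ) (exp ℚ) - rescale (-1 / 2 : ℚ) (exp ℚ) := by
  ext m
  cases m with
  | zero =>
    rw [map_sub, coeff_rescale, coeff_rescale]
    simp
  | succ m => rw [coeff_succ_X_mul, sinhQuot, coeff_mk]

/-- The logarithmic derivative is (1/2) coth(u/2) - 1/u = 1/(e^u - 1) + 1/2 - 1/u. It is what
cancels the constant terms of the Eisenstein series. -/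
theorem derivative_sinhQuot : d⁄dX ℚ sinhQuot = -bernoulliPart * sinhQuot := by
  have hs := X_mul_sinhQuot
  have hb := X_mul_bernoulliPart
  have hB := bernoulliPowerSeries_mul_exp_sub_one ℚ
  have hd := congrArg (d⁄dX ℚ) hs
  rw [Derivation.leibniz, derivative_X, map_sub, derivative_rescale_exp, derivative_rescale_exp,
    smul_eq_mul, smul_eq_mul, mul_one] at hd
  have h1 : rescale (1 / 2 : ℚ) (exp ℚ) * rescale (-1 / 2 : ℚ) (exp ℚ) = 1 := by
    rw [rescale_exp_mul]
    norm_num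
  have h2 : rescale (1 / 2 : ℚ) (exp ℚ) * rescale (1 / 2 : ℚ) (exp ℚ) = exp ℚ := by
    rw [rescale_exp_mul]
    norm_num
  have hC : (C (-1 / 2 : ℚ) : PowerSeries ℚ) = -C (1 / 2 : ℚ) := by
    rw [← map_neg]
    norm_num
  have hC2 : (C (1 / 2 : ℚ) : PowerSeries ℚ) + C (1 / 2 : ℚ) = 1 := by
    rw [← map_add]
    norm_num
  rw [hC] at hd
  rw [← h2] at hB
  set e := rescale (1 / 2 : ℚ) (exp ℚ)
  set e' := rescale (-1 / 2 : ℚ) (exp ℚ)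
  -- One factor u clears the denominator of `sinhQuot`, the other that of its logarithmic
  -- derivative.
  apply mul_left_cancel₀ (X_ne_zero (R := ℚ))
  apply mul_left_cancel₀ (X_ne_zero (R := ℚ))
  linear_combination X * hd - bernoulliPowerSeries ℚ * hs - C (1 / 2 : ℚ) * X * hs +
    (X * sinhQuot) * hb + X * e' * hC2 - e' * hB + bernoulliPowerSeries ℚ * e * h1

/-- Both sides solve the equation of `eq_of_derivU_eq`: on the right, `bernoulliPart` occurs once
with each sign and drops out. -/
theorem eq_sinhQuot_mul_swapVars {H : PowerSeries (PowerSeries ℚ)}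
    (hH : partitionSeries (PowerSeries ℚ) * H = partitionSeries (PowerSeries ℚ) +
      C ((expQ - 1) * (1 - expNegQ)) * contentSeries expQ expNegQ) :
    H = C sinhQuot * swapVars (expOf eisExponent) := by
  have hone : rescale (1 : ℚ) (exp ℚ) = expQ := by simp
  have hq : expQ * expNegQ = 1 := by
    have := rescale_exp_mul 1 (-1)
    rw [hone] at this
    rw [expNegQ, this]
    norm_num
  have h1 : d⁄dX ℚ expQ = expQ := derivative_exp ℚ
  have h2 : d⁄dX ℚ expNegQ = -expNegQ := by
    rw [expNegQ, derivative_rescale_exp]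
    simp
  refine eq_of_derivU_eq (g := lambert expQ - lambert expNegQ) ?_
    (derivU_eq_of_quotient hq h1 h2 hH) ?_ fun n => ?_
  · rw [← coeff_zero_eq_constantCoeff_apply]
    simp [lambert]
  · rw [derivU_mul, derivU_C, derivative_sinhQuot, derivU_swapVars, derivative_expOf_eisExponent,
      swapVars.map_mul, swapVars_derivative_eisExponent, C.map_mul, map_neg]
    ring
  · rw [constantCoeff_of_quotient hq (constantCoeff_exp) hH, coeff_C_mul, map_mul,
      ← coeff_zero_eq_constantCoeff_apply (coeff n (swapVars _)), coeff_coeff_swapVars,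
      coeff_zero_eq_constantCoeff_apply, constantCoeff_expOf_eisExponent, coeff_one]
    have : constantCoeff sinhQuot = 1 := by
      rw [← coeff_zero_eq_constantCoeff_apply, sinhQuot, coeff_mk, map_sub, coeff_rescale,
        coeff_rescale, coeff_exp]
      norm_num
    rw [this, one_mul]

end Eisenstein
end CharVar
end

noncomputable section
namespace CharVar

/-! ### Quasi-modularity of the coefficients. -/

section QuasiModular

open PowerSeries UpperHalfPlane ModularForm EisensteinSeries
open scoped MatrixGroups

/-- The normalised Eisenstein series of weight `k`, with rational coefficients. -/
def eisE (k : ℕ) : PowerSeries ℚ :=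
  PowerSeries.mk fun n =>
    if n = 0 then 1 else -(2 * k / bernoulli k) * ∑ d ∈ n.divisors, (d : ℚ) ^ (k - 1)

/-- For j > 0, Euler's formula for ζ(2j) has B_{2j} as a factor, and ζ does not vanish for real part
above 1. -/
theorem bernoulli_ne_zero_of_even {k : ℕ} (hk : Even k) : bernoulli k ≠ 0 := by
  obtain ⟨j, rfl⟩ := hk
  rw [← two_mul]
  intro h
  rcases Nat.eq_zero_or_pos j with rfl | hj
  · simp at h
  · have h1 := riemannZeta_two_mul_nat hj.ne'
    rw [h] at h1
    refine riemannZeta_ne_zero_of_one_lt_re (s := 2 * (j : ℂ)) ?_ (h1.trans (by simp))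
    have : (1 : ℝ) ≤ j := by exact_mod_cast hj
    simp
    linarith

theorem eisG_eq_smul_eisE {k : ℕ} (hk : Even k) (hk0 : k ≠ 0) :
    eisG k = (-bernoulli k / (2 * k)) • eisE k := by
  have h := bernoulli_ne_zero_of_even hk
  have h' : (k : ℚ) ≠ 0 := by exact_mod_cast hk0
  ext n
  rw [coeff_smul, eisG, eisE, coeff_mk, coeff_mk]
  split_ifs
  · simp
  · rw [smul_eq_mul]
    field_simp

theorem eisE_eq_smul_eisG {k : ℕ} (hk : Even k) (hk0 : k ≠ 0) :
    eisE k = (-bernoulli k / (2 * k))⁻¹ • eisG k := by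
  have h := bernoulli_ne_zero_of_even hk
  have h' : (k : ℚ) ≠ 0 := by exact_mod_cast hk0
  rw [eisG_eq_smul_eisE hk hk0, smul_smul, inv_mul_cancel₀, one_smul]
  exact div_ne_zero (neg_ne_zero.2 h) (mul_ne_zero two_ne_zero h')

theorem eisG_two_mem : eisG 2 ∈ quasiModular := Algebra.subset_adjoin (by simp)

theorem eisE_four_mem : eisE 4 ∈ quasiModular := by
  rw [eisE_eq_smul_eisG (by decide) (by decide)]
  exact Subalgebra.smul_mem _ (Algebra.subset_adjoin (by simp)) _

theorem eisE_six_mem : eisE 6 ∈ quasiModular := by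
  rw [eisE_eq_smul_eisG (by decide) (by decide)]
  exact Subalgebra.smul_mem _ (Algebra.subset_adjoin (by simp)) _

/-- A rational power series regarded as a complex one. -/
abbrev toComplex : PowerSeries ℚ →+* PowerSeries ℂ := PowerSeries.map (algebraMap ℚ ℂ)

theorem toComplex_injective : Function.Injective toComplex :=
  PowerSeries.map_injective _ (algebraMap ℚ ℂ).injective

theorem toComplex_smul (c : ℚ) (f : PowerSeries ℚ) :
    toComplex (c • f) = (c : ℂ) • toComplex f := by
  ext n
  simp

theorem qExpansion_E {k : ℕ} (hk : 3 ≤ k) (hk2 : Even k) :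
    qExpansion 1 (E hk) = toComplex (eisE k) := by
  ext n
  rw [E_qExpansion_coeff hk hk2, coeff_map, eisE, coeff_mk, ArithmeticFunction.sigma_apply]
  split_ifs <;> simp

/-- The rational expansion of the discriminant. -/
def deltaQ : PowerSeries ℚ := (1 / 1728 : ℚ) • (eisE 4 ^ 3 - eisE 6 ^ 2)

theorem deltaQ_mem : deltaQ ∈ quasiModular :=
  Subalgebra.smul_mem _ (Subalgebra.sub_mem _ (Subalgebra.pow_mem _ eisE_four_mem _)
    (Subalgebra.pow_mem _ eisE_six_mem _)) _

theorem qExpansion_sub_smul {k : ℤ} (c : ℂ) (f g : ModularForm 𝒮ℒ k) :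
    qExpansion 1 (f - c • g : ModularForm 𝒮ℒ k) = qExpansion 1 f - c • qExpansion 1 g := by
  have h := ModularForm.qExpansion_sub one_pos one_mem_strictPeriods_SL f (c • g)
  have h' := ModularForm.qExpansion_smul one_pos one_mem_strictPeriods_SL c g
  rw [← h']
  exact h

theorem qExpansion_discriminant : qExpansion 1 discriminant = toComplex deltaQ := by
  let f : ModularForm 𝒮ℒ 12 := ModularForm.mcast (by decide) (E₄.pow 3)
  let g : ModularForm 𝒮ℒ 12 := ModularForm.mcast (by decide) (E₆.pow 2)
  have h : discriminant = (1 / 1728 : ℂ) • ⇑(f - (1 : ℂ) • g) := by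
    ext z
    have hf : f z = E₄ z ^ 3 := by rw [mcast_apply, ModularForm.coe_pow, Pi.pow_apply]
    have hg : g z = E₆ z ^ 2 := by rw [mcast_apply, ModularForm.coe_pow, Pi.pow_apply]
    rw [discriminant_eq_E₄_cube_sub_E₆_sq, Pi.smul_apply, one_smul, _root_.sub_apply, hf, hg,
      smul_eq_mul]
    ring
  have hf : qExpansion 1 f = toComplex (eisE 4 ^ 3) := by
    rw [ModularForm.qExpansion_mcast, ModularForm.qExpansion_pow one_pos one_mem_strictPeriods_SL,
      qExpansion_E (by norm_num : 3 ≤ 4) (by decide), map_pow]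
  have hg : qExpansion 1 g = toComplex (eisE 6 ^ 2) := by
    rw [ModularForm.qExpansion_mcast, ModularForm.qExpansion_pow one_pos one_mem_strictPeriods_SL,
      qExpansion_E (by norm_num : 3 ≤ 6) (by decide), map_pow]
  rw [h, ModularForm.qExpansion_smul one_pos one_mem_strictPeriods_SL, qExpansion_sub_smul, hf, hg,
    deltaQ, toComplex_smul, one_smul, map_sub]
  simp

/-- The discriminant is T times a unit of ℚ[[T]], so dividing a rational series by it over ℂ gives a
rational series. -/
theorem exists_mul_deltaQ {P : PowerSeries ℚ} {R : PowerSeries ℂ}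
    (h : toComplex P = toComplex deltaQ * R) : ∃ Q, toComplex Q = R ∧ P = deltaQ * Q := by
  have hord := discriminant_qExpansion_order
  have h1 := discriminant_qExpansion_coeff_one
  have h0 : (qExpansion 1 discriminant).coeff 0 = 0 :=
    coeff_of_lt_order _ (by rw [hord]; simp)
  rw [qExpansion_discriminant, coeff_map] at h0 h1
  have h0' : constantCoeff deltaQ = 0 := by
    rw [← coeff_zero_eq_constantCoeff_apply]
    exact (algebraMap ℚ ℂ).injective (h0.trans (map_zero _).symm)
  obtain ⟨U, hU⟩ := X_dvd_iff.2 h0'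
  have hP0 : constantCoeff P = 0 := by
    apply (algebraMap ℚ ℂ).injective
    have := congrArg constantCoeff h
    rw [map_mul, hU, map_mul, PowerSeries.map_X, map_mul, constantCoeff_X, zero_mul,
      zero_mul] at this
    rw [map_zero, ← this, ← coeff_zero_eq_constantCoeff_apply, ← coeff_zero_eq_constantCoeff_apply,
      coeff_map]
  obtain ⟨P', hP'⟩ := X_dvd_iff.2 hP0
  have hU1 : constantCoeff U ≠ 0 := by
    intro hU0
    rw [hU, show (1 : ℕ) = 0 + 1 from rfl, coeff_succ_X_mul, coeff_zero_eq_constantCoeff_apply,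
      hU0] at h1
    simp at h1
  have hinv : U * U⁻¹ = 1 := PowerSeries.mul_inv_cancel _ hU1
  rw [hU, hP', map_mul, map_mul, PowerSeries.map_X, mul_assoc] at h
  have h2 := mul_left_cancel₀ X_ne_zero h
  refine ⟨U⁻¹ * P', ?_, ?_⟩
  · rw [map_mul, h2, ← mul_assoc, ← map_mul, mul_comm U⁻¹, hinv, map_one, one_mul]
  · rw [hU, hP', mul_assoc, ← mul_assoc U, hinv, one_mul]

/-- A nonnegative even weight other than 2 is 4a or 4a + 6; negative weights, odd weights and weight
2 carry only the zero form. -/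
theorem eq_zero_or_exists_weight {k : ℤ} (f : ModularForm 𝒮ℒ k) :
    f = 0 ∨ ∃ a b : ℕ, (a * 4 + b * 6 : ℤ) = k := by
  rcases lt_or_ge k 0 with hk | hk
  · exact .inl (rank_zero_iff_forall_zero.mp (levelOne_neg_weight_rank_zero hk) f)
  rcases Int.even_or_odd k with he | ho
  · obtain ⟨j, rfl⟩ := he
    by_cases h1 : j = 1
    · subst h1
      exact .inl (rank_zero_iff_forall_zero.mp levelOne_weight_two_rank_zero f)
    · right
      rcases Int.even_or_odd' j with ⟨i, rfl | rfl⟩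
      · exact ⟨i.toNat, 0, by omega⟩
      · exact ⟨(i - 1).toNat, 1, by omega⟩
  · exact .inl (levelOne_odd_weight_eq_zero ho f)

/-- A modular form of level one with rational expansion is a rational polynomial in
`E₄` and `E₆`. -/
theorem mem_quasiModular_of_qExpansion (N : ℕ) {k : ℤ} (hk : k < N) (f : ModularForm 𝒮ℒ k)
    {P : PowerSeries ℚ} (hP : qExpansion 1 f = toComplex P) : P ∈ quasiModular := by
  induction N generalizing k P with
  | zero =>
    have hf : f = 0 :=
      rank_zero_iff_forall_zero.mp (levelOne_neg_weight_rank_zero (by simpa using hk)) f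
    rw [hf, FunLike.coe_zero, qExpansion_zero] at hP
    rw [toComplex_injective (hP.symm.trans (map_zero _).symm)]
    exact zero_mem _
  | succ N ih =>
    rcases eq_zero_or_exists_weight f with hf | ⟨a, b, hab⟩
    · rw [hf, FunLike.coe_zero, qExpansion_zero] at hP
      rw [toComplex_injective (hP.symm.trans (map_zero _).symm)]
      exact zero_mem _
    · set c := constantCoeff P with hc
      -- This monomial has constant term 1, so f - c m has constant term 0 and is the discriminant
      -- times a form of weight k - 12. The constant c is rational, as P is.
      let m : ModularForm 𝒮ℒ k := ModularForm.mcast hab ((E₄.pow a).mul (E₆.pow b))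
      have hm : qExpansion 1 m = toComplex (eisE 4 ^ a * eisE 6 ^ b) := by
        rw [ModularForm.qExpansion_mcast,
          ModularForm.qExpansion_mul one_pos one_mem_strictPeriods_SL,
          ModularForm.qExpansion_pow one_pos one_mem_strictPeriods_SL,
          ModularForm.qExpansion_pow one_pos one_mem_strictPeriods_SL,
          qExpansion_E (by norm_num : 3 ≤ 4) (by decide),
          qExpansion_E (by norm_num : 3 ≤ 6) (by decide)]
        simp
      have hg : qExpansion 1 (f - (c : ℂ) • m : ModularForm 𝒮ℒ k) =
          toComplex (P - c • (eisE 4 ^ a * eisE 6 ^ b)) := by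
        rw [qExpansion_sub_smul, hP, hm, map_sub, toComplex_smul]
      have h0 : (qExpansion 1 (f - (c : ℂ) • m : ModularForm 𝒮ℒ k)).coeff 0 = 0 := by
        have h4 : constantCoeff (eisE 4) = 1 := by
          rw [← coeff_zero_eq_constantCoeff_apply, eisE, coeff_mk, if_pos rfl]
        have h6 : constantCoeff (eisE 6) = 1 := by
          rw [← coeff_zero_eq_constantCoeff_apply, eisE, coeff_mk, if_pos rfl]
        rw [hg, coeff_map, coeff_zero_eq_constantCoeff_apply, map_sub, smul_eq_C_mul, map_mul,
          map_mul, map_pow, map_pow, h4, h6]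
        simp [hc]
      have hdiv := qExpansion_eq_qExpansion_discriminant_mul _ h0
      rw [hg, qExpansion_discriminant] at hdiv
      obtain ⟨Q, hQ, hPQ⟩ := exists_mul_deltaQ hdiv
      have hQm := ih (by push_cast at hk; omega) _ hQ.symm
      rw [sub_eq_iff_eq_add] at hPQ
      rw [hPQ]
      exact Subalgebra.add_mem _ (Subalgebra.mul_mem _ deltaQ_mem hQm)
        (Subalgebra.smul_mem _ (Subalgebra.mul_mem _ (Subalgebra.pow_mem _ eisE_four_mem _)
          (Subalgebra.pow_mem _ eisE_six_mem _)) _)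

theorem eisG_mem_quasiModular {k : ℕ} (hk : Even k) (hk0 : k ≠ 0) : eisG k ∈ quasiModular := by
  by_cases h2 : k = 2
  · rw [h2]
    exact eisG_two_mem
  · have h3 : 3 ≤ k := by
      obtain ⟨j, rfl⟩ := hk
      omega
    rw [eisG_eq_smul_eisE hk hk0]
    exact Subalgebra.smul_mem _
      (mem_quasiModular_of_qExpansion (k + 1) (by simp) (E h3) (qExpansion_E h3 hk)) _

/-- The equation F' = E' F for F = exp E gives (m + 1) F_{m+1} as a sum of products of earlier F_i
with multiples of Eisenstein series. -/
theorem coeff_expOf_eisExponent_mem (m : ℕ) : coeff m (expOf eisExponent) ∈ quasiModular := by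
  induction m using Nat.strong_induction_on with
  | _ m ih =>
    cases m with
    | zero =>
      rw [coeff_zero_eq_constantCoeff_apply, constantCoeff_expOf_eisExponent]
      exact one_mem _
    | succ m =>
      have h := congrArg (coeff m) derivative_expOf_eisExponent
      rw [coeff_derivative, coeff_mul] at h
      have hmem : coeff (m + 1) (expOf eisExponent) * ((m : PowerSeries ℚ) + 1) ∈ quasiModular := by
        rw [h]
        refine Subalgebra.sum_mem _ fun p hp => ?_
        rw [Finset.HasAntidiagonal.mem_antidiagonal] at hp
        refine Subalgebra.mul_mem _ ?_ (ih _ (by omega))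
        rw [coeff_derivative_eisExponent]
        split_ifs with hodd
        · exact Subalgebra.smul_mem _ (eisG_mem_quasiModular hodd.add_one (Nat.succ_ne_zero _)) _
        · exact zero_mem _
      have hm : ((m : ℚ) + 1) ≠ 0 := by positivity
      have hsmul : coeff (m + 1) (expOf eisExponent) = ((m : ℚ) + 1)⁻¹ •
          (coeff (m + 1) (expOf eisExponent) * ((m : PowerSeries ℚ) + 1)) := by
        rw [mul_comm, show ((m : PowerSeries ℚ) + 1) = C ((m : ℚ) + 1) by simp, ← smul_eq_C_mul,
          smul_smul, inv_mul_cancel₀ hm, one_smul]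
      rw [hsmul]
      exact Subalgebra.smul_mem _ hmem _

theorem coeff_map_C_mul_expOf_mem (s : PowerSeries ℚ) (m : ℕ) :
    coeff m (PowerSeries.map C s * expOf eisExponent) ∈ quasiModular := by
  rw [coeff_mul]
  refine Subalgebra.sum_mem _ fun p hp => Subalgebra.mul_mem _ ?_ (coeff_expOf_eisExponent_mem _)
  rw [coeff_map]
  exact Subalgebra.algebraMap_mem _ _

end QuasiModular
end CharVar
end

noncomputable section
namespace CharVar

/-! ### Specialization of ℍ_{(n-1,1)} on the curve zw = 1. -/

section Specialisation

open PowerSeries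

variable {L : Type*} [Field L] [Algebra ℚ L] {a : Fin 2 → L}

/-- The series with constant term 1 lifts to one over the ring `valuePairs a` with constant term the
pair (1, 1). It is therefore invertible there, although that ring need not be a field, and the
quotient projects to both sides. -/
theorem HasValue.coeff_mul_inv {x y : PowerSeries QZW} {x' y' : PowerSeries L}
    (hx : ∀ n, HasValue a (coeff n x) (coeff n x')) (hy : ∀ n, HasValue a (coeff n y) (coeff n y'))
    (h1 : constantCoeff y = 1) (h1' : constantCoeff y' = 1) (n : ℕ) :
    HasValue a (coeff n (x * y⁻¹)) (coeff n (x' * y'⁻¹)) := by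
  simp only [hasValue_iff] at hx hy
  choose s hs hs' using hx
  choose t ht ht' using hy
  have ht0 : t 0 = 1 := by
    refine Subtype.ext (Prod.ext ?_ ?_)
    · exact (ht 0).trans ((coeff_zero_eq_constantCoeff_apply y).trans h1)
    · exact (ht' 0).trans ((coeff_zero_eq_constantCoeff_apply y').trans h1')
  have hst : PowerSeries.mk s * invOfUnit (PowerSeries.mk t) 1 * PowerSeries.mk t =
      PowerSeries.mk s := by
    rw [mul_assoc, mul_comm (invOfUnit _ _), mul_invOfUnit _ _ ?_, mul_one]
    rw [← coeff_zero_eq_constantCoeff_apply, coeff_mk, ht0, Units.val_one]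
  rw [hasValue_iff]
  refine ⟨coeff n (PowerSeries.mk s * invOfUnit (PowerSeries.mk t) 1), ?_, ?_⟩
  · rw [← coeff_map]
    congr 1
    rw [PowerSeries.eq_mul_inv_iff_mul_eq (by rw [h1]; exact one_ne_zero)]
    rw [show y = PowerSeries.map (pairFun a) (PowerSeries.mk t) by ext; simp [ht],
      show x = PowerSeries.map (pairFun a) (PowerSeries.mk s) by ext; simp [hs],
      ← (PowerSeries.map (pairFun a)).map_mul, hst]
  · rw [← coeff_map]
    congr 1
    rw [PowerSeries.eq_mul_inv_iff_mul_eq (by rw [h1']; exact one_ne_zero)]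
    rw [show y' = PowerSeries.map (pairVal a) (PowerSeries.mk t) by ext; simp [ht'],
      show x' = PowerSeries.map (pairVal a) (PowerSeries.mk s) by ext; simp [hs'],
      ← (PowerSeries.map (pairVal a)).map_mul, hst]

theorem constantCoeff_partitionSeries (R : Type*) [CommRing R] :
    constantCoeff (partitionSeries R) = 1 := by
  rw [← coeff_zero_eq_constantCoeff_apply, partitionSeries, coeff_mk]
  simp

theorem constantCoeff_contentSeries {R : Type*} [CommRing R] (q qi : R) :
    constantCoeff (contentSeries q qi) = 0 := by
  rw [← coeff_zero_eq_constantCoeff_apply, contentSeries, coeff_mk]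
  simp [cells]

theorem hasValue_coeff_evalOneSeries [CharZero L] (h01 : a 0 * a 1 = 1)
    (hq : ∀ k : ℕ, 0 < k → (a 0 ^ 2) ^ k ≠ 1) (n : ℕ) :
    HasValue a (coeff n (evalOneSeries (Omega 1))) (coeff n (partitionSeries L)) := by
  rw [evalOneSeries, coeff_map, Omega, coeff_mk, map_sum, partitionSeries, coeff_mk]
  refine HasValue.sum _ fun l _ => ?_
  rw [map_mul, MvPolynomial.eval_C, ← mul_one (1 : L)]
  exact (hasValue_hookFun h01 hq l).mul (hasValue_eval_macH h01 hq l).1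

theorem hasValue_coeff_hookCoeffSeries [CharZero L] (h01 : a 0 * a 1 = 1)
    (hq : ∀ k : ℕ, 0 < k → (a 0 ^ 2) ^ k ≠ 1) (n : ℕ) :
    HasValue a (coeff n (hookCoeffSeries (Omega 1)))
      (coeff n (contentSeries (a 0 ^ 2) (a 0 ^ 2)⁻¹)) := by
  rw [hookCoeffSeries, coeff_mk, Omega, coeff_mk, map_sum, contentSeries, coeff_mk]
  refine HasValue.sum _ fun l _ => ?_
  rw [← MvPolynomial.smul_eq_C_mul, map_smul, smul_eq_mul, ← one_mul (∑ s ∈ cells l, _)]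
  exact (hasValue_hookFun h01 hq l).mul (hasValue_eval_macH h01 hq l).2

/-- The value of `ℍ_{(n,1)}` on the curve `z w = 1`. -/
theorem hasValue_bbH [CharZero L] (h01 : a 0 * a 1 = 1)
    (hq : ∀ k : ℕ, 0 < k → (a 0 ^ 2) ^ k ≠ 1) (n : ℕ) :
    HasValue a (bbH 1 (hookPartition n)) ((a 0 ^ 2 - 1) * (1 - (a 0 ^ 2)⁻¹) *
      coeff (n + 1) (contentSeries (a 0 ^ 2) (a 0 ^ 2)⁻¹ * (partitionSeries L)⁻¹)) := by
  have hw : a 1 ^ 2 = (a 0 ^ 2)⁻¹ := by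
    refine eq_inv_of_mul_eq_one_right ?_
    rw [← mul_pow, h01, one_pow]
  rw [bbH_eq, ← hw]
  refine (((hasValue_zv.pow 2).sub .one).mul (HasValue.one.sub (hasValue_wv.pow 2))).mul ?_
  rw [hw]
  refine HasValue.coeff_mul_inv (hasValue_coeff_hookCoeffSeries h01 hq)
    (hasValue_coeff_evalOneSeries h01 hq) ?_ (constantCoeff_partitionSeries L) _
  rw [← coeff_zero_eq_constantCoeff_apply, evalOneSeries, coeff_map,
    coeff_zero_eq_constantCoeff_apply, constantCoeff_Omega, map_one]

theorem map_partitionSeries {R S : Type*} [CommRing R] [CommRing S] (φ : R →+* S) :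
    PowerSeries.map φ (partitionSeries R) = partitionSeries S := by
  ext n
  simp [partitionSeries]

theorem map_contentSeries {R S : Type*} [CommRing R] [CommRing S] (φ : R →+* S) (q qi : R) :
    PowerSeries.map φ (contentSeries q qi) = contentSeries (φ q) (φ qi) := by
  ext n
  simp [contentSeries]

end Specialisation

/-! ### The point (e^(u/2), e^(-u/2)) and the conclusion. -/

section EulerPoint

open PowerSeries

theorem eulerPoint_mul : eulerPoint 0 * eulerPoint 1 = 1 := by
  change expU (1 / 2) * expU (-1 / 2) = 1
  rw [expU, expU, ← map_mul, rescale_exp_mul]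
  norm_num

theorem eulerPoint_sq : eulerPoint 0 ^ 2 = HahnSeries.ofPowerSeries ℤ ℚ expQ := by
  change expU (1 / 2) ^ 2 = _
  rw [expU, ← map_pow, pow_two, rescale_exp_mul]
  norm_num

theorem eulerPoint_sq_pow_ne_one (k : ℕ) (hk : 0 < k) : (eulerPoint 0 ^ 2) ^ k ≠ 1 := by
  rw [eulerPoint_sq, ← map_pow, exp_pow_eq_rescale_exp]
  intro h
  have h' := HahnSeries.ofPowerSeries_injective (h.trans (map_one _).symm)
  have := congrArg (coeff 1) h'
  rw [coeff_rescale, coeff_exp, coeff_one] at this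
  simp at this
  omega

theorem eulerPoint_sq_inv : (eulerPoint 0 ^ 2)⁻¹ = HahnSeries.ofPowerSeries ℤ ℚ expNegQ := by
  refine inv_eq_of_mul_eq_one_right ?_
  have := rescale_exp_mul 1 (-1)
  rw [show rescale (1 : ℚ) (exp ℚ) = expQ by simp] at this
  rw [eulerPoint_sq, ← map_mul, expNegQ, this]
  norm_num

theorem charZero_laurentSeries : CharZero (LaurentSeries ℚ) :=
  charZero_of_injective_algebraMap (algebraMap ℚ (LaurentSeries ℚ)).injective

theorem hasValue_bbH_eulerPoint (n : ℕ) : HasValue eulerPoint (bbH 1 (hookPartition n))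
    ((eulerPoint 0 ^ 2 - 1) * (1 - (eulerPoint 0 ^ 2)⁻¹) * coeff (n + 1)
      (contentSeries (eulerPoint 0 ^ 2) (eulerPoint 0 ^ 2)⁻¹ *
        (partitionSeries (LaurentSeries ℚ))⁻¹)) :=
  @hasValue_bbH _ _ _ _ charZero_laurentSeries eulerPoint_mul eulerPoint_sq_pow_ne_one n

theorem partitionSeries_mul_hookSeries :
    partitionSeries (LaurentSeries ℚ) * hookSeries = partitionSeries (LaurentSeries ℚ) +
      C ((eulerPoint 0 ^ 2 - 1) * (1 - (eulerPoint 0 ^ 2)⁻¹)) *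
        contentSeries (eulerPoint 0 ^ 2) (eulerPoint 0 ^ 2)⁻¹ := by
  have h1 : constantCoeff (partitionSeries (LaurentSeries ℚ)) ≠ 0 := by
    rw [constantCoeff_partitionSeries]
    exact one_ne_zero
  have h : hookSeries = 1 + C ((eulerPoint 0 ^ 2 - 1) * (1 - (eulerPoint 0 ^ 2)⁻¹)) *
      (contentSeries (eulerPoint 0 ^ 2) (eulerPoint 0 ^ 2)⁻¹ *
        (partitionSeries (LaurentSeries ℚ))⁻¹) := by
    rw [hookSeries]
    congr 1
    ext1 n
    cases n with
    | zero =>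
      rw [coeff_zero_X_mul, coeff_C_mul, coeff_zero_eq_constantCoeff_apply, map_mul,
        constantCoeff_contentSeries, zero_mul, mul_zero]
    | succ n =>
      rw [coeff_succ_X_mul, coeff_mk, coeff_C_mul, (hasValue_bbH_eulerPoint n).evalAt]
  have h2 := PowerSeries.mul_inv_cancel _ h1
  rw [h]
  linear_combination (C ((eulerPoint 0 ^ 2 - 1) * (1 - (eulerPoint 0 ^ 2)⁻¹)) *
    contentSeries (eulerPoint 0 ^ 2) (eulerPoint 0 ^ 2)⁻¹) * h2

/-- After multiplication by `partitionSeries` the equation for `hookSeries` has coefficients in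
ℚ[[u]] and is solvable there. Uniqueness over ℚ((u)) shows that `hookSeries` comes from this
solution, so it has no pole at u = 0. -/
theorem hookSeries_eq_map : hookSeries = PowerSeries.map (HahnSeries.ofPowerSeries ℤ ℚ)
    (C sinhQuot * swapVars (expOf eisExponent)) := by
  have hinv : partitionSeries (PowerSeries ℚ) * invOfUnit (partitionSeries (PowerSeries ℚ)) 1 = 1 :=
    mul_invOfUnit _ _ (by rw [constantCoeff_partitionSeries, Units.val_one])
  obtain ⟨H, hH⟩ : ∃ H, partitionSeries (PowerSeries ℚ) * H = partitionSeries (PowerSeries ℚ) +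
      C ((expQ - 1) * (1 - expNegQ)) * contentSeries expQ expNegQ :=
    ⟨_, by rw [← mul_assoc, hinv, one_mul]⟩
  rw [← eq_sinhQuot_mul_swapVars hH]
  have hne : partitionSeries (LaurentSeries ℚ) ≠ 0 := by
    intro h0
    have := constantCoeff_partitionSeries (LaurentSeries ℚ)
    rw [h0, map_zero] at this
    exact zero_ne_one this
  refine mul_left_cancel₀ hne ?_
  rw [partitionSeries_mul_hookSeries, eulerPoint_sq_inv, eulerPoint_sq]
  have := congrArg (PowerSeries.map (HahnSeries.ofPowerSeries ℤ ℚ)) hH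
  rw [map_mul, map_partitionSeries, map_add, map_partitionSeries, map_mul, map_contentSeries,
    map_C] at this
  rw [this]
  simp

theorem map_swapVars (f : PowerSeries (PowerSeries ℚ)) :
    PowerSeries.map (HahnSeries.ofPowerSeries ℤ ℚ) (swapVars f) = swapSeries f := by
  ext1 n
  rw [coeff_map, swapSeries, coeff_mk]
  congr 1
  ext m
  rw [coeff_coeff_swapVars, coeff_mk]

theorem ofPowerSeries_sinhQuot : HahnSeries.ofPowerSeries ℤ ℚ sinhQuot =
    (HahnSeries.single (1 : ℤ) (1 : ℚ) : LaurentSeries ℚ)⁻¹ * (expU (1 / 2) - expU (-1 / 2)) := by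
  have hne : (HahnSeries.single (1 : ℤ) (1 : ℚ) : LaurentSeries ℚ) ≠ 0 :=
    HahnSeries.single_ne_zero one_ne_zero
  rw [eq_inv_mul_iff_mul_eq₀ hne, ← HahnSeries.ofPowerSeries_X, ← map_mul, X_mul_sinhQuot, map_sub,
    expU, expU]

/-- The factor `sinhQuot` does not involve T, so it only forms rational combinations of the
coefficients of the exponential; negative powers of u do not occur. -/
theorem coeffU_hookSeries_mem (m : ℤ) : coeffU m hookSeries ∈ quasiModular := by
  have hswap : C sinhQuot * swapVars (expOf eisExponent) =
      swapVars (PowerSeries.map C sinhQuot * expOf eisExponent) := by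
    rw [swapVars.map_mul, swapVars_map_C]
  rw [hookSeries_eq_map, hswap]
  rcases lt_or_ge m 0 with hm | hm
  · have : coeffU m (PowerSeries.map (HahnSeries.ofPowerSeries ℤ ℚ)
        (swapVars (PowerSeries.map C sinhQuot * expOf eisExponent))) = 0 := by
      ext n
      rw [coeffU, coeff_mk, coeff_map, map_zero]
      rw [PowerSeries.coeff_coe, if_pos hm]
    rw [this]
    exact zero_mem _
  · lift m to ℕ using hm
    have : coeffU m (PowerSeries.map (HahnSeries.ofPowerSeries ℤ ℚ)
        (swapVars (PowerSeries.map C sinhQuot * expOf eisExponent))) =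
        coeff m (PowerSeries.map C sinhQuot * expOf eisExponent) := by
      ext n
      rw [coeffU, coeff_mk, coeff_map, LaurentSeries.coeff_coe_powerSeries, coeff_coeff_swapVars]
    rw [this]
    exact coeff_map_C_mul_expOf_mem _ _

end EulerPoint
end CharVar
end

theorem mainTheorem6 :
    (∀ n : ℕ, CharVar.RegularAt (CharVar.bbH 1 (CharVar.hookPartition n)) CharVar.eulerPoint) ∧
    CharVar.hookSeries =
      PowerSeries.C ((HahnSeries.single (1 : ℤ) (1 : ℚ) : LaurentSeries ℚ)⁻¹ *
          (CharVar.expU (1 / 2) - CharVar.expU (-1 / 2))) *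
        CharVar.swapSeries (CharVar.expOf CharVar.eisExponent) ∧
    ∀ m : ℤ, CharVar.coeffU m CharVar.hookSeries ∈ CharVar.quasiModular := by
  refine ⟨fun n => (CharVar.hasValue_bbH_eulerPoint n).regularAt, ?_, CharVar.coeffU_hookSeries_mem⟩
  rw [CharVar.hookSeries_eq_map, map_mul, PowerSeries.map_C, CharVar.map_swapVars,
    CharVar.ofPowerSeries_sinhQuot]
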